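/- Let $M$ be a smooth finite-dimensional manifold (Hausdorff, $\sigma$-compact) and let $\mathbf A=(A,v_{\mathbf A})\to M$ be a smooth special affine bundle: an affine bundle with a nowhere-vanishing section $v_{\mathbf A}$ of its model vector bundle $\mathsf V(\mathbf A)$, locally isomorphic to $U\times(F\times\mathbb R)$ with $v_{\mathbf A}=(0,1)$. Its special dual $\mathbf A^\#$ consists of the affine functions $\varphi$ on the fibres of $A$ whose linear part $\varphi_{\mathsf v}$ satisfies $\varphi_{\mathsf v}(v_{\mathbf A})=1$, with distinguished section the constant function $1_A$. Put $\underline{\mathbf A}=A/\langle v_{\mathbf A}\rangle$ and $N=\underline{\mathbf A^\#}=\mathbf A^\#/\langle 1_A\rangle$. Let $\mathsf{AV}(\mathbf A)$ be the bundle $A\to\underline{\mathbf A}$ with distinguished vector $-v_{\mathbf A}$, so that differences of its sections are functions on $\underline{\mathbf A}$. Its phase bundle $\mathsf P\mathbf A$ over $\underline{\mathbf A}$ consists of the affine differentials $\mathbf d\sigma(b)$, i.e. the classes of pairs $(b,\sigma)$, $\sigma$ a section of $\mathsf{AV}(\mathbf A)$, modulo $(b,\sigma)\sim(b,\sigma')$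 iff $\mathrm d(\sigma'-\sigma)(b)=0$; it is an affine bundle modelled on $\mathsf T^*\underline{\mathbf A}$. In local coordinates $(x,y,p,\xi)$, where $p=\partial_x\sigma$, $\xi=\partial_y\sigma$, it is a double affine bundle with projections $(x,y)$ onto $\underline{\mathbf A}$ and $(x,\xi)$ onto $N$; similarly $\mathsf P\mathbf A^\#$, with coordinates $(x,\xi,p,y)$, has projections onto $N$ and onto $\underline{\mathbf A}$, and $\mathsf TN$, with coordinates $(x,\xi,\dot x,\dot\xi)$, has projections onto $N$ and onto $\mathsf TM$. A section $a$ of $\mathbf A$ defines the section $\iota^\#_a$ of $\mathsf{AV}(\mathbf A^\#)$, the zero set of $\varphi\mapsto\varphi(a)$, and a section $X$ of $\mathsf V(\mathbf A)$ defines the function $\iota^\#_X([\varphi])=\varphi_{\mathsf v}(X)$ on $N$. A special affgebroid on $\mathbf A$ is a morphism of double affine bundles $\mathcal E:\mathsf P\mathbf A\to\mathsf TN$ covering the identity on $N$ (and some map $\underline{\mathbf A}\to\mathsf TM$): it is smooth and affine on the fibres of both projections. (1) There is a canonical bijection $\mathcal R:\mathsf P\mathbf A\to\mathsf P\mathbf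 A^\#$, given in all local coordinates by $(x,y,p,\xi)\mapsto(x,\xi,-p,y)$. The formula $\mathcal E=\widetilde\Gamma_{\mathcal E}\circ\mathcal R$ defines a bijection $\mathcal E\mapsto\Gamma_{\mathcal E}$ between special affgebroids on $\mathbf A$ and affine tensors, i.e. smooth sections $\Gamma$ of $(\mathsf P\mathbf A^\#)^\dagger\otimes_N\mathsf TN$ (with $(\mathsf P\mathbf A^\#)^\dagger$ the bundle of affine functions on the fibres of $\mathsf P\mathbf A^\#\to N$) whose contraction $\widetilde\Gamma:\mathsf P\mathbf A^\#\to\mathsf TN$ is a morphism of double affine bundles over the identity of $N$. The bracket $\{\sigma,f\}_{\mathcal E}=\langle\Gamma_{\mathcal E},\mathbf d\sigma\otimes\mathrm df\rangle$ is an affine-closed biderivation $\mathsf{Sec}(\mathsf{AV}(\mathbf A^\#))\times C^\infty(N)\to C^\infty(N)$ (an affine derivation in $\sigma$, a derivation in $f$, and $\{\sigma,f\}_{\mathcal E}$ is a fibrewise affine function if $\sigma$ and $f$ are fibrewise affine); it determines $\mathcal E$, and if $\operatorname{rank}\mathbf A\ge 2$ every affine-closed biderivation arises in this way. (2) There is a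 bijection between special affgebroids $\mathcal E$ on $\mathbf A$ and triples consisting of an affine-linear bracket $[\cdot,\cdot]_{\mathcal E}:\mathsf{Sec}(\mathbf A)\times\mathsf{Sec}(\mathsf V(\mathbf A))\to\mathsf{Sec}(\mathsf V(\mathbf A))$ which is special, i.e. $[a,u+v_{\mathbf A}]_{\mathcal E}=[a+v_{\mathbf A},u]_{\mathcal E}=[a,u]_{\mathcal E}$, an affine bundle morphism $\mathcal E_l:A\to\mathsf TM$ and a vector bundle morphism $\mathcal E_r:\mathsf V(\mathbf A)\to\mathsf TM$ over the identity of $M$ (left and right anchors), such that $$[a,gY]_{\mathcal E}=g[a,Y]_{\mathcal E}+(\mathcal E_l\circ a)(g)\,Y,\qquad [a+fX,Y]_{\mathcal E}=(1-f)[a,Y]_{\mathcal E}+f[a+X,Y]_{\mathcal E}-(\mathcal E_r\circ Y)(f)\,X$$ for all sections $a$ of $\mathbf A$ and $X,Y$ of $\mathsf V(\mathbf A)$ and all $f,g\in C^\infty(M)$. The left anchor $\mathcal E_l$ is the composition of $A\to\underline{\mathbf A}$ with the map $\underline{\mathbf A}\to\mathsf TM$ covered by $\mathcal E$. (3) The three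 objects are related by $$\langle\Gamma_{\mathcal E},\mathbf d\iota^\#_a\otimes\mathrm d\iota^\#_X\rangle=\iota^\#_{[a,X]_{\mathcal E}}=\{\iota^\#_a,\iota^\#_X\}_{\mathcal E}$$ for all $a\in\mathsf{Sec}(\mathbf A)$, $X\in\mathsf{Sec}(\mathsf V(\mathbf A))$, and this formula determines the bracket with its anchors from $\Gamma_{\mathcal E}$, the tensor $\Gamma_{\mathcal E}$ from the bracket, and the biderivation from the bracket. (4) The special affgebroid is a special Lie affgebroid if and only if $\Gamma_{\mathcal E}$ is an aff-Poisson tensor. Here the first means that $[\cdot,\cdot]_{\mathcal E}$ is the affine-linear part of a skew-symmetric bi-affine bracket $\mathsf{Sec}(\mathbf A)\times\mathsf{Sec}(\mathbf A)\to\mathsf{Sec}(\mathsf V(\mathbf A))$ that satisfies the Jacobi identity $[a,[b,c]]^2_{\mathsf v}+[b,[c,a]]^2_{\mathsf v}+[c,[a,b]]^2_{\mathsf v}=0$, for which $v_{\mathbf A}$ is central, with anchor $\mathcal E_l$; the second means that $\{\cdot,\cdot\}_{\mathcal E}$ is the affine-linear part of an aff-Poisson bracket, i.e. of a skew-symmetric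 bi-affine bracket $\mathsf{Sec}(\mathsf{AV}(\mathbf A^\#))\times\mathsf{Sec}(\mathsf{AV}(\mathbf A^\#))\to C^\infty(N)$ that satisfies the same Jacobi identity and is a derivation (a vector field) in its linear argument. ($[\cdot,\cdot]^2_{\mathsf v}$ is the linear part with respect to the second argument.) -/

import Mathlib

open Set
open scoped Manifold ContDiff Topology TensorProduct

noncomputable section

/-- A smooth special affine bundle over `M` with typical fibre the special affine space
`F × ℝ` (distinguished vector `(0, 1)`): a family of affine spaces `Fib x`, modelled on vector
spaces `Mod x` with distinguished vectors `v x`, and a bundle atlas of local trivializations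
by isomorphisms of special affine spaces with smooth transition maps.  Only the values of
`triv i` over the open set `U i` matter. -/
structure SpecialAffineBundle (E : Type*) [NormedAddCommGroup E] [NormedSpace ℝ E]
    (M : Type*) [TopologicalSpace M] [ChartedSpace E M]
    (F : Type*) [NormedAddCommGroup F] [NormedSpace ℝ F] where
  /-- the fibres `A_x` -/
  Fib : M → Type*
  /-- the fibres of the model vector bundle `V(A)` -/
  Mod : M → Type*
  [instGroup : ∀ x, AddCommGroup (Mod x)]
  [instModule : ∀ x, Module ℝ (Mod x)]
  [instTorsor : ∀ x, AddTorsor (Mod x) (Fib x)]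
  /-- the distinguished section of `V(A)` -/
  v : ∀ x, Mod x
  /-- index set of the bundle atlas -/
  Idx : Type*
  U : Idx → Set M
  isOpen_U : ∀ i, IsOpen (U i)
  idx : M → Idx
  mem_U : ∀ x, x ∈ U (idx x)
  triv : Idx → ∀ x, Fib x ≃ᵃ[ℝ] F × ℝ
  triv_v : ∀ i x, (triv i x).linear (v x) = (0, 1)
  smooth_trans : ∀ i j, ContMDiffOn (𝓘(ℝ, E).prod 𝓘(ℝ, F × ℝ)) 𝓘(ℝ, F × ℝ) ∞
    (fun q : M × (F × ℝ) => triv j q.1 ((triv i q.1).symm q.2)) ((U i ∩ U j) ×ˢ univ)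

namespace SpecialAffineBundle

attribute [instance] SpecialAffineBundle.instGroup SpecialAffineBundle.instModule
  SpecialAffineBundle.instTorsor

variable {E : Type*} [NormedAddCommGroup E] [NormedSpace ℝ E]
  {M : Type*} [TopologicalSpace M] [ChartedSpace E M]
  {F : Type*} [NormedAddCommGroup F] [NormedSpace ℝ F]
  (A : SpecialAffineBundle E M F)

/-! ### The quotient by the distinguished section -/

/-- Two points of a fibre are equivalent if they differ by a multiple of the distinguished
vector. -/
def lineSetoid (x : M) : Setoid (A.Fib x) where
  r a b := ∃ t : ℝ, b = t • A.v x +ᵥ a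
  iseqv :=
    { refl := fun a => ⟨0, by simp⟩
      symm := by
        rintro a b ⟨t, rfl⟩
        exact ⟨-t, by rw [vadd_vadd]; simp⟩
      trans := by
        rintro a b c ⟨t, rfl⟩ ⟨s, rfl⟩
        exact ⟨s + t, by rw [vadd_vadd, add_smul]⟩ }

/-- The fibre over `x` of the quotient bundle `A / ⟨v⟩`. -/
def QFib (x : M) : Type _ := Quotient (A.lineSetoid x)

/-- The class of a point of the fibre in the quotient `A / ⟨v⟩`. -/
def qmk {x : M} (a : A.Fib x) : A.QFib x := Quotient.mk (A.lineSetoid x) a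

/-- The total space of the quotient bundle `A / ⟨v⟩`. -/
def Base : Type _ := Σ x : M, A.QFib x

theorem triv_smul_v_vadd (i : A.Idx) (x : M) (t : ℝ) (a : A.Fib x) :
    A.triv i x (t • A.v x +ᵥ a) = ((A.triv i x a).1, (A.triv i x a).2 + t) := by
  rw [AffineEquiv.map_vadd, map_smul, A.triv_v]
  ext <;> simp [add_comm]

theorem qmk_eq {x : M} (a b : A.Fib x) :
    A.qmk a = A.qmk b ↔ ∃ t : ℝ, b = t • A.v x +ᵥ a :=
  Quotient.eq (r := A.lineSetoid x)

/-- The fibre coordinate on `A / ⟨v⟩` induced by a local trivialization of `A`. -/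
def qcoord (i : A.Idx) (x : M) : A.QFib x → F :=
  Quotient.lift (fun a : A.Fib x => (A.triv i x a).1) (by
    rintro a b ⟨t, rfl⟩
    rw [A.triv_smul_v_vadd])

@[simp] theorem qcoord_qmk (i : A.Idx) (x : M) (a : A.Fib x) :
    A.qcoord i x (A.qmk a) = (A.triv i x a).1 := rfl

/-- The inverse of the fibre coordinate on `A / ⟨v⟩`. -/
def qinv (i : A.Idx) (x : M) (f : F) : A.QFib x := A.qmk ((A.triv i x).symm (f, 0))

@[simp] theorem qcoord_qinv (i : A.Idx) (x : M) (f : F) : A.qcoord i x (A.qinv i x f) = f := by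
  simp [qinv]

@[simp] theorem qinv_qcoord (i : A.Idx) (x : M) (b : A.QFib x) :
    A.qinv i x (A.qcoord i x b) = b := by
  induction b using Quotient.inductionOn with
  | _ a =>
    refine (A.qmk_eq _ _).2 ⟨(A.triv i x a).2, ?_⟩
    apply (A.triv i x).injective
    rw [A.triv_smul_v_vadd]
    simp [qcoord]

/-- The domain in `M` of local coordinates: a trivializing set intersected with the domain of a
chart of `M`. -/
def dom (i : A.Idx) (x₀ : M) : Set M := A.U i ∩ (chartAt E x₀).source

theorem isOpen_dom (i : A.Idx) (x₀ : M) : IsOpen (A.dom i x₀) :=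
  (A.isOpen_U i).inter (chartAt E x₀).open_source

/-- The local coordinates `(x, y)` on `A / ⟨v⟩`, as functions on the total space. -/
def coord (i : A.Idx) (x₀ : M) (b : A.Base) : E × F := (chartAt E x₀ b.1, A.qcoord i b.1 b.2)

/-- The point of `A / ⟨v⟩` with given local coordinates. -/
def coordSymm (i : A.Idx) (x₀ : M) (q : E × F) : A.Base :=
  ⟨(chartAt E x₀).symm q.1, A.qinv i _ q.2⟩

/-- The local coordinates on `A / ⟨v⟩` as a partial equivalence. -/
def baseChart (i : A.Idx) (x₀ : M) : PartialEquiv A.Base (E × F) where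
  toFun := A.coord i x₀
  invFun := A.coordSymm i x₀
  source := {b | b.1 ∈ A.dom i x₀}
  target := {q | q.1 ∈ (chartAt E x₀).target ∧ (chartAt E x₀).symm q.1 ∈ A.U i}
  map_source' := by
    rintro b ⟨h1, h2⟩
    refine ⟨(chartAt E x₀).map_source h2, ?_⟩
    simp only [coord]
    rw [(chartAt E x₀).left_inv h2]
    exact h1
  map_target' := by
    rintro q ⟨h1, h2⟩
    exact ⟨h2, (chartAt E x₀).map_target h1⟩
  left_inv' := by
    rintro ⟨x, b⟩ ⟨h1, h2⟩
    have h3 : (chartAt E x₀).symm (chartAt E x₀ x) = x := (chartAt E x₀).left_inv h2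
    simp only [coord, coordSymm]
    rw [h3, A.qinv_qcoord]
  right_inv' := by
    rintro q ⟨h1, h2⟩
    simp only [coord, coordSymm]
    rw [(chartAt E x₀).right_inv h1, A.qcoord_qinv]

theorem contDiffOn_baseChart_trans [IsManifold 𝓘(ℝ, E) ∞ M] (i j : A.Idx) (x₀ x₁ : M) :
    ContDiffOn ℝ ∞ ((A.baseChart i x₀).symm.trans (A.baseChart j x₁))
      ((A.baseChart i x₀).symm.trans (A.baseChart j x₁)).source := by
  have hs : ContMDiffOn 𝓘(ℝ, E × F) 𝓘(ℝ, E) ∞ (fun q : E × F => (chartAt E x₀).symm q.1)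
      ((A.baseChart i x₀).symm.trans (A.baseChart j x₁)).source := by
    refine (contMDiffOn_chart_symm (x := x₀)).comp
      (contDiff_fst.contMDiff.contMDiffOn) ?_
    rintro q ⟨hq, -⟩
    exact hq.1
  rw [← contMDiffOn_iff_contDiffOn]
  have h1 : ContMDiffOn 𝓘(ℝ, E × F) 𝓘(ℝ, E) ∞
      (fun q : E × F => chartAt E x₁ ((chartAt E x₀).symm q.1))
      ((A.baseChart i x₀).symm.trans (A.baseChart j x₁)).source := by
    refine (contMDiffOn_chart (x := x₁)).comp hs ?_
    rintro q ⟨-, hq⟩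
    exact hq.2
  have h2 : ContMDiffOn 𝓘(ℝ, E × F) 𝓘(ℝ, F) ∞
      (fun q : E × F => (A.triv j ((chartAt E x₀).symm q.1)
        ((A.triv i ((chartAt E x₀).symm q.1)).symm (q.2, 0))).1)
      ((A.baseChart i x₀).symm.trans (A.baseChart j x₁)).source := by
    have h3 : ContMDiffOn 𝓘(ℝ, E × F) 𝓘(ℝ, F × ℝ) ∞ (fun q : E × F => ((q.2, 0) : F × ℝ))
        ((A.baseChart i x₀).symm.trans (A.baseChart j x₁)).source :=
      (contDiff_snd.prodMk contDiff_const).contMDiff.contMDiffOn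
    have h4 := (A.smooth_trans i j).comp (hs.prodMk h3) (by
      rintro q ⟨hq, hq'⟩
      exact ⟨⟨hq.2, hq'.1⟩, mem_univ _⟩)
    exact contDiff_fst.contMDiff.comp_contMDiffOn h4
  have h5 := h1.prodMk_space h2
  exact h5

/-- The atlas of local coordinates `(x, y)` on the total space of `A / ⟨v⟩`. -/
def baseCore [IsManifold 𝓘(ℝ, E) ∞ M] : ChartedSpaceCore (E × F) A.Base where
  atlas := {e | ∃ i x₀, e = A.baseChart i x₀}
  chartAt b := A.baseChart (A.idx b.1) b.1
  mem_chart_source b := ⟨A.mem_U b.1, mem_chart_source E b.1⟩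
  chart_mem_atlas b := ⟨_, _, rfl⟩
  open_source := by
    rintro _ _ ⟨i, x₀, rfl⟩ ⟨j, x₁, rfl⟩
    have h : ((A.baseChart i x₀).symm.trans (A.baseChart j x₁)).source =
        (fun q : E × F => q.1) ⁻¹' ((chartAt E x₀).target ∩
          (chartAt E x₀).symm ⁻¹' (A.U i ∩ A.dom j x₁)) := by
      ext q
      simp [baseChart, PartialEquiv.trans_source, coordSymm, and_assoc]
    rw [h]
    exact ((chartAt E x₀).isOpen_inter_preimage_symm
      ((A.isOpen_U i).inter (A.isOpen_dom j x₁))).preimage continuous_fst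
  continuousOn_toFun := by
    rintro _ _ ⟨i, x₀, rfl⟩ ⟨j, x₁, rfl⟩
    exact (A.contDiffOn_baseChart_trans i j x₀ x₁).continuousOn

section manifold

variable [IsManifold 𝓘(ℝ, E) ∞ M]

instance instTopBase : TopologicalSpace A.Base := A.baseCore.toTopologicalSpace

instance instChartedBase : ChartedSpace (E × F) A.Base := A.baseCore.toChartedSpace

theorem mem_atlas_iff {e : OpenPartialHomeomorph A.Base (E × F)} :
    e ∈ atlas (E × F) A.Base ↔
      ∃ c, ∃ hc : c ∈ A.baseCore.atlas, e = A.baseCore.openPartialHomeomorph c hc := by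
  change e ∈ ⋃ (c : PartialEquiv A.Base (E × F)) (hc : c ∈ A.baseCore.atlas),
    {A.baseCore.openPartialHomeomorph c hc} ↔ _
  simp only [mem_iUnion, mem_singleton_iff]

instance instManifoldBase : IsManifold 𝓘(ℝ, E × F) ∞ A.Base := by
  apply isManifold_of_contDiffOn
  intro e e' he he'
  obtain ⟨_, ⟨⟨i, x₀, rfl⟩, rfl⟩⟩ := A.mem_atlas_iff.1 he
  obtain ⟨_, ⟨⟨j, x₁, rfl⟩, rfl⟩⟩ := A.mem_atlas_iff.1 he'
  refine (A.contDiffOn_baseChart_trans i j x₀ x₁).congr_mono (fun _ _ => rfl) ?_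
  intro q hq
  exact hq.1

/-- The local coordinates on `A / ⟨v⟩` as a chart. -/
def baseChartHomeo (i : A.Idx) (x₀ : M) : OpenPartialHomeomorph A.Base (E × F) :=
  A.baseCore.openPartialHomeomorph (A.baseChart i x₀) ⟨i, x₀, rfl⟩

theorem baseChartHomeo_mem (i : A.Idx) (x₀ : M) :
    A.baseChartHomeo i x₀ ∈ IsManifold.maximalAtlas 𝓘(ℝ, E × F) ∞ A.Base := by
  apply IsManifold.subset_maximalAtlas
  exact A.mem_atlas_iff.2 ⟨A.baseChart i x₀, ⟨i, x₀, rfl⟩, rfl⟩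

theorem contMDiffOn_coord (i : A.Idx) (x₀ : M) :
    ContMDiffOn 𝓘(ℝ, E × F) 𝓘(ℝ, E × F) ∞ (A.coord i x₀) {b | b.1 ∈ A.dom i x₀} :=
  contMDiffOn_of_mem_maximalAtlas (A.baseChartHomeo_mem i x₀)

theorem isOpen_over_dom (i : A.Idx) (x₀ : M) : IsOpen {b : A.Base | b.1 ∈ A.dom i x₀} :=
  (A.baseChartHomeo i x₀).open_source

theorem contMDiff_fst : ContMDiff 𝓘(ℝ, E × F) 𝓘(ℝ, E) ∞ (fun b : A.Base => b.1) := by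
  intro b
  have hb : b.1 ∈ A.dom (A.idx b.1) b.1 := ⟨A.mem_U b.1, mem_chart_source E b.1⟩
  have h : ContMDiffOn 𝓘(ℝ, E × F) 𝓘(ℝ, E) ∞
      (fun c : A.Base => (chartAt E b.1).symm (A.coord (A.idx b.1) b.1 c).1)
      {c | c.1 ∈ A.dom (A.idx b.1) b.1} :=
    (contMDiffOn_chart_symm (x := b.1)).comp
      (contDiff_fst.contMDiff.comp_contMDiffOn (A.contMDiffOn_coord _ _))
      (fun c hc => (chartAt E b.1).map_source hc.2)
  refine (h.congr (fun c hc => ?_)).contMDiffAt ((A.isOpen_over_dom _ _).mem_nhds hb)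
  exact ((chartAt E b.1).left_inv hc.2).symm

theorem isOpen_over_U (i : A.Idx) : IsOpen {b : A.Base | b.1 ∈ A.U i} :=
  (A.isOpen_U i).preimage A.contMDiff_fst.continuous

theorem contMDiffOn_qcoord (i : A.Idx) :
    ContMDiffOn 𝓘(ℝ, E × F) 𝓘(ℝ, F) ∞ (fun b : A.Base => A.qcoord i b.1 b.2)
      {b | b.1 ∈ A.U i} := by
  intro b hb
  have h := contDiff_snd.contMDiff.comp_contMDiffOn (A.contMDiffOn_coord i b.1)
  exact (h.contMDiffAt ((A.isOpen_over_dom i b.1).mem_nhds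
    ⟨hb, mem_chart_source E b.1⟩)).contMDiffWithinAt

end manifold

/-! ### Sections -/

/-- Smooth sections of `A`. -/
def Sec : Type _ :=
  {a : ∀ x, A.Fib x // ∀ i, ContMDiffOn 𝓘(ℝ, E) 𝓘(ℝ, F × ℝ) ∞ (fun x => A.triv i x (a x)) (A.U i)}

/-- Smooth sections of the model vector bundle `V(A)`. -/
def SecV : Submodule ℝ (∀ x, A.Mod x) where
  carrier := {X | ∀ i, ContMDiffOn 𝓘(ℝ, E) 𝓘(ℝ, F × ℝ) ∞
    (fun x => (A.triv i x).linear (X x)) (A.U i)}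
  add_mem' := by
    intro X Y hX hY i
    refine ((hX i).add (hY i)).congr (fun x _ => ?_)
    simp
  zero_mem' := by
    intro i
    refine (contMDiffOn_const (c := (0 : F × ℝ))).congr (fun x _ => ?_)
    simp
  smul_mem' := by
    intro c X hX i
    refine ((contMDiffOn_const (I' := 𝓘(ℝ, ℝ)) (c := c)).smul (hX i)).congr (fun x _ => ?_)
    simp

/-- The distinguished section of `V(A)`, as a smooth section. -/
def vSec : A.SecV :=
  ⟨A.v, fun i => (contMDiffOn_const (c := ((0, 1) : F × ℝ))).congr (fun x _ => A.triv_v i x)⟩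

variable {A}

/-- The section `g X` of `V(A)`. -/
def smulV (g : C^∞⟮𝓘(ℝ, E), M; ℝ⟯) (X : A.SecV) : A.SecV :=
  ⟨fun x => g x • (X : ∀ x, A.Mod x) x, fun i => by
    refine (g.contMDiff.contMDiffOn.smul (X.2 i)).congr (fun x _ => ?_)
    simp⟩

/-- The section `a + X` of `A`. -/
def vadd (a : A.Sec) (X : A.SecV) : A.Sec :=
  ⟨fun x => (X : ∀ x, A.Mod x) x +ᵥ a.1 x, fun i => by
    refine ((X.2 i).add (a.2 i)).congr (fun x _ => ?_)
    simp⟩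

variable (A)

/-! ### The special affine dual -/

/-- The model vector space of the fibre of the special affine dual: affine functions whose
linear part vanishes on the distinguished vector. -/
def DualMod (x : M) : Submodule ℝ (A.Fib x →ᵃ[ℝ] ℝ) where
  carrier := {ψ | ψ.linear (A.v x) = 0}
  add_mem' := by
    intro a b ha hb
    have ha' : a.linear (A.v x) = 0 := ha
    have hb' : b.linear (A.v x) = 0 := hb
    simp [ha', hb']
  zero_mem' := by simp
  smul_mem' := by
    intro c a ha
    have ha' : a.linear (A.v x) = 0 := ha
    simp [ha']

/-- The fibre of the special affine dual: affine functions whose linear part maps the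
distinguished vector to `1`. -/
def DualFib (x : M) : Type _ := {φ : A.Fib x →ᵃ[ℝ] ℝ // φ.linear (A.v x) = 1}

/-- The affine function on the fibre whose expression in a local trivialization is
`(y, s) ↦ l y + c + s`. -/
def dualInv (i : A.Idx) (x : M) (q : (F →L[ℝ] ℝ) × ℝ) : A.DualFib x :=
  ⟨((q.1 : F →ₗ[ℝ] ℝ).comp (LinearMap.fst ℝ F ℝ) + LinearMap.snd ℝ F ℝ).toAffineMap.comp
      (A.triv i x).toAffineMap + AffineMap.const ℝ (A.Fib x) q.2, by
    have := A.triv_v i x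
    simp [this]⟩

theorem dualInv_apply (i : A.Idx) (x : M) (q : (F →L[ℝ] ℝ) × ℝ) (a : A.Fib x) :
    (A.dualInv i x q).1 a = q.1 (A.triv i x a).1 + (A.triv i x a).2 + q.2 := rfl

instance instTorsorDual (x : M) : AddTorsor (A.DualMod x) (A.DualFib x) where
  vadd ψ φ := ⟨ψ.1 + φ.1, by
    have h1 : ψ.1.linear (A.v x) = 0 := ψ.2
    have h2 := φ.2
    simp [h1, h2]⟩
  zero_vadd φ := Subtype.ext (zero_add φ.1)
  add_vadd ψ ψ' φ := Subtype.ext (add_assoc ψ.1 ψ'.1 φ.1)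
  vsub φ φ' := ⟨φ.1 - φ'.1, by
    have h1 := φ.2
    have h2 := φ'.2
    change (φ.1 - φ'.1).linear (A.v x) = 0
    simp [h1, h2]⟩
  nonempty := ⟨A.dualInv (A.idx x) x 0⟩
  vsub_vadd' φ φ' := Subtype.ext (sub_add_cancel φ.1 φ'.1)
  vadd_vsub' ψ φ := Subtype.ext (add_sub_cancel_right ψ.1 φ.1)

theorem dual_vadd_apply {x : M} (ψ : A.DualMod x) (φ : A.DualFib x) (a : A.Fib x) :
    (ψ +ᵥ φ).1 a = ψ.1 a + φ.1 a := rfl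

theorem dual_vadd_val {x : M} (ψ : A.DualMod x) (φ : A.DualFib x) :
    (ψ +ᵥ φ).1 = ψ.1 + φ.1 := rfl

/-- The constant function `1`, the distinguished vector of the dual. -/
def dualOne (x : M) : A.DualMod x := ⟨AffineMap.const ℝ (A.Fib x) 1, by
  change (AffineMap.const ℝ (A.Fib x) (1 : ℝ)).linear (A.v x) = 0
  simp⟩

section dual

variable [FiniteDimensional ℝ F]

/-- The coordinates `(l, c)` of an affine function on the fibre, read in a trivialization. -/
def affCoord (i : A.Idx) (x : M) : (A.Fib x →ᵃ[ℝ] ℝ) →ₗ[ℝ] (F →L[ℝ] ℝ) × ℝ where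
  toFun φ := (LinearMap.toContinuousLinearMap
    ((φ.linear.comp ((A.triv i x).symm.linear : F × ℝ →ₗ[ℝ] A.Mod x)).comp
      (LinearMap.inl ℝ F ℝ)), φ ((A.triv i x).symm (0, 0)))
  map_add' φ ψ := by
    ext <;> simp
  map_smul' c φ := by
    ext <;> simp

theorem affCoord_fst (i : A.Idx) (x : M) (φ : A.Fib x →ᵃ[ℝ] ℝ) (y : F) :
    (A.affCoord i x φ).1 y = φ.linear ((A.triv i x).linear.symm (y, 0)) := rfl

theorem affCoord_snd (i : A.Idx) (x : M) (φ : A.Fib x →ᵃ[ℝ] ℝ) :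
    (A.affCoord i x φ).2 = φ ((A.triv i x).symm (0, 0)) := rfl

theorem affine_eq (i : A.Idx) (x : M) (φ : A.Fib x →ᵃ[ℝ] ℝ) (a : A.Fib x) :
    φ a = (A.affCoord i x φ).1 (A.triv i x a).1 +
      (A.triv i x a).2 * φ.linear (A.v x) + (A.affCoord i x φ).2 := by
  have h1 : a = (A.triv i x).linear.symm (A.triv i x a) +ᵥ (A.triv i x).symm (0, 0) := by
    apply (A.triv i x).injective
    rw [AffineEquiv.map_vadd]
    simp
  have h2 : A.triv i x a = ((A.triv i x a).1, 0) + (A.triv i x a).2 • ((0, 1) : F × ℝ) := by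
    ext <;> simp
  have h3 : (A.triv i x).linear.symm (A.triv i x a) =
      (A.triv i x).linear.symm ((A.triv i x a).1, 0) + (A.triv i x a).2 • A.v x := by
    conv_lhs => rw [h2]
    rw [map_add, map_smul, ← A.triv_v i x]
    simp
  conv_lhs => rw [h1]
  rw [AffineMap.map_vadd, h3, map_add, map_smul, affCoord_fst, affCoord_snd]
  simp

theorem affCoord_dualInv (i : A.Idx) (x : M) (q : (F →L[ℝ] ℝ) × ℝ) :
    A.affCoord i x (A.dualInv i x q).1 = q := by
  have h2 : (A.affCoord i x (A.dualInv i x q).1).2 = q.2 := by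
    rw [affCoord_snd, dualInv_apply]
    simp
  ext y
  · have h := A.affine_eq i x (A.dualInv i x q).1 ((A.triv i x).symm (y, 0))
    rw [h2, dualInv_apply] at h
    simp at h
    simpa using h.symm
  · exact h2

/-- The affine function with linear part vanishing on `v` and with given coordinates. -/
def dualModInv (i : A.Idx) (x : M) (q : (F →L[ℝ] ℝ) × ℝ) : A.DualMod x :=
  A.dualInv i x q -ᵥ A.dualInv i x 0

/-- The coordinates on the model vector space of the dual fibre. -/
def dualLinTriv (i : A.Idx) (x : M) : A.DualMod x ≃ₗ[ℝ] (F →L[ℝ] ℝ) × ℝ where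
  __ := (A.affCoord i x).comp (A.DualMod x).subtype
  invFun := A.dualModInv i x
  left_inv ψ := by
    ext a
    have h := A.affine_eq i x ψ.1 a
    have h0 : ψ.1.linear (A.v x) = 0 := ψ.2
    rw [h0] at h
    change (A.dualInv i x (A.affCoord i x ψ.1)).1 a - (A.dualInv i x 0).1 a = ψ.1 a
    rw [h, dualInv_apply, dualInv_apply]
    simp
    ring
  right_inv q := by
    change A.affCoord i x ((A.dualInv i x q).1 - (A.dualInv i x 0).1) = q
    rw [map_sub, affCoord_dualInv, affCoord_dualInv, sub_zero]

/-- The local trivialization of the special affine dual induced by a local trivialization of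
`A`: the affine function `(y, s) ↦ l y + c + s` has the coordinates `(l, c)`. -/
def dualTriv (i : A.Idx) (x : M) : A.DualFib x ≃ᵃ[ℝ] (F →L[ℝ] ℝ) × ℝ where
  toFun φ := A.affCoord i x φ.1
  invFun := A.dualInv i x
  left_inv φ := by
    apply Subtype.ext
    ext a
    have h := A.affine_eq i x φ.1 a
    rw [φ.2] at h
    rw [h, dualInv_apply]
    ring
  right_inv q := A.affCoord_dualInv i x q
  linear := A.dualLinTriv i x
  map_vadd' φ ψ := (A.affCoord i x).map_add ψ.1 φ.1

theorem dualTriv_apply (i : A.Idx) (x : M) (φ : A.DualFib x) :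
    A.dualTriv i x φ = A.affCoord i x φ.1 := rfl

theorem contMDiffOn_clm {G : Type*} [NormedAddCommGroup G] [NormedSpace ℝ G]
    {H : Type*} [TopologicalSpace H] {I : ModelWithCorners ℝ G H}
    {N : Type*} [TopologicalSpace N] [ChartedSpace H N] {s : Set N} {f : N → (F →L[ℝ] ℝ)}
    (h : ∀ y, ContMDiffOn I 𝓘(ℝ, ℝ) ∞ (fun n => f n y) s) :
    ContMDiffOn I 𝓘(ℝ, F →L[ℝ] ℝ) ∞ f s := by
  let b := Module.finBasis ℝ F
  have hf : ∀ n, f n = ∑ k, f n (b k) • LinearMap.toContinuousLinearMap (b.coord k) := by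
    intro n
    ext y
    conv_lhs => rw [← b.sum_repr y, map_sum]
    simp [mul_comm]
  have : ContMDiffOn I 𝓘(ℝ, F →L[ℝ] ℝ) ∞
      (fun n => ∑ k, f n (b k) • LinearMap.toContinuousLinearMap (b.coord k)) s := by
    apply contMDiffOn_finsetSum
    intro k _
    exact (h (b k)).smul contMDiffOn_const
  exact this.congr (fun n _ => hf n)

/-- The special affine dual `A^#`. -/
def dual : SpecialAffineBundle E M (F →L[ℝ] ℝ) where
  Fib := A.DualFib
  Mod x := A.DualMod x
  v := A.dualOne
  Idx := A.Idx
  U := A.U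
  isOpen_U := A.isOpen_U
  idx := A.idx
  mem_U := A.mem_U
  triv := A.dualTriv
  triv_v i x := by
    change A.affCoord i x (A.dualOne x).1 = (0, 1)
    ext y
    · rw [affCoord_fst]
      simp [dualOne]
    · rfl
  smooth_trans i j := by
    have hT : ∀ y : F, ContMDiffOn (𝓘(ℝ, E).prod 𝓘(ℝ, (F →L[ℝ] ℝ) × ℝ)) 𝓘(ℝ, F × ℝ) ∞
        (fun q : M × ((F →L[ℝ] ℝ) × ℝ) => A.triv i q.1 ((A.triv j q.1).symm (y, 0)))
        ((A.U i ∩ A.U j) ×ˢ univ) := by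
      intro y
      exact (A.smooth_trans j i).comp (contMDiffOn_fst.prodMk contMDiffOn_const)
        (fun q hq => ⟨⟨hq.1.2, hq.1.1⟩, mem_univ _⟩)
    have hv : ∀ y : F, ContMDiffOn (𝓘(ℝ, E).prod 𝓘(ℝ, (F →L[ℝ] ℝ) × ℝ)) 𝓘(ℝ, ℝ) ∞
        (fun q : M × ((F →L[ℝ] ℝ) × ℝ) =>
          (A.dualInv i q.1 q.2).1 ((A.triv j q.1).symm (y, 0)))
        ((A.U i ∩ A.U j) ×ˢ univ) := by
      intro y
      have hq : ContMDiffOn (𝓘(ℝ, E).prod 𝓘(ℝ, (F →L[ℝ] ℝ) × ℝ)) 𝓘(ℝ, (F →L[ℝ] ℝ) × ℝ) ∞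
        (fun q : M × ((F →L[ℝ] ℝ) × ℝ) => q.2) ((A.U i ∩ A.U j) ×ˢ univ) := contMDiffOn_snd
      have hl := contDiff_fst (𝕜 := ℝ) (E := F →L[ℝ] ℝ) (F := ℝ) (n := ∞)
        |>.contMDiff.comp_contMDiffOn hq
      have hc := contDiff_snd (𝕜 := ℝ) (E := F →L[ℝ] ℝ) (F := ℝ) (n := ∞)
        |>.contMDiff.comp_contMDiffOn hq
      have h1 := contDiff_fst (𝕜 := ℝ) (E := F) (F := ℝ) (n := ∞)
        |>.contMDiff.comp_contMDiffOn (hT y)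
      have h2 := contDiff_snd (𝕜 := ℝ) (E := F) (F := ℝ) (n := ∞)
        |>.contMDiff.comp_contMDiffOn (hT y)
      exact ((hl.clm_apply h1).add h2).add hc
    have key : ∀ q : M × ((F →L[ℝ] ℝ) × ℝ), A.dualTriv j q.1 ((A.dualTriv i q.1).symm q.2) =
        A.affCoord j q.1 (A.dualInv i q.1 q.2).1 := fun q => rfl
    simp only [key]
    refine ContMDiffOn.prodMk_space (contMDiffOn_clm fun y => ?_) (hv 0)
    refine ((hv y).sub (hv 0)).congr fun q _ => ?_
    have h := A.affine_eq j q.1 (A.dualInv i q.1 q.2).1 ((A.triv j q.1).symm (y, 0))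
    simp only [AffineEquiv.apply_symm_apply, zero_mul, add_zero] at h
    rw [h, affCoord_snd]
    simp [affCoord_fst]

end dual


section phase

variable [IsManifold 𝓘(ℝ, E) ∞ M]

/-! ### The AV-bundle of a special affine bundle and its phase bundle

`AV(A)` is the bundle `A → A / ⟨v⟩`, with the distinguished vector `-v`. -/

/-- Smooth sections of `AV(A)`. -/
@[ext] structure AVSection where
  toFun : ∀ b : A.Base, A.Fib b.1
  proj : ∀ b, A.qmk (toFun b) = b.2
  smooth : ∀ i, ContMDiffOn 𝓘(ℝ, E × F) 𝓘(ℝ, F × ℝ) ∞ (fun b : A.Base => A.triv i b.1 (toFun b))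
    {b | b.1 ∈ A.U i}

variable {A} in
/-- The section `σ + h` of `AV(A)`, for a smooth function `h` on `A / ⟨v⟩`; recall that the
distinguished vector of `AV(A)` is `-v`. -/
def AVSection.add (σ : A.AVSection) (h : C^∞⟮𝓘(ℝ, E × F), A.Base; ℝ⟯) : A.AVSection where
  toFun b := h b • (-A.v b.1) +ᵥ σ.toFun b
  proj b := by
    rw [← σ.proj b]
    exact ((A.qmk_eq _ _).2 ⟨-h b, by simp⟩).symm
  smooth i := by
    have h1 : ContMDiffOn 𝓘(ℝ, E × F) 𝓘(ℝ, F × ℝ) ∞ (fun b : A.Base => h b • ((0, -1) : F × ℝ))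
        {b | b.1 ∈ A.U i} := h.contMDiff.contMDiffOn.smul contMDiffOn_const
    refine (h1.add (σ.smooth i)).congr (fun b _ => ?_)
    have h2 := A.triv_smul_v_vadd i b.1 (-h b) (σ.toFun b)
    rw [neg_smul, ← smul_neg] at h2
    rw [h2]
    ext <;> simp [add_comm]

/-- The differential at a point of a smooth function on `A / ⟨v⟩`. -/
def dfun (h : C^∞⟮𝓘(ℝ, E × F), A.Base; ℝ⟯) (b : A.Base) :
    TangentSpace 𝓘(ℝ, E × F) b →L[ℝ] ℝ :=
  mfderiv 𝓘(ℝ, E × F) 𝓘(ℝ, ℝ) h b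

theorem dfun_zero (b : A.Base) : A.dfun 0 b = 0 :=
  mfderiv_const

theorem dfun_add (h k : C^∞⟮𝓘(ℝ, E × F), A.Base; ℝ⟯) (b : A.Base) :
    A.dfun (h + k) b = A.dfun h b + A.dfun k b :=
  mfderiv_add (h.contMDiff.mdifferentiableAt (by simp)) (k.contMDiff.mdifferentiableAt (by simp))

theorem dfun_neg (h : C^∞⟮𝓘(ℝ, E × F), A.Base; ℝ⟯) (b : A.Base) :
    A.dfun (-h) b = -A.dfun h b := by
  have h1 := A.dfun_add h (-h) b
  rw [add_neg_cancel, dfun_zero] at h1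
  exact (neg_eq_of_add_eq_zero_right h1.symm).symm

theorem AVSection.add_zero (σ : A.AVSection) : σ.add 0 = σ := by
  ext b
  simp [AVSection.add]

theorem AVSection.add_add (σ : A.AVSection) (h k : C^∞⟮𝓘(ℝ, E × F), A.Base; ℝ⟯) :
    (σ.add h).add k = σ.add (h + k) := by
  ext b
  simp only [AVSection.add, vadd_vadd, ← add_smul]
  rw [add_comm]
  rfl

/-- Two sections of `AV(A)` are equivalent at `b` if the differential at `b` of their difference,
which is a function on `A / ⟨v⟩`, vanishes. -/
def phaseSetoid (b : A.Base) : Setoid A.AVSection where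
  r σ τ := ∃ h : C^∞⟮𝓘(ℝ, E × F), A.Base; ℝ⟯, τ = σ.add h ∧ A.dfun h b = 0
  iseqv :=
    { refl := fun σ => ⟨0, σ.add_zero.symm, A.dfun_zero b⟩
      symm := by
        rintro σ τ ⟨h, rfl, hb⟩
        refine ⟨-h, ?_, by rw [dfun_neg, hb, neg_zero]⟩
        rw [AVSection.add_add, add_neg_cancel, AVSection.add_zero]
      trans := by
        rintro σ τ ρ ⟨h, rfl, hb⟩ ⟨k, rfl, kb⟩
        exact ⟨h + k, AVSection.add_add _ _ _ _, by rw [dfun_add, hb, kb, add_zero]⟩ }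

/-- The fibre at `b` of the phase bundle `PA` of `AV(A)`. -/
def PhaseFib (b : A.Base) : Type _ := Quotient (A.phaseSetoid b)

/-- The total space of the phase bundle `PA`. -/
def Phase : Type _ := Σ b : A.Base, A.PhaseFib b

variable {A} in
/-- The affine differential of a section of `AV(A)` at a point. -/
def AVSection.dd (σ : A.AVSection) (b : A.Base) : A.PhaseFib b :=
  Quotient.mk (A.phaseSetoid b) σ

variable {A} in
/-- The affine differential of a section of `AV(A)`, as a section of `PA`. -/
def AVSection.ddP (σ : A.AVSection) (b : A.Base) : A.Phase := ⟨b, σ.dd b⟩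

variable {A} in
/-- In the local coordinates `(x, y)` and the trivialization of `AV(A)` induced by a local
trivialization of `A`, a section of `AV(A)` is a function of `(x, y)`.  Its derivative gives the
coordinates `(p, ξ)` of the affine differential, so that `PA` has the local coordinates
`(x, y, p, ξ)`. -/
def AVSection.phaseCoord (σ : A.AVSection) (i : A.Idx) (x₀ : M) (b : A.Base) :
    (E →L[ℝ] ℝ) × (F →L[ℝ] ℝ) :=
  let D : E × F →L[ℝ] ℝ := fderiv ℝ (fun q : E × F =>
    -(A.triv i (A.coordSymm i x₀ q).1 (σ.toFun (A.coordSymm i x₀ q))).2) (A.coord i x₀ b)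
  (D.comp (ContinuousLinearMap.inl ℝ E F), D.comp (ContinuousLinearMap.inr ℝ E F))

/-- The local coordinates `(x, y, ẋ, ẏ)` on the tangent bundle of `A / ⟨v⟩`. -/
def tangentCoord (i : A.Idx) (x₀ : M) (w : TangentBundle 𝓘(ℝ, E × F) A.Base) :
    (E × F) × (E × F) :=
  (A.coord i x₀ w.proj,
    mfderiv 𝓘(ℝ, E × F) 𝓘(ℝ, E × F) (A.coord i x₀) w.proj w.snd)

/-- The fibre at `b` of the vector dual of the phase bundle `PA`, i.e. the space of real
functions on the fibre of `PA` that are affine with respect to the affine structure modelled on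
the cotangent space, `dd (σ + h) = dd σ + dh`. -/
def Ttilde (b : A.Base) : Submodule ℝ (A.PhaseFib b → ℝ) where
  carrier := {G | ∃ L : (TangentSpace 𝓘(ℝ, E × F) b →L[ℝ] ℝ) →ₗ[ℝ] ℝ,
    ∀ (σ : A.AVSection) (h : C^∞⟮𝓘(ℝ, E × F), A.Base; ℝ⟯),
      G ((σ.add h).dd b) = G (σ.dd b) + L (A.dfun h b)}
  add_mem' := by
    rintro G G' ⟨L, hL⟩ ⟨L', hL'⟩
    refine ⟨L + L', fun σ h => ?_⟩
    simp only [Pi.add_apply, LinearMap.add_apply, hL, hL']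
    ring
  zero_mem' := ⟨0, fun σ h => by simp⟩
  smul_mem' := by
    rintro c G ⟨L, hL⟩
    refine ⟨c • L, fun σ h => ?_⟩
    simp only [Pi.smul_apply, LinearMap.smul_apply, hL, smul_eq_mul]
    ring

/-- Evaluation of affine functions at a point of the fibre of `PA`. -/
def evalPhase {b : A.Base} (p : A.PhaseFib b) : A.Ttilde b →ₗ[ℝ] ℝ :=
  (LinearMap.proj p).comp (A.Ttilde b).subtype

/-- The contraction `⟨Γ, p ⊗ η⟩`. -/
def contract {b : A.Base} (t : A.Ttilde b ⊗[ℝ] TangentSpace 𝓘(ℝ, E × F) b)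
    (p : A.PhaseFib b) (η : TangentSpace 𝓘(ℝ, E × F) b →L[ℝ] ℝ) : ℝ :=
  TensorProduct.lid ℝ ℝ
    (TensorProduct.map (A.evalPhase p) (η : TangentSpace 𝓘(ℝ, E × F) b →ₗ[ℝ] ℝ) t)

/-- The contraction of the first factor of a tensor with a point of the fibre of `PA`. -/
def sharpAt {b : A.Base} (t : A.Ttilde b ⊗[ℝ] TangentSpace 𝓘(ℝ, E × F) b)
    (p : A.PhaseFib b) : TangentSpace 𝓘(ℝ, E × F) b :=
  TensorProduct.lid ℝ (TangentSpace 𝓘(ℝ, E × F) b)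
    (TensorProduct.map (A.evalPhase p) LinearMap.id t)

/-- A section of `AV(A)` is affine if it is fibrewise an affine map `A / ⟨v⟩ → A`. -/
def AVSection.IsAffine (σ : A.AVSection) : Prop :=
  ∀ x, ∃ T : A.Fib x →ᵃ[ℝ] A.Fib x, ∀ a, σ.toFun ⟨x, A.qmk a⟩ = T a

/-- A function on `A / ⟨v⟩` is affine if it is so fibrewise. -/
def IsAffineFun (f : C^∞⟮𝓘(ℝ, E × F), A.Base; ℝ⟯) : Prop :=
  ∀ x, ∃ T : A.Fib x →ᵃ[ℝ] ℝ, ∀ a, f ⟨x, A.qmk a⟩ = T a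

/-- An aff-Poisson bracket on `AV(A)`: a Lie affgebra bracket on the sections of `AV(A)` with
values in the functions on `A / ⟨v⟩`, whose affine-linear part `lin` is, for each first
argument, a derivation (a vector field). -/
structure AffPoissonBracket where
  br : A.AVSection → A.AVSection → C^∞⟮𝓘(ℝ, E × F), A.Base; ℝ⟯
  lin : A.AVSection → C^∞⟮𝓘(ℝ, E × F), A.Base; ℝ⟯ → C^∞⟮𝓘(ℝ, E × F), A.Base; ℝ⟯
  affine_right : ∀ σ τ h, br σ (τ.add h) = br σ τ + lin σ h
  affine_left : ∀ τ, ∃ L : C^∞⟮𝓘(ℝ, E × F), A.Base; ℝ⟯ →ₗ[ℝ] C^∞⟮𝓘(ℝ, E × F), A.Base; ℝ⟯,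
    ∀ σ h, br (σ.add h) τ = br σ τ + L h
  skew : ∀ σ τ, br σ τ = -br τ σ
  jacobi : ∀ σ τ ρ, lin σ (br τ ρ) + lin τ (br ρ σ) + lin ρ (br σ τ) = 0
  vectorField : ∀ σ, ∃ D : Derivation ℝ C^∞⟮𝓘(ℝ, E × F), A.Base; ℝ⟯
    C^∞⟮𝓘(ℝ, E × F), A.Base; ℝ⟯, ∀ f, lin σ f = D f

/-! ### Brackets on sections -/

/-- The derivative of a smooth function on `M` along a tangent vector. -/
def dirDeriv (g : C^∞⟮𝓘(ℝ, E), M; ℝ⟯) (x : M) (w : TangentSpace 𝓘(ℝ, E) x) : ℝ :=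
  (mfderiv 𝓘(ℝ, E) 𝓘(ℝ, ℝ) g x : TangentSpace 𝓘(ℝ, E) x →L[ℝ] ℝ) w

/-- A morphism of affine bundles `A → TM` over the identity. -/
@[ext] structure AffineAnchor where
  toFun : ∀ x, A.Fib x →ᵃ[ℝ] TangentSpace 𝓘(ℝ, E) x
  smooth : ∀ i, ContMDiffOn (𝓘(ℝ, E).prod 𝓘(ℝ, F × ℝ)) 𝓘(ℝ, E).tangent ∞
    (fun q : M × (F × ℝ) =>
      (⟨q.1, toFun q.1 ((A.triv i q.1).symm q.2)⟩ : TangentBundle 𝓘(ℝ, E) M)) (A.U i ×ˢ univ)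

/-- A morphism of vector bundles `V(A) → TM` over the identity. -/
@[ext] structure LinearAnchor where
  toFun : ∀ x, A.Mod x →ₗ[ℝ] TangentSpace 𝓘(ℝ, E) x
  smooth : ∀ i, ContMDiffOn (𝓘(ℝ, E).prod 𝓘(ℝ, F × ℝ)) 𝓘(ℝ, E).tangent ∞
    (fun q : M × (F × ℝ) =>
      (⟨q.1, toFun q.1 ((A.triv i q.1).linear.symm q.2)⟩ : TangentBundle 𝓘(ℝ, E) M))
    (A.U i ×ˢ univ)

/-- A special affine-linear bracket `Sec(A) × Sec(V(A)) → Sec(V(A))` with left and right anchors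
and the Leibniz rules
`[a, gY] = g[a, Y] + (l ∘ a)(g) Y` and
`[a + fX, Y] = (1 - f)[a, Y] + f[a + X, Y] - (r ∘ Y)(f) X`. -/
@[ext] structure SpecialAffgebroidBracket where
  bracket : A.Sec → A.SecV → A.SecV
  left : A.AffineAnchor
  right : A.LinearAnchor
  linear_right : ∀ a, IsLinearMap ℝ (bracket a)
  affine_left : ∀ Y, ∃ L : A.SecV →ₗ[ℝ] A.SecV, ∀ a X, bracket (vadd a X) Y = bracket a Y + L X
  special_right : ∀ a X, bracket a (X + A.vSec) = bracket a X
  special_left : ∀ a X, bracket (vadd a A.vSec) X = bracket a X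
  leibniz_right : ∀ a g Y x, (bracket a (smulV g Y)).1 x =
    g x • (bracket a Y).1 x + dirDeriv g x (left.toFun x (a.1 x)) • Y.1 x
  leibniz_left : ∀ a f X Y x, (bracket (vadd a (smulV f X)) Y).1 x =
    (1 - f x) • (bracket a Y).1 x + f x • (bracket (vadd a X) Y).1 x
      - dirDeriv f x (right.toFun x (Y.1 x)) • X.1 x

/-- A special Lie affgebroid on `A`: a skew-symmetric bi-affine bracket
`Sec(A) × Sec(A) → Sec(V(A))` with affine-linear part `lin` that satisfies the Jacobi identity,
for which the distinguished section is central, together with an anchor `ρ : A → TM`. -/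
structure SpecialLieAffgebroid where
  br : A.Sec → A.Sec → A.SecV
  lin : A.Sec → A.SecV →ₗ[ℝ] A.SecV
  ρ : A.AffineAnchor
  affine_right : ∀ a b X, br a (vadd b X) = br a b + lin a X
  affine_left : ∀ b, ∃ L : A.SecV →ₗ[ℝ] A.SecV, ∀ a X, br (vadd a X) b = br a b + L X
  skew : ∀ a b, br a b = -br b a
  jacobi : ∀ a b c, lin a (br b c) + lin b (br c a) + lin c (br a b) = 0
  anchor : ∀ a f X x, (lin a (smulV f X)).1 x =
    f x • (lin a X).1 x + dirDeriv f x (ρ.toFun x (a.1 x)) • X.1 x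
  central : ∀ a, lin a A.vSec = 0

variable {A} in
/-- The bracket with anchors is that of a special Lie affgebroid. -/
def SpecialAffgebroidBracket.IsLie (B : A.SpecialAffgebroidBracket) : Prop :=
  ∃ L : A.SpecialLieAffgebroid, (∀ a X, L.lin a X = B.bracket a X) ∧ L.ρ = B.left

section affgebroid

variable [FiniteDimensional ℝ F]

/-! ### Sections of `A` and `V(A)` as sections and functions on the dual side -/

/-- The point `φ - φ(a)` of the dual fibre, on which the evaluation at `a` vanishes. -/
def dualShift {x : M} (a : A.Fib x) : A.dual.QFib x → A.DualFib x :=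
  Quotient.lift (fun φ : A.DualFib x => (-(φ.1 a)) • A.dualOne x +ᵥ φ) (by
    rintro φ _ ⟨t, rfl⟩
    apply Subtype.ext
    ext c
    change (-(φ.1 a)) * 1 + φ.1 c = (-(t * 1 + φ.1 a)) * 1 + (t * 1 + φ.1 c)
    ring)

variable {A} in
/-- The affine section `ι^#_a` of `AV(A^#)` corresponding to a section `a` of `A`: the zero set
of the function `φ ↦ φ(a)` on `A^#`. -/
def iotaSec (a : A.Sec) : A.dual.AVSection where
  toFun φ := A.dualShift (a.1 φ.1) φ.2
  proj := by
    rintro ⟨x, φ⟩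
    induction φ using Quotient.inductionOn with
    | _ φ => exact ((A.dual.qmk_eq _ _).2 ⟨-(φ.1 (a.1 x)), rfl⟩).symm
  smooth i := by
    have h1 : ContMDiffOn 𝓘(ℝ, E × (F →L[ℝ] ℝ)) 𝓘(ℝ, F →L[ℝ] ℝ) ∞
        (fun φ : A.dual.Base => A.dual.qcoord i φ.1 φ.2) {φ | φ.1 ∈ A.U i} :=
      A.dual.contMDiffOn_qcoord i
    have h2 : ContMDiffOn 𝓘(ℝ, E × (F →L[ℝ] ℝ)) 𝓘(ℝ, F × ℝ) ∞
        (fun φ : A.dual.Base => A.triv i φ.1 (a.1 φ.1)) {φ | φ.1 ∈ A.U i} :=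
      (a.2 i).comp A.dual.contMDiff_fst.contMDiffOn (fun φ hφ => hφ)
    have h3 := contDiff_fst (𝕜 := ℝ) (E := F) (F := ℝ) (n := ∞) |>.contMDiff.comp_contMDiffOn h2
    have h4 := contDiff_snd (𝕜 := ℝ) (E := F) (F := ℝ) (n := ∞) |>.contMDiff.comp_contMDiffOn h2
    refine (h1.prodMk_space ((h1.clm_apply h3).add h4).neg).congr ?_
    rintro ⟨x, φ⟩ -
    induction φ using Quotient.inductionOn with
    | _ φ =>
      have h5 := A.dual.triv_smul_v_vadd i x (-(φ.1 (a.1 x))) φ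
      refine h5.trans ?_
      have h6 := A.affine_eq i x φ.1 (a.1 x)
      rw [φ.2] at h6
      refine Prod.ext rfl ?_
      change (A.affCoord i x φ.1).2 + -(φ.1 (a.1 x)) =
        -((A.affCoord i x φ.1).1 (A.triv i x (a.1 x)).1 + (A.triv i x (a.1 x)).2)
      rw [h6]
      ring

/-- The value of the linear part of a class of affine functions modulo constants. -/
def linPart {x : M} (u : A.Mod x) : A.dual.QFib x → ℝ :=
  Quotient.lift (fun φ : A.DualFib x => φ.1.linear u) (by
    rintro φ _ ⟨t, rfl⟩
    change φ.1.linear u = (t • AffineMap.const ℝ (A.Fib x) (1 : ℝ) + φ.1).linear u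
    simp)

variable {A} in
/-- The affine function `ι^#_X` on `A^# / ⟨1⟩` corresponding to a section `X` of `V(A)`. -/
def iotaFun (X : A.SecV) : C^∞⟮𝓘(ℝ, E × (F →L[ℝ] ℝ)), A.dual.Base; ℝ⟯ :=
  ⟨fun φ => A.linPart (X.1 φ.1) φ.2, by
    have key : ∀ i, ContMDiffOn 𝓘(ℝ, E × (F →L[ℝ] ℝ)) 𝓘(ℝ, ℝ) ∞
        (fun φ : A.dual.Base => A.linPart (X.1 φ.1) φ.2) {φ | φ.1 ∈ A.U i} := by
      intro i
      have h1 : ContMDiffOn 𝓘(ℝ, E × (F →L[ℝ] ℝ)) 𝓘(ℝ, F →L[ℝ] ℝ) ∞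
          (fun φ : A.dual.Base => A.dual.qcoord i φ.1 φ.2) {φ | φ.1 ∈ A.U i} :=
        A.dual.contMDiffOn_qcoord i
      have h2 : ContMDiffOn 𝓘(ℝ, E × (F →L[ℝ] ℝ)) 𝓘(ℝ, F × ℝ) ∞
          (fun φ : A.dual.Base => (A.triv i φ.1).linear (X.1 φ.1)) {φ | φ.1 ∈ A.U i} :=
        (X.2 i).comp A.dual.contMDiff_fst.contMDiffOn (fun φ hφ => hφ)
      have h3 := contDiff_fst (𝕜 := ℝ) (E := F) (F := ℝ) (n := ∞)
        |>.contMDiff.comp_contMDiffOn h2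
      have h4 := contDiff_snd (𝕜 := ℝ) (E := F) (F := ℝ) (n := ∞)
        |>.contMDiff.comp_contMDiffOn h2
      refine ((h1.clm_apply h3).add h4).congr ?_
      rintro ⟨x, φ⟩ -
      induction φ using Quotient.inductionOn with
      | _ φ =>
        change φ.1.linear (X.1 x) = (A.affCoord i x φ.1).1 ((A.triv i x).linear (X.1 x)).1 +
          ((A.triv i x).linear (X.1 x)).2
        rw [affCoord_fst]
        have h5 : (A.triv i x).linear (X.1 x) = (((A.triv i x).linear (X.1 x)).1, 0) +
            ((A.triv i x).linear (X.1 x)).2 • ((0, 1) : F × ℝ) := by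
          ext <;> simp
        have h6 : X.1 x = (A.triv i x).linear.symm (((A.triv i x).linear (X.1 x)).1, 0) +
            ((A.triv i x).linear (X.1 x)).2 • A.v x := by
          apply (A.triv i x).linear.injective
          rw [map_add, map_smul, A.triv_v, LinearEquiv.apply_symm_apply]
          exact h5
        conv_lhs => rw [h6]
        rw [map_add, map_smul, φ.2]
        simp
    intro φ
    exact (key (A.idx φ.1)).contMDiffAt ((A.dual.isOpen_over_U (A.idx φ.1)).mem_nhds
      (A.mem_U φ.1))⟩

/-! ### Morphisms of double affine bundles -/

/-- A morphism of trivial double affine bundles `W × K₁ × K₂ × K → W × K₁' × K₂' × K'` over the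
identity of `W`, `(x, k₁, k₂, k) ↦ (x, Φ₁ x k₁, Φ₂ x k₂, Φ₀ x k₁ k₂ k)`: it is smooth, and affine
on the fibres of both projections `(x, k₁, k₂, k) ↦ (x, k₁)` and `(x, k₁, k₂, k) ↦ (x, k₂)`. -/
structure IsTrivialDoubleAffineMorphism
    {K₁ K₂ K K₁' K₂' K' : Type*}
    [NormedAddCommGroup K₁] [NormedSpace ℝ K₁] [NormedAddCommGroup K₂] [NormedSpace ℝ K₂]
    [NormedAddCommGroup K] [NormedSpace ℝ K] [NormedAddCommGroup K₁'] [NormedSpace ℝ K₁']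
    [NormedAddCommGroup K₂'] [NormedSpace ℝ K₂'] [NormedAddCommGroup K'] [NormedSpace ℝ K']
    (W : Set E) (Φ₁ : E → K₁ → K₁') (Φ₂ : E → K₂ → K₂') (Φ₀ : E → K₁ → K₂ → K → K') : Prop where
  smooth₁ : ContDiffOn ℝ ∞ (fun q : E × K₁ => Φ₁ q.1 q.2) (W ×ˢ univ)
  smooth₂ : ContDiffOn ℝ ∞ (fun q : E × K₂ => Φ₂ q.1 q.2) (W ×ˢ univ)
  smooth₀ : ContDiffOn ℝ ∞ (fun q : E × K₁ × K₂ × K => Φ₀ q.1 q.2.1 q.2.2.1 q.2.2.2) (W ×ˢ univ)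
  affine₁ : ∀ x ∈ W, ∀ k₁, ∃ T : K₂ × K →ᵃ[ℝ] K₂' × K', ∀ k₂ k,
    T (k₂, k) = (Φ₂ x k₂, Φ₀ x k₁ k₂ k)
  affine₂ : ∀ x ∈ W, ∀ k₂, ∃ T : K₁ × K →ᵃ[ℝ] K₁' × K', ∀ k₁ k,
    T (k₁, k) = (Φ₁ x k₁, Φ₀ x k₁ k₂ k)

/-- A special affgebroid structure on `A`: a morphism of double affine bundles
`PA → T(A^# / ⟨1⟩)` covering the identity of `A^# / ⟨1⟩`.

`PA` has the local coordinates `(x, y, p, ξ)` and the projections `(x, y)` to `A / ⟨v⟩` and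
`(x, ξ)` to `A^# / ⟨1⟩`; the tangent bundle of `A^# / ⟨1⟩` has the local coordinates
`(x, ξ, ẋ, ξ̇)` and the projections `(x, ξ)` to `A^# / ⟨1⟩` and `(x, ẋ)` to `TM`. The map
`A / ⟨v⟩ → TM` covered by the morphism is `left`. -/
@[ext] structure SpecialAffgebroid where
  toFun : A.Phase → TangentBundle 𝓘(ℝ, E × (F →L[ℝ] ℝ)) A.dual.Base
  left : A.Base → TangentBundle 𝓘(ℝ, E) M
  over_base : ∀ α, (toFun α).proj.1 = α.1.1
  comm_left : ∀ α, tangentMap 𝓘(ℝ, E × (F →L[ℝ] ℝ)) 𝓘(ℝ, E) (fun φ : A.dual.Base => φ.1)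
    (toFun α) = left α.1
  isMorphism : ∀ (i : A.Idx) (x₀ : M), ∃ (Φ₂ : E → F → E)
    (Φ₀ : E → (F →L[ℝ] ℝ) → F → (E →L[ℝ] ℝ) → (F →L[ℝ] ℝ)),
    IsTrivialDoubleAffineMorphism (chartAt E x₀ '' A.dom i x₀) (fun _ ξ => ξ) Φ₂ Φ₀ ∧
    ∀ b : A.Base, b.1 ∈ A.dom i x₀ → ∀ (σ : A.AVSection) (x : E) (y : F) (p : E →L[ℝ] ℝ)
      (ξ : F →L[ℝ] ℝ), A.coord i x₀ b = (x, y) → σ.phaseCoord i x₀ b = (p, ξ) →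
        A.dual.tangentCoord i x₀ (toFun (σ.ddP b)) = ((x, ξ), (Φ₂ x y, Φ₀ x ξ y p))

/-- Affine tensors: smooth sections `Γ` of the tensor product of the vector dual of `P(A^#)` and
the tangent bundle of `A^# / ⟨1⟩` for which the contraction with the first factor is a morphism
of double affine bundles `P(A^#) → T(A^# / ⟨1⟩)` covering the identity of `A^# / ⟨1⟩`.

`P(A^#)` has the local coordinates `(x, ξ, p, y)`, where `y` is an element of the double dual of
`F`, and the projections `(x, ξ)` to `A^# / ⟨1⟩` and `(x, y)` to `(A^#)^# / ⟨1⟩ = A / ⟨v⟩`. -/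
@[ext] structure AffineTensor where
  toFun : ∀ φ : A.dual.Base,
    A.dual.Ttilde φ ⊗[ℝ] TangentSpace 𝓘(ℝ, E × (F →L[ℝ] ℝ)) φ
  smooth : ∀ (σ : A.dual.AVSection) (f : C^∞⟮𝓘(ℝ, E × (F →L[ℝ] ℝ)), A.dual.Base; ℝ⟯),
    ContMDiff 𝓘(ℝ, E × (F →L[ℝ] ℝ)) 𝓘(ℝ, ℝ) ∞
      (fun φ => A.dual.contract (toFun φ) (σ.dd φ) (A.dual.dfun f φ))
  isMorphism : ∀ (i : A.Idx) (x₀ : M), ∃ (Φ₂ : E → ((F →L[ℝ] ℝ) →L[ℝ] ℝ) → E)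
    (Φ₀ : E → (F →L[ℝ] ℝ) → ((F →L[ℝ] ℝ) →L[ℝ] ℝ) → (E →L[ℝ] ℝ) → (F →L[ℝ] ℝ)),
    IsTrivialDoubleAffineMorphism (chartAt E x₀ '' A.dom i x₀) (fun _ ξ => ξ) Φ₂ Φ₀ ∧
    ∀ φ : A.dual.Base, φ.1 ∈ A.dom i x₀ → ∀ (σ : A.dual.AVSection) (x : E) (ξ : F →L[ℝ] ℝ)
      (p : E →L[ℝ] ℝ) (y : (F →L[ℝ] ℝ) →L[ℝ] ℝ),
      A.dual.coord i x₀ φ = (x, ξ) → σ.phaseCoord i x₀ φ = (p, y) →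
        A.dual.tangentCoord i x₀ ⟨φ, A.dual.sharpAt (toFun φ) (σ.dd φ)⟩ =
          ((x, ξ), (Φ₂ x y, Φ₀ x ξ y p))

variable {A}

/-- The morphism `P(A^#) → T(A^# / ⟨1⟩)` of a tensor. -/
def AffineTensor.sharp (Γ : A.AffineTensor) (β : A.dual.Phase) :
    TangentBundle 𝓘(ℝ, E × (F →L[ℝ] ℝ)) A.dual.Base :=
  ⟨β.1, A.dual.sharpAt (Γ.toFun β.1) β.2⟩

/-- The pairing `⟨Γ, dd σ ⊗ df⟩`. -/
def AffineTensor.pair (Γ : A.AffineTensor) (σ : A.dual.AVSection)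
    (f : C^∞⟮𝓘(ℝ, E × (F →L[ℝ] ℝ)), A.dual.Base; ℝ⟯) :
    C^∞⟮𝓘(ℝ, E × (F →L[ℝ] ℝ)), A.dual.Base; ℝ⟯ :=
  ⟨fun φ => A.dual.contract (Γ.toFun φ) (σ.dd φ) (A.dual.dfun f φ), Γ.smooth σ f⟩

/-- `Γ` is an aff-Poisson tensor: its bracket is the affine-linear part of an aff-Poisson bracket
on `AV(A^#)`. -/
def AffineTensor.IsAffPoisson (Γ : A.AffineTensor) : Prop :=
  ∃ P : A.dual.AffPoissonBracket, ∀ σ f, P.lin σ f = Γ.pair σ f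

variable (A)

/-- Affine-closed biderivations `Sec(AV(A^#)) × C^∞(A^# / ⟨1⟩) → C^∞(A^# / ⟨1⟩)`. -/
@[ext] structure AffineBiderivation where
  br : A.dual.AVSection → C^∞⟮𝓘(ℝ, E × (F →L[ℝ] ℝ)), A.dual.Base; ℝ⟯ →
    C^∞⟮𝓘(ℝ, E × (F →L[ℝ] ℝ)), A.dual.Base; ℝ⟯
  derivation_left : ∀ f, ∃ D : Derivation ℝ C^∞⟮𝓘(ℝ, E × (F →L[ℝ] ℝ)), A.dual.Base; ℝ⟯
    C^∞⟮𝓘(ℝ, E × (F →L[ℝ] ℝ)), A.dual.Base; ℝ⟯, ∀ σ h, br (σ.add h) f = br σ f + D h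
  derivation_right : ∀ σ, ∃ D : Derivation ℝ C^∞⟮𝓘(ℝ, E × (F →L[ℝ] ℝ)), A.dual.Base; ℝ⟯
    C^∞⟮𝓘(ℝ, E × (F →L[ℝ] ℝ)), A.dual.Base; ℝ⟯, ∀ f, br σ f = D f
  affine_closed : ∀ σ f, σ.IsAffine → A.dual.IsAffineFun f → A.dual.IsAffineFun (br σ f)

variable {A}

/-- The canonical isomorphism of double affine bundles `PA → P(A^#)`, which in all local
coordinates is `(x, y, p, ξ) ↦ (x, ξ, -p, y)`. -/
def IsCanonicalIso (R : A.Phase ≃ A.dual.Phase) : Prop :=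
  ∀ (i : A.Idx) (x₀ : M) (b : A.Base), b.1 ∈ A.dom i x₀ →
    ∀ (σ : A.AVSection) (φ : A.dual.Base) (τ : A.dual.AVSection), R (σ.ddP b) = τ.ddP φ →
      φ.1 = b.1 ∧
      ∀ (x : E) (y : F) (p : E →L[ℝ] ℝ) (ξ : F →L[ℝ] ℝ),
        A.coord i x₀ b = (x, y) → σ.phaseCoord i x₀ b = (p, ξ) →
          A.dual.coord i x₀ φ = (x, ξ) ∧
          τ.phaseCoord i x₀ φ = (-p, ContinuousLinearMap.apply ℝ ℝ y)

end affgebroid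

end phase

end SpecialAffineBundle

end

/-! Everything is compared on the sections ι_a and the functions ι_X over N. In local coordinates
ι_a is the function ξ(y(x)) + s(x), where (y, s) is the local expression of a, and ι_X has the same
form. Since y and s are arbitrary smooth functions, at a given point of N every element of the phase
fibre is the affine differential of some ι_a (`exists_iotaSec_dd_eq`), and every covector is the
differential of some ι_X (`exists_iotaFun_dfun_eq`). By Hadamard's lemma a derivation of the smooth
functions sees only the differential at a point (`derivation_eq_zero_of_dfun_eq_zero`). Hence affine
tensors and biderivations are determined by their values on the ι_a and ι_X. The map X ↦ ι_X is
injective and its image is exactly the fibrewise affine functions (`IsAffineFun.exists_iotaFun`), so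
for an affine-closed biderivation these values are the same thing as a bracket Sec(A) × Sec(V(A)) →
Sec(V(A)).

The canonical isomorphism R is defined without coordinates: the differential of the zero section of
ψ along a corresponds to that of ι_a along ψ when ψ(a) is locally constant (`Rel`). Differentiating
ψ(a) = const in any chart gives (x, y, p, ξ) ↦ (x, ξ, -p, y) (`Rel.coord`). With R available,
special affgebroids and affine tensors have the same local form up to the substitution (y, p) ↦
(evaluation at y, -p), and it only remains to see that a map with this local form is the contraction
with a smooth tensor (`exists_affineTensor`).

From a biderivation to a bracket: affine-closedness gives the bracket, and the anchors come from its
action on pull-backs from M. The product ι_Y · {ι_a, g} equals {ι_a, g ι_Y} - g {ι_a, ι_Y}, so it is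
affine for every Y. A product of two affine functions that are not constant on a fibre is quadratic,
so {ι_a, g} is a pull-back (`exists_pull_eq_of_mul_isAffineFun`). One more condition is needed to
turn this into pointwise anchors: {σ + f, g} = {σ, g} for f, g pulled back from M. For a tensor it
holds because the velocity ẋ does not depend on p (`AffineTensor.pair_add_pull_pull`); for an
arbitrary biderivation it holds once F is nonzero (`AffineBiderivation.br_add_pull_pull`), which is
where the rank assumption enters.

From a bracket to a tensor: each argument of the bracket is a first order operator whose symbol is
an anchor and which kills v_A. Therefore the value of ι_{[a,X]} at φ depends only on the
differentials of ι_a and ι_X at φ (`iotaFun_eq_zero_of_dfun_eq_zero`), and this defines a pointwise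
map from P(A^#) to TN (`exists_sharp`). Testing with suitable sections shows that it has the local
form of a morphism of double affine bundles (`Represents.isTrivialDoubleAffineMorphism`).

The Lie case: an aff-Poisson bracket restricts to the sections ι_a. Conversely the Jacobiator of the
extended bracket depends only on the differentials of its arguments, because the commutator of two
derivations is a derivation; so it vanishes once it vanishes on the ι_a. -/

section Analysis

/-! ### Analysis in normed spaces: parametric integrals, Hadamard's lemma, duality. -/

theorem contDiff_intervalIntegral_param {V : Type*} [NormedAddCommGroup V] [NormedSpace ℝ V]
    [FiniteDimensional ℝ V] (n : ℕ) (K : V × ℝ → ℝ) (hK : ContDiff ℝ ∞ K) :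
    ContDiff ℝ n (fun z => ∫ t in (0 : ℝ)..1, K (z, t)) := by
  have : ProperSpace V := FiniteDimensional.proper ℝ V
  induction n generalizing K with
  | zero =>
    refine contDiff_zero.2 ?_
    exact intervalIntegral.continuous_parametric_intervalIntegral_of_continuous'
      (f := fun z t => K (z, t)) hK.continuous 0 1
  | succ n ih =>
    have hd : ContDiff ℝ ∞ (fun q : V × ℝ =>
        (fderiv ℝ K q).comp (ContinuousLinearMap.inl ℝ V ℝ)) :=
      (hK.fderiv_right (m := ∞) (by simp)).clm_comp contDiff_const
    have hder : ∀ z₀ : V, HasFDerivAt (fun z => ∫ t in (0 : ℝ)..1, K (z, t))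
        (∫ t in (0 : ℝ)..1, (fderiv ℝ K (z₀, t)).comp (ContinuousLinearMap.inl ℝ V ℝ)) z₀ := by
      intro z₀
      obtain ⟨C, hC⟩ := ((isCompact_closedBall z₀ 1).prod (isCompact_Icc (a := (0 : ℝ)) (b := 1))).exists_bound_of_continuousOn
        hd.continuous.continuousOn
      refine (intervalIntegral.hasFDerivAt_integral_of_dominated_of_fderiv_le
        (F := fun z t => K (z, t))
        (F' := fun z t => (fderiv ℝ K (z, t)).comp (ContinuousLinearMap.inl ℝ V ℝ))
        (s := Metric.ball z₀ 1) (bound := fun _ => C)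
        (Metric.ball_mem_nhds z₀ one_pos) ?_ ?_ ?_ ?_ ?_ ?_)
      · refine Filter.Eventually.of_forall fun z => ?_
        exact (hK.continuous.comp (by fun_prop : Continuous fun t : ℝ => (z, t))).aestronglyMeasurable
      · exact (hK.continuous.comp (by fun_prop : Continuous fun t : ℝ => (z₀, t))).intervalIntegrable _ _
      · exact (hd.continuous.comp (by fun_prop : Continuous fun t : ℝ => (z₀, t))).aestronglyMeasurable
      · refine Filter.Eventually.of_forall fun t ht z hz => ?_
        rw [uIoc_of_le zero_le_one] at ht
        exact hC (z, t) ⟨Metric.ball_subset_closedBall hz, ht.1.le, ht.2⟩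
      · exact intervalIntegrable_const
      · refine Filter.Eventually.of_forall fun t ht z hz => ?_
        have h1 : HasFDerivAt K (fderiv ℝ K (z, t)) (z, t) :=
          (hK.differentiable (by simp)).differentiableAt.hasFDerivAt
        exact h1.comp z (hasFDerivAt_prodMk_left z t)
    have : ((n + 1 : ℕ) : WithTop ℕ∞) = (n : WithTop ℕ∞) + 1 := by push_cast; rfl
    -- On a fixed vector y the derivative is again a parametric integral, with the smooth kernel
    -- obtained by differentiating K along (y, 0). The induction hypothesis covers all kernels, so
    -- it applies to this one.
    rw [this, contDiff_succ_iff_fderiv_apply]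
    refine ⟨fun z => (hder z).differentiableAt, by simp, fun y => ?_⟩
    have h2 : ∀ z, fderiv ℝ (fun z => ∫ t in (0 : ℝ)..1, K (z, t)) z y =
        ∫ t in (0 : ℝ)..1, fderiv ℝ K (z, t) (y, 0) := by
      intro z
      rw [(hder z).fderiv]
      have hi : IntervalIntegrable (fun t : ℝ => (fderiv ℝ K (z, t)).comp
          (ContinuousLinearMap.inl ℝ V ℝ)) MeasureTheory.volume 0 1 :=
        (hd.continuous.comp (by fun_prop : Continuous fun t : ℝ => (z, t))).intervalIntegrable _ _
      exact ContinuousLinearMap.intervalIntegral_apply hi y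
    simp only [h2]
    apply ih (fun q => fderiv ℝ K q (y, 0))
    exact (hK.fderiv_right (m := ∞) (by simp)).clm_apply contDiff_const

/-- Hadamard's lemma. -/
theorem exists_contDiff_eq_add_apply_sub {V : Type*} [NormedAddCommGroup V] [NormedSpace ℝ V]
    [FiniteDimensional ℝ V] {f : V → ℝ} (hf : ContDiff ℝ ∞ f) (z₀ : V) :
    ∃ g : V → V → ℝ, (∀ v, ContDiff ℝ ∞ (fun z => g z v)) ∧ (∀ z, IsLinearMap ℝ (g z)) ∧
      (∀ z, f z = f z₀ + g z (z - z₀)) ∧ ∀ v, g z₀ v = fderiv ℝ f z₀ v := by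
  have hd : ContDiff ℝ ∞ (fderiv ℝ f) := hf.fderiv_right (by simp)
  have hc : ∀ z v : V, Continuous fun t : ℝ => fderiv ℝ f (z₀ + t • (z - z₀)) v := by
    intro z v
    exact (hd.continuous.comp (by fun_prop)).clm_apply continuous_const
  refine ⟨fun z v => ∫ t in (0 : ℝ)..1, fderiv ℝ f (z₀ + t • (z - z₀)) v, fun v => ?_,
    fun z => ⟨fun v w => ?_, fun c v => ?_⟩, fun z => ?_, fun v => ?_⟩
  · refine contDiff_infty.2 fun n => ?_
    apply contDiff_intervalIntegral_param n (fun q : V × ℝ => fderiv ℝ f (z₀ + q.2 • (q.1 - z₀)) v)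
    refine (hd.comp ?_).clm_apply contDiff_const
    exact contDiff_const.add (contDiff_snd.smul (contDiff_fst.sub contDiff_const))
  · simp only [map_add]
    exact intervalIntegral.integral_add ((hc z v).intervalIntegrable _ _)
      ((hc z w).intervalIntegrable _ _)
  · simp only [map_smul]
    exact intervalIntegral.integral_smul _ _
  · have h : ∀ t ∈ uIcc (0 : ℝ) 1, HasDerivAt (fun t : ℝ => f (z₀ + t • (z - z₀)))
        (fderiv ℝ f (z₀ + t • (z - z₀)) (z - z₀)) t := by
      intro t _
      have h1 : HasDerivAt (fun t : ℝ => z₀ + t • (z - z₀)) (z - z₀) t := by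
        simpa using ((hasDerivAt_id t).smul_const (z - z₀)).const_add z₀
      exact ((hf.differentiable (by simp)).differentiableAt.hasFDerivAt).comp_hasDerivAt t h1
    have := intervalIntegral.integral_eq_sub_of_hasDerivAt h ((hc z _).intervalIntegrable _ _)
    simp only [one_smul, zero_smul, add_zero, add_sub_cancel] at this
    dsimp only
    rw [this]; ring
  · simp

/-- A map that is smooth in the first variable and affine in the second one is smooth. -/
theorem contDiffOn_of_affine_right {V K G : Type*} [NormedAddCommGroup V] [NormedSpace ℝ V]
    [NormedAddCommGroup K] [NormedSpace ℝ K] [FiniteDimensional ℝ K]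
    [NormedAddCommGroup G] [NormedSpace ℝ G] {s : Set V} {f : V → K → G}
    (h1 : ∀ k, ContDiffOn ℝ ∞ (fun x => f x k) s)
    (h2 : ∀ x ∈ s, ∃ T : K →ᵃ[ℝ] G, ∀ k, f x k = T k) :
    ContDiffOn ℝ ∞ (fun q : V × K => f q.1 q.2) (s ×ˢ univ) := by
  let b := Module.finBasis ℝ K
  have hfst : ContDiffOn ℝ ∞ (fun q : V × K => q.1) (s ×ˢ univ) := contDiff_fst.contDiffOn
  -- An affine map is its value at 0 plus its increments along a basis, weighted by the coordinates,
  -- so only finitely many of the functions x ↦ f x k are involved.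
  have key : ∀ q ∈ s ×ˢ (univ : Set K), f q.1 q.2 =
      f q.1 0 + ∑ j, (b.coord j).toContinuousLinearMap q.2 • (f q.1 (b j) - f q.1 0) := by
    rintro ⟨x, k⟩ ⟨hx, -⟩
    obtain ⟨T, hT⟩ := h2 x hx
    simp only [hT]
    have h3 : ∀ k, T k - T 0 = T.linear k := by
      intro k
      have := T.linearMap_vsub k 0
      simpa using this.symm
    simp only [h3]
    have h4 : T.linear k = ∑ j, (b.coord j) k • T.linear (b j) := by
      conv_lhs => rw [← b.sum_repr k, map_sum]
      simp
    have h5 := h3 k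
    rw [h4] at h5
    simpa [sub_eq_iff_eq_add'] using h5
  refine ContDiffOn.congr ?_ key
  refine ((h1 0).comp hfst (fun q hq => hq.1)).add (ContDiffOn.sum fun j _ => ?_)
  refine ContDiffOn.smul ?_ ?_
  · exact ((ContinuousLinearMap.contDiff _).comp contDiff_snd).contDiffOn
  · exact ((h1 (b j)).comp hfst (fun q hq => hq.1)).sub ((h1 0).comp hfst (fun q hq => hq.1))

/-- A linear functional that vanishes on the kernel of a map onto the dual of a finite dimensional
space is the evaluation at a vector. -/
theorem exists_vector_of_ker_le {V T : Type*} [AddCommGroup V] [Module ℝ V] [AddCommGroup T]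
    [Module ℝ T] [TopologicalSpace T] [IsTopologicalAddGroup T] [ContinuousSMul ℝ T] [T2Space T]
    [FiniteDimensional ℝ T]
    (q : V → (T →L[ℝ] ℝ)) (hq : IsLinearMap ℝ q) (hs : Function.Surjective q)
    (l : V → ℝ) (hl : IsLinearMap ℝ l) (hk : ∀ v, q v = 0 → l v = 0) :
    ∃ w : T, ∀ v, l v = q v w := by
  let q' : V →ₗ[ℝ] (T →L[ℝ] ℝ) := hq.mk' q
  let l' : V →ₗ[ℝ] ℝ := hl.mk' l
  choose r hr using hs
  have hwd : ∀ v w, q v = q w → l v = l w := by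
    intro v w h
    have h1 : q' (v - w) = 0 := by
      rw [map_sub, sub_eq_zero]; exact h
    have h2 := hk _ h1
    have h3 : l' (v - w) = 0 := h2
    rw [map_sub, sub_eq_zero] at h3
    exact h3
  -- The factorization of l through q. It is additive and homogeneous although the right inverse r
  -- is arbitrary, because `hwd` makes l independent of the choice of preimage. Reflexivity of T
  -- then turns m into a vector.
  let m : Module.Dual ℝ T →ₗ[ℝ] ℝ :=
    { toFun := fun η => l (r η.toContinuousLinearMap)
      map_add' := fun η θ => by
        rw [← hl.map_add]
        apply hwd
        rw [hq.map_add, hr, hr, hr, map_add]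
      map_smul' := fun c η => by
        rw [RingHom.id_apply, ← hl.map_smul]
        apply hwd
        rw [hq.map_smul, hr, hr, map_smul] }
  refine ⟨(Module.evalEquiv ℝ T).symm m, fun v => ?_⟩
  have h1 : (Module.evalEquiv ℝ T) ((Module.evalEquiv ℝ T).symm m) (q v : T →ₗ[ℝ] ℝ) =
      m (q v : T →ₗ[ℝ] ℝ) := by
    rw [LinearEquiv.apply_symm_apply]
  rw [Module.evalEquiv_apply, Module.Dual.eval_apply] at h1
  refine Eq.trans ?_ h1.symm
  apply hwd
  rw [hr]
  ext; rfl

end Analysis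

noncomputable section

set_option linter.unusedSectionVars false

namespace SpecialAffineBundle

variable {E : Type*} [NormedAddCommGroup E] [NormedSpace ℝ E] [FiniteDimensional ℝ E]
  {M : Type*} [TopologicalSpace M] [ChartedSpace E M] [IsManifold 𝓘(ℝ, E) ∞ M] [T2Space M]
  {F : Type*} [NormedAddCommGroup F] [NormedSpace ℝ F]
  (A : SpecialAffineBundle E M F)

/-! ### Cut-offs, extension of local sections, local coordinates and differentials. -/

section

theorem exists_bump {x₁ : M} {s : Set M} (hs : s ∈ 𝓝 x₁) :
    ∃ χ : C^∞⟮𝓘(ℝ, E), M; ℝ⟯, (∀ᶠ x in 𝓝 x₁, χ x = 1) ∧ tsupport χ ⊆ s := by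
  obtain ⟨f, -, hf⟩ := (SmoothBumpFunction.nhds_basis_tsupport (I := 𝓘(ℝ, E)) x₁).mem_iff.1 hs
  exact ⟨⟨f, f.contMDiff⟩, f.eventuallyEq_one, hf⟩

/-- A function that vanishes off a closed set and is smooth near it is smooth. -/
theorem contMDiffOn_of_tsupport {E' N G : Type*} [NormedAddCommGroup E'] [NormedSpace ℝ E']
    [TopologicalSpace N] [ChartedSpace E' N] [NormedAddCommGroup G] [NormedSpace ℝ G]
    {π : N → M} (hπ : Continuous π) {χ : M → ℝ} {O : Set M} {U : Set N}
    (hO : IsOpen O) (hU : IsOpen U) (hχ : tsupport χ ⊆ O) {s : N → G}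
    (h1 : ContMDiffOn 𝓘(ℝ, E') 𝓘(ℝ, G) ∞ s (U ∩ π ⁻¹' O)) (h0 : ∀ n, χ (π n) = 0 → s n = 0) :
    ContMDiffOn 𝓘(ℝ, E') 𝓘(ℝ, G) ∞ s U := by
  intro n hn
  by_cases h : π n ∈ tsupport χ
  · exact (h1.contMDiffAt ((hU.inter (hO.preimage hπ)).mem_nhds ⟨hn, hχ h⟩)).contMDiffWithinAt
  · have h2 : ∀ᶠ m in 𝓝 n, s m = 0 := by
      have h3 : ∀ᶠ m in 𝓝 n, π m ∈ (tsupport χ)ᶜ :=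
        hπ.continuousAt.eventually_mem ((isClosed_tsupport χ).isOpen_compl.mem_nhds h)
      filter_upwards [h3] with m hm
      exact h0 m (image_eq_zero_of_notMem_tsupport hm)
    exact ((contMDiffAt_const (c := (0 : G))).congr_of_eventuallyEq h2).contMDiffWithinAt

theorem exists_contMDiff_eventuallyEq {G : Type*} [NormedAddCommGroup G] [NormedSpace ℝ G]
    {x₁ : M} {O : Set M} (hO : IsOpen O) (hx : x₁ ∈ O) {s : M → G}
    (hs : ContMDiffOn 𝓘(ℝ, E) 𝓘(ℝ, G) ∞ s O) :
    ∃ s' : M → G, ContMDiff 𝓘(ℝ, E) 𝓘(ℝ, G) ∞ s' ∧ ∀ᶠ x in 𝓝 x₁, s' x = s x := by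
  obtain ⟨χ, h1, h2⟩ := exists_bump (E := E) (hO.mem_nhds hx)
  refine ⟨fun x => χ x • s x, ?_, ?_⟩
  · rw [← contMDiffOn_univ]
    refine contMDiffOn_of_tsupport continuous_id hO isOpen_univ h2 ?_ (fun x h => ?_)
    · rw [univ_inter]
      exact χ.contMDiff.contMDiffOn.smul hs
    · simp only [id] at h
      simp [h]
  · filter_upwards [h1] with x hx
    simp [hx]

theorem exists_fun_eventuallyEq {x₁ : M} {O : Set M} (hO : IsOpen O) (hx : x₁ ∈ O) {s : M → ℝ}
    (hs : ContMDiffOn 𝓘(ℝ, E) 𝓘(ℝ, ℝ) ∞ s O) :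
    ∃ g : C^∞⟮𝓘(ℝ, E), M; ℝ⟯, ∀ᶠ x in 𝓝 x₁, g x = s x := by
  obtain ⟨s', h1, h2⟩ := exists_contMDiff_eventuallyEq hO hx hs
  exact ⟨⟨s', h1⟩, h2⟩

/-- The linear part of a transition map is the difference of two of its values. -/
theorem linear_trans (i j : A.Idx) (x : M) (w : F × ℝ) :
    (A.triv j x).linear ((A.triv i x).linear.symm w) =
      A.triv j x ((A.triv i x).symm w) - A.triv j x ((A.triv i x).symm 0) := by
  have h : (A.triv i x).symm w = (A.triv i x).linear.symm w +ᵥ (A.triv i x).symm 0 := by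
    apply (A.triv i x).injective
    rw [AffineEquiv.map_vadd]
    simp
  rw [h, AffineEquiv.map_vadd]
  simp

theorem contMDiffOn_trans_comp {E' N : Type*} [NormedAddCommGroup E'] [NormedSpace ℝ E']
    [TopologicalSpace N] [ChartedSpace E' N] {U : Set N} {π : N → M} {s : N → F × ℝ}
    (i j : A.Idx) (hπ : ContMDiffOn 𝓘(ℝ, E') 𝓘(ℝ, E) ∞ π U)
    (hs : ContMDiffOn 𝓘(ℝ, E') 𝓘(ℝ, F × ℝ) ∞ s U) (hU : ∀ n ∈ U, π n ∈ A.U i ∩ A.U j) :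
    ContMDiffOn 𝓘(ℝ, E') 𝓘(ℝ, F × ℝ) ∞ (fun n => A.triv j (π n) ((A.triv i (π n)).symm (s n))) U :=
  (A.smooth_trans i j).comp (hπ.prodMk hs) (fun n hn => ⟨hU n hn, mem_univ _⟩)

theorem contMDiffOn_linear_trans_comp {E' N : Type*} [NormedAddCommGroup E'] [NormedSpace ℝ E']
    [TopologicalSpace N] [ChartedSpace E' N] {U : Set N} {π : N → M} {s : N → F × ℝ}
    (i j : A.Idx) (hπ : ContMDiffOn 𝓘(ℝ, E') 𝓘(ℝ, E) ∞ π U)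
    (hs : ContMDiffOn 𝓘(ℝ, E') 𝓘(ℝ, F × ℝ) ∞ s U) (hU : ∀ n ∈ U, π n ∈ A.U i ∩ A.U j) :
    ContMDiffOn 𝓘(ℝ, E') 𝓘(ℝ, F × ℝ) ∞
      (fun n => (A.triv j (π n)).linear ((A.triv i (π n)).linear.symm (s n))) U := by
  simp only [linear_trans]
  exact (A.contMDiffOn_trans_comp i j hπ hs hU).sub
    (A.contMDiffOn_trans_comp i j hπ contMDiffOn_const hU)

/-- A smooth local section of `V(A)` extends to a section of `V(A)`, after shrinking. -/
theorem exists_secV_eventuallyEq (i : A.Idx) {x₁ : M} {O : Set M} (hO : IsOpen O) (hx : x₁ ∈ O)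
    (hi : x₁ ∈ A.U i) {s : M → F × ℝ} (hs : ContMDiffOn 𝓘(ℝ, E) 𝓘(ℝ, F × ℝ) ∞ s O) :
    ∃ X : A.SecV, ∀ᶠ x in 𝓝 x₁, (A.triv i x).linear (X.1 x) = s x := by
  have hO' := hO.inter (A.isOpen_U i)
  obtain ⟨χ, h1, h2⟩ := exists_bump (E := E) (hO'.mem_nhds ⟨hx, hi⟩)
  refine ⟨⟨fun x => (A.triv i x).linear.symm (χ x • s x), fun j => ?_⟩, ?_⟩
  · refine contMDiffOn_of_tsupport (π := fun x => x) continuous_id hO' (A.isOpen_U j) h2 ?_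
      (fun x h => by simp [h])
    refine A.contMDiffOn_linear_trans_comp i j contMDiffOn_id ?_ (fun x hx => ⟨hx.2.2, hx.1⟩)
    exact (χ.contMDiff.contMDiffOn.smul hs).mono (fun x hx => hx.2.1)
  · filter_upwards [h1] with x hx
    simp [hx]

variable {A} in
/-- The pull-back to `A / ⟨v⟩` of a function on `M`. -/
def pull (A : SpecialAffineBundle E M F) (g : C^∞⟮𝓘(ℝ, E), M; ℝ⟯) :
    C^∞⟮𝓘(ℝ, E × F), A.Base; ℝ⟯ :=
  ⟨fun b => g b.1, g.contMDiff.comp A.contMDiff_fst⟩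

theorem isOpen_baseChart_target (i : A.Idx) (x₀ : M) : IsOpen (A.baseChart i x₀).target :=
  (A.baseChartHomeo i x₀).open_target

theorem coord_mem_target {i : A.Idx} {x₀ : M} {b : A.Base} (hb : b.1 ∈ A.dom i x₀) :
    A.coord i x₀ b ∈ (A.baseChart i x₀).target := (A.baseChart i x₀).map_source hb

theorem coordSymm_coord {i : A.Idx} {x₀ : M} {b : A.Base} (hb : b.1 ∈ A.dom i x₀) :
    A.coordSymm i x₀ (A.coord i x₀ b) = b := (A.baseChart i x₀).left_inv hb

theorem coord_coordSymm {i : A.Idx} {x₀ : M} {q : E × F} (hq : q ∈ (A.baseChart i x₀).target) :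
    A.coord i x₀ (A.coordSymm i x₀ q) = q := (A.baseChart i x₀).right_inv hq

theorem coordSymm_mem {i : A.Idx} {x₀ : M} {q : E × F} (hq : q ∈ (A.baseChart i x₀).target) :
    (A.coordSymm i x₀ q).1 ∈ A.dom i x₀ := (A.baseChart i x₀).map_target hq

theorem coord_injOn {i : A.Idx} {x₀ : M} {b c : A.Base} (hb : b.1 ∈ A.dom i x₀)
    (hc : c.1 ∈ A.dom i x₀) (h : A.coord i x₀ b = A.coord i x₀ c) : b = c :=
  (A.baseChart i x₀).injOn hb hc h

theorem contMDiffOn_coordSymm (i : A.Idx) (x₀ : M) :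
    ContMDiffOn 𝓘(ℝ, E × F) 𝓘(ℝ, E × F) ∞ (A.coordSymm i x₀) (A.baseChart i x₀).target :=
  contMDiffOn_symm_of_mem_maximalAtlas (A.baseChartHomeo_mem i x₀)

theorem contDiffOn_comp_coordSymm (i : A.Idx) (x₀ : M) {G : Type*} [NormedAddCommGroup G]
    [NormedSpace ℝ G] {h : A.Base → G} {U : Set A.Base}
    (hh : ContMDiffOn 𝓘(ℝ, E × F) 𝓘(ℝ, G) ∞ h U) (hU : ∀ b : A.Base, b.1 ∈ A.U i → b ∈ U) :
    ContDiffOn ℝ ∞ (fun q => h (A.coordSymm i x₀ q)) (A.baseChart i x₀).target := by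
  rw [← contMDiffOn_iff_contDiffOn]
  exact hh.comp (A.contMDiffOn_coordSymm i x₀) (fun q hq => hU _ hq.2)

theorem contDiffOn_fun_comp_coordSymm (i : A.Idx) (x₀ : M)
    (h : C^∞⟮𝓘(ℝ, E × F), A.Base; ℝ⟯) :
    ContDiffOn ℝ ∞ (fun q => h (A.coordSymm i x₀ q)) (A.baseChart i x₀).target :=
  A.contDiffOn_comp_coordSymm i x₀ h.contMDiff.contMDiffOn (fun _ _ => mem_univ _)

/-- A smooth function of the coordinates extends to the total space, after shrinking in `M`. -/
theorem exists_base_fun_eventuallyEq (i : A.Idx) (x₀ : M) {x₁ : M} (hx : x₁ ∈ A.dom i x₀)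
    {s : E × F → ℝ} (hs : ContDiffOn ℝ ∞ s (A.baseChart i x₀).target) :
    ∃ h : C^∞⟮𝓘(ℝ, E × F), A.Base; ℝ⟯, ∀ᶠ x in 𝓝 x₁, ∀ c : A.Base, c.1 = x →
      h c = s (A.coord i x₀ c) := by
  obtain ⟨χ, h1, h2⟩ := exists_bump (E := E) ((A.isOpen_dom i x₀).mem_nhds hx)
  refine ⟨⟨fun b => χ b.1 • s (A.coord i x₀ b), ?_⟩, ?_⟩
  · rw [← contMDiffOn_univ]
    refine contMDiffOn_of_tsupport A.contMDiff_fst.continuous (A.isOpen_dom i x₀) isOpen_univ h2 ?_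
      (fun x h => by
        change χ x.1 • s _ = 0
        rw [h, zero_smul])
    rw [univ_inter]
    refine (χ.contMDiff.comp A.contMDiff_fst).contMDiffOn.smul ?_
    exact (contMDiffOn_iff_contDiffOn.2 hs).comp (A.contMDiffOn_coord i x₀)
      (fun b hb => A.coord_mem_target hb)
  · filter_upwards [h1] with x hx c hc
    change χ c.1 * s _ = _
    rw [hc, hx, one_mul]

theorem eventually_base {b : A.Base} {p : M → Prop} (h : ∀ᶠ x in 𝓝 b.1, p x) :
    ∀ᶠ c : A.Base in 𝓝 b, p c.1 :=
  A.contMDiff_fst.continuous.continuousAt.eventually h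

theorem mdifferentiableAt_coord {i : A.Idx} {x₀ : M} {b : A.Base} (hb : b.1 ∈ A.dom i x₀) :
    MDifferentiableAt 𝓘(ℝ, E × F) 𝓘(ℝ, E × F) (A.coord i x₀) b :=
  ((A.contMDiffOn_coord i x₀).contMDiffAt ((A.isOpen_over_dom i x₀).mem_nhds hb)).mdifferentiableAt
    (by simp)

theorem mfderiv_coord_bijective {i : A.Idx} {x₀ : M} {b : A.Base} (hb : b.1 ∈ A.dom i x₀) :
    Function.Bijective (mfderiv 𝓘(ℝ, E × F) 𝓘(ℝ, E × F) (A.coord i x₀) b) := by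
  have hm : (A.baseChartHomeo i x₀).MDifferentiable 𝓘(ℝ, E × F) 𝓘(ℝ, E × F) :=
    mdifferentiable_of_mem_atlas (A.mem_atlas_iff.2 ⟨A.baseChart i x₀, ⟨i, x₀, rfl⟩, rfl⟩)
  exact hm.mfderiv_bijective hb

/-- The differential of a function in local coordinates. -/
def cdiff (i : A.Idx) (x₀ : M) (h : A.Base → ℝ) (b : A.Base) : E × F →L[ℝ] ℝ :=
  fderiv ℝ (fun q => h (A.coordSymm i x₀ q)) (A.coord i x₀ b)

theorem differentiableAt_comp_coordSymm {i : A.Idx} {x₀ : M} {b : A.Base} (hb : b.1 ∈ A.dom i x₀)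
    (h : C^∞⟮𝓘(ℝ, E × F), A.Base; ℝ⟯) :
    DifferentiableAt ℝ (fun q => h (A.coordSymm i x₀ q)) (A.coord i x₀ b) :=
  ((A.contDiffOn_fun_comp_coordSymm i x₀ h).contDiffAt
    ((A.isOpen_baseChart_target i x₀).mem_nhds (A.coord_mem_target hb))).differentiableAt (by simp)

theorem dfun_apply {i : A.Idx} {x₀ : M} {b : A.Base} (hb : b.1 ∈ A.dom i x₀)
    (h : C^∞⟮𝓘(ℝ, E × F), A.Base; ℝ⟯) (w : TangentSpace 𝓘(ℝ, E × F) b) :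
    A.dfun h b w =
      A.cdiff i x₀ h b (mfderiv 𝓘(ℝ, E × F) 𝓘(ℝ, E × F) (A.coord i x₀) b w) := by
  have h1 : (h : A.Base → ℝ) =ᶠ[𝓝 b] (fun q => h (A.coordSymm i x₀ q)) ∘ A.coord i x₀ := by
    filter_upwards [(A.isOpen_over_dom i x₀).mem_nhds hb] with c hc
    simp only [Function.comp, A.coordSymm_coord hc]
  have h2 := (A.differentiableAt_comp_coordSymm hb h).mdifferentiableAt
  have h3 := mfderiv_comp b h2 (A.mdifferentiableAt_coord hb)
  rw [dfun, h1.mfderiv_eq, h3, mfderiv_eq_fderiv]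
  rfl

theorem dfun_eq_iff {i : A.Idx} {x₀ : M} {b : A.Base} (hb : b.1 ∈ A.dom i x₀)
    (h k : C^∞⟮𝓘(ℝ, E × F), A.Base; ℝ⟯) :
    A.dfun h b = A.dfun k b ↔ A.cdiff i x₀ h b = A.cdiff i x₀ k b := by
  constructor
  · intro H
    refine ContinuousLinearMap.ext fun w => ?_
    obtain ⟨w', rfl⟩ := (A.mfderiv_coord_bijective hb).2 w
    have := congrArg (fun L => L w') H
    simp only [A.dfun_apply hb] at this
    exact this
  · intro H
    refine ContinuousLinearMap.ext fun w => ?_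
    rw [A.dfun_apply hb, A.dfun_apply hb, H]

end

/-! ### Differentials in local coordinates, and locality of derivations. -/

section

/-- Germs are taken along whole fibres: a property is required over a neighbourhood in M, not in the
total space. This suffices because all cut-offs are pulled back from M. -/
theorem eventually_coordSymm {i : A.Idx} {x₀ : M} {b : A.Base} (hb : b.1 ∈ A.dom i x₀)
    {p : M → Prop} (h : ∀ᶠ x in 𝓝 b.1, p x) :
    ∀ᶠ q in 𝓝 (A.coord i x₀ b), q ∈ (A.baseChart i x₀).target ∧ p (A.coordSymm i x₀ q).1 := by
  have ht := (A.isOpen_baseChart_target i x₀).mem_nhds (A.coord_mem_target hb)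
  have hc : ContinuousAt (A.coordSymm i x₀) (A.coord i x₀ b) :=
    (A.contMDiffOn_coordSymm i x₀).continuousOn.continuousAt ht
  have h' : ∀ᶠ c : A.Base in 𝓝 (A.coordSymm i x₀ (A.coord i x₀ b)), p c.1 := by
    rw [A.coordSymm_coord hb]
    exact A.eventually_base h
  filter_upwards [ht, hc.eventually h'] with q h1 h2
  exact ⟨h1, h2⟩

theorem cdiff_congr {i : A.Idx} {x₀ : M} {b : A.Base} (hb : b.1 ∈ A.dom i x₀) {h k : A.Base → ℝ}
    (H : ∀ᶠ x in 𝓝 b.1, ∀ c : A.Base, c.1 = x → h c = k c) :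
    A.cdiff i x₀ h b = A.cdiff i x₀ k b := by
  refine Filter.EventuallyEq.fderiv_eq ?_
  filter_upwards [A.eventually_coordSymm hb H] with q hq
  exact hq.2 _ rfl

theorem cdiff_comp_coord {i : A.Idx} {x₀ : M} {b : A.Base} (hb : b.1 ∈ A.dom i x₀)
    (s : E × F → ℝ) :
    A.cdiff i x₀ (fun c => s (A.coord i x₀ c)) b = fderiv ℝ s (A.coord i x₀ b) := by
  refine Filter.EventuallyEq.fderiv_eq ?_
  filter_upwards [(A.isOpen_baseChart_target i x₀).mem_nhds (A.coord_mem_target hb)] with q hq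
  rw [A.coord_coordSymm hq]

theorem exists_cdiff_eq {i : A.Idx} {x₀ : M} {b : A.Base} (hb : b.1 ∈ A.dom i x₀)
    (L : E × F →L[ℝ] ℝ) : ∃ h : C^∞⟮𝓘(ℝ, E × F), A.Base; ℝ⟯, A.cdiff i x₀ h b = L := by
  obtain ⟨h, hh⟩ := A.exists_base_fun_eventuallyEq i x₀ hb L.contDiff.contDiffOn
  refine ⟨h, ?_⟩
  rw [A.cdiff_congr (k := fun c => L (A.coord i x₀ c)) hb hh, A.cdiff_comp_coord hb, L.fderiv]

/-! ### Derivations of the algebra of smooth functions -/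

/-- Multiply by a bump function pulled back from M and supported where h vanishes: the product is
zero, and the Leibniz rule at b leaves only the value of D h. -/
theorem derivation_eq_zero_of_eventually
    (D : Derivation ℝ C^∞⟮𝓘(ℝ, E × F), A.Base; ℝ⟯ C^∞⟮𝓘(ℝ, E × F), A.Base; ℝ⟯)
    {h : C^∞⟮𝓘(ℝ, E × F), A.Base; ℝ⟯} {b : A.Base}
    (H : ∀ᶠ x in 𝓝 b.1, ∀ c : A.Base, c.1 = x → h c = 0) : D h b = 0 := by
  obtain ⟨χ, h1, h2⟩ := exists_bump (E := E) H
  have h3 : A.pull χ * h = 0 := by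
    ext c
    change χ c.1 * h c = 0
    by_cases hx : χ c.1 = 0
    · rw [hx, zero_mul]
    · rw [h2 (subset_tsupport _ hx) c rfl, mul_zero]
  have h4 : D (A.pull χ * h) b = χ b.1 * D h b + h b * D (A.pull χ) b := by
    rw [D.leibniz]
    rfl
  have h5 : h b = 0 := H.self_of_nhds b rfl
  rw [h3, map_zero, h1.self_of_nhds, h5] at h4
  simpa using h4.symm

theorem derivation_congr
    (D : Derivation ℝ C^∞⟮𝓘(ℝ, E × F), A.Base; ℝ⟯ C^∞⟮𝓘(ℝ, E × F), A.Base; ℝ⟯)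
    {h k : C^∞⟮𝓘(ℝ, E × F), A.Base; ℝ⟯} {b : A.Base}
    (H : ∀ᶠ x in 𝓝 b.1, ∀ c : A.Base, c.1 = x → h c = k c) : D h b = D k b := by
  have h1 : D (h - k) b = 0 := by
    apply A.derivation_eq_zero_of_eventually D
    filter_upwards [H] with x hx c hc
    change h c - k c = 0
    rw [hx c hc, sub_self]
  rw [map_sub] at h1
  exact sub_eq_zero.1 h1

/-- Hadamard's lemma needs a smooth function on all of E × F. A cut-off in the E-direction is
enough, since the fibre coordinate already runs through the whole of F. -/
theorem exists_contDiff_eventuallyEq {i : A.Idx} {x₀ : M} {b : A.Base} (hb : b.1 ∈ A.dom i x₀)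
    (h : C^∞⟮𝓘(ℝ, E × F), A.Base; ℝ⟯) :
    ∃ s : E × F → ℝ, ContDiff ℝ ∞ s ∧
      ∀ᶠ x in 𝓝 b.1, ∀ c : A.Base, c.1 = x → h c = s (A.coord i x₀ c) := by
  have hW : IsOpen {e : E | e ∈ (chartAt E x₀).target ∧ (chartAt E x₀).symm e ∈ A.U i} :=
    (chartAt E x₀).isOpen_inter_preimage_symm (A.isOpen_U i)
  have hbt := A.coord_mem_target hb
  obtain ⟨χ, h1, h2⟩ := exists_bump (E := E) (M := E) (hW.mem_nhds hbt)
  refine ⟨fun q => χ q.1 • h (A.coordSymm i x₀ q), ?_, ?_⟩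
  · rw [← contMDiff_iff_contDiff, ← contMDiffOn_univ]
    refine contMDiffOn_of_tsupport (π := Prod.fst) continuous_fst hW isOpen_univ h2 ?_
      (fun x hx => by rw [hx, zero_smul])
    rw [univ_inter]
    refine (χ.contMDiff.comp contDiff_fst.contMDiff).contMDiffOn.smul ?_
    exact contMDiffOn_iff_contDiffOn.2 (A.contDiffOn_fun_comp_coordSymm i x₀ h)
  · have h3 : ∀ᶠ x in 𝓝 b.1, χ (chartAt E x₀ x) = 1 :=
      ((chartAt E x₀).continuousAt hb.2).eventually h1
    filter_upwards [h3, (A.isOpen_dom i x₀).mem_nhds hb] with x hx hxd c hc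
    subst hc
    change _ = χ (chartAt E x₀ c.1) • _
    rw [hx, one_smul, A.coordSymm_coord hxd]

theorem fun_sum_apply {ι : Type*} (s : Finset ι) (f : ι → C^∞⟮𝓘(ℝ, E × F), A.Base; ℝ⟯)
    (b : A.Base) : (∑ k ∈ s, f k) b = ∑ k ∈ s, f k b := by
  have := map_sum (ContMDiffMap.coeFnRingHom (I := 𝓘(ℝ, E × F)) (I' := 𝓘(ℝ, ℝ)) (N := A.Base)
    (R := ℝ) (n := ∞)) f s
  have h := congrFun this b
  rw [Finset.sum_apply] at h
  exact h

variable [FiniteDimensional ℝ F]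

/-- By Hadamard's lemma h is, over a neighbourhood, a constant plus a sum of products e_k g_k. The
coordinate differences e_k vanish at b, and so do the g_k, whose values there are the partial
derivatives of h. The Leibniz rule annihilates each product. -/
theorem derivation_eq_zero_of_dfun_eq_zero
    (D : Derivation ℝ C^∞⟮𝓘(ℝ, E × F), A.Base; ℝ⟯ C^∞⟮𝓘(ℝ, E × F), A.Base; ℝ⟯)
    {h : C^∞⟮𝓘(ℝ, E × F), A.Base; ℝ⟯} {b : A.Base} (H : A.dfun h b = 0) : D h b = 0 := by
  have hb : b.1 ∈ A.dom (A.idx b.1) b.1 := ⟨A.mem_U b.1, mem_chart_source E b.1⟩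
  set i := A.idx b.1
  obtain ⟨s, hs, hs'⟩ := A.exists_contDiff_eventuallyEq hb h
  obtain ⟨g, hg, hgl, hgz, hg0⟩ := exists_contDiff_eq_add_apply_sub hs (A.coord i b.1 b)
  have hds : fderiv ℝ s (A.coord i b.1 b) = 0 := by
    rw [← A.cdiff_comp_coord hb, ← A.cdiff_congr hb hs']
    rw [← A.dfun_zero b, A.dfun_eq_iff hb] at H
    rw [H]
    exact fderiv_const_apply _
  let β := Module.finBasis ℝ (E × F)
  choose gh hgh using fun k => A.exists_base_fun_eventuallyEq i b.1 hb ((hg (β k)).contDiffOn)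
  choose eh heh using fun k => A.exists_base_fun_eventuallyEq i b.1 hb
    (s := fun z => (β.coord k).toContinuousLinearMap (z - A.coord i b.1 b))
    ((ContinuousLinearMap.contDiff _).comp (contDiff_id.sub contDiff_const)).contDiffOn
  let c : C^∞⟮𝓘(ℝ, E × F), A.Base; ℝ⟯ := algebraMap ℝ _ (s (A.coord i b.1 b))
  have key : D h b = D (c + ∑ k, eh k * gh k) b := by
    apply A.derivation_congr D
    filter_upwards [hs', Filter.eventually_all.2 hgh, Filter.eventually_all.2 heh] with x h1 h2 h3 d hd
    rw [h1 d hd, hgz]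
    have h4 : (c + ∑ k, eh k * gh k) d = s (A.coord i b.1 b) +
        ∑ k, eh k d * gh k d := by
      change s (A.coord i b.1 b) + (∑ k, eh k * gh k) _ = _
      rw [A.fun_sum_apply]
      rfl
    rw [h4]
    congr 1
    set z := A.coord i b.1 d
    have h6 : (hgl z).mk' (g z) (z - A.coord i b.1 b) =
        ∑ k, (β.coord k) (z - A.coord i b.1 b) • g z (β k) := by
      conv_lhs => rw [← β.sum_repr (z - A.coord i b.1 b), map_sum]
      simp
    refine Eq.trans h6 (Finset.sum_congr rfl fun k _ => ?_)
    rw [h2 k d hd, h3 k d hd]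
    rfl
  have hk : ∀ k, D (eh k * gh k) b = 0 := by
    intro k
    have h1 : D (eh k * gh k) b = eh k b * D (gh k) b + gh k b * D (eh k) b := by
      rw [D.leibniz]
      rfl
    have h2 : gh k b = 0 := by
      have := (hgh k).self_of_nhds b rfl
      refine this.trans ?_
      rw [hg0, hds]
      rfl
    have h3 : eh k b = 0 := by
      have := (heh k).self_of_nhds b rfl
      refine this.trans ?_
      rw [sub_self, map_zero]
    rw [h1, h2, h3]; simp
  rw [key, map_add, D.map_algebraMap, zero_add, map_sum]
  exact (A.fun_sum_apply _ _ b).trans (Finset.sum_eq_zero fun k _ => hk k)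

theorem derivation_congr_dfun
    (D : Derivation ℝ C^∞⟮𝓘(ℝ, E × F), A.Base; ℝ⟯ C^∞⟮𝓘(ℝ, E × F), A.Base; ℝ⟯)
    {h k : C^∞⟮𝓘(ℝ, E × F), A.Base; ℝ⟯} {b : A.Base} (H : A.dfun h b = A.dfun k b) :
    D h b = D k b := by
  have h1 : D (h - k) b = 0 := by
    apply A.derivation_eq_zero_of_dfun_eq_zero D
    rw [sub_eq_add_neg, A.dfun_add, A.dfun_neg, H, add_neg_cancel]
  rw [map_sub] at h1
  exact sub_eq_zero.1 h1

end

section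

/-! ### Sections of the AV-bundle in local coordinates -/

variable {A} in
/-- The local expression of a section of `AV(A)`. -/
def AVSection.loc (σ : A.AVSection) (i : A.Idx) (x₀ : M) (q : E × F) : ℝ :=
  -(A.triv i (A.coordSymm i x₀ q).1 (σ.toFun (A.coordSymm i x₀ q))).2

variable {A}

theorem AVSection.contDiffOn_loc (σ : A.AVSection) (i : A.Idx) (x₀ : M) :
    ContDiffOn ℝ ∞ (σ.loc i x₀) (A.baseChart i x₀).target := by
  have h := A.contDiffOn_comp_coordSymm i x₀ (σ.smooth i) (fun _ hb => hb)
  exact (contDiff_snd.comp_contDiffOn h).neg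

theorem AVSection.add_toFun (σ : A.AVSection) (h : C^∞⟮𝓘(ℝ, E × F), A.Base; ℝ⟯) (b : A.Base) :
    (σ.add h).toFun b = (-h b) • A.v b.1 +ᵥ σ.toFun b := by
  change h b • (-A.v b.1) +ᵥ σ.toFun b = _
  rw [neg_smul, smul_neg]

theorem AVSection.loc_add (σ : A.AVSection) (h : C^∞⟮𝓘(ℝ, E × F), A.Base; ℝ⟯) (i : A.Idx) (x₀ : M)
    (q : E × F) : (σ.add h).loc i x₀ q = σ.loc i x₀ q + h (A.coordSymm i x₀ q) := by
  simp only [AVSection.loc]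
  rw [AVSection.add_toFun, A.triv_smul_v_vadd]
  ring

/-- The derivative of the local expression of a section of `AV(A)`. -/
def AVSection.locDeriv (σ : A.AVSection) (i : A.Idx) (x₀ : M) (b : A.Base) : E × F →L[ℝ] ℝ :=
  fderiv ℝ (σ.loc i x₀) (A.coord i x₀ b)

theorem AVSection.phaseCoord_eq (σ : A.AVSection) (i : A.Idx) (x₀ : M) (b : A.Base) :
    σ.phaseCoord i x₀ b = ((σ.locDeriv i x₀ b).comp (ContinuousLinearMap.inl ℝ E F),
      (σ.locDeriv i x₀ b).comp (ContinuousLinearMap.inr ℝ E F)) := rfl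

theorem AVSection.phaseCoord_eq_iff (σ : A.AVSection) (i : A.Idx) (x₀ : M) (b : A.Base)
    (p : E →L[ℝ] ℝ) (ξ : F →L[ℝ] ℝ) :
    σ.phaseCoord i x₀ b = (p, ξ) ↔ σ.locDeriv i x₀ b = p.coprod ξ := by
  rw [phaseCoord_eq, Prod.mk.injEq]
  constructor
  · rintro ⟨h1, h2⟩
    refine ContinuousLinearMap.ext fun w => ?_
    have h3 : w = ContinuousLinearMap.inl ℝ E F w.1 + ContinuousLinearMap.inr ℝ E F w.2 := by
      ext <;> simp
    conv_lhs => rw [h3, map_add]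
    rw [← h1, ← h2]
    rfl
  · intro h
    rw [h]
    constructor <;> ext <;> simp

theorem AVSection.differentiableAt_loc (σ : A.AVSection) {i : A.Idx} {x₀ : M} {b : A.Base}
    (hb : b.1 ∈ A.dom i x₀) : DifferentiableAt ℝ (σ.loc i x₀) (A.coord i x₀ b) :=
  ((σ.contDiffOn_loc i x₀).contDiffAt
    ((A.isOpen_baseChart_target i x₀).mem_nhds (A.coord_mem_target hb))).differentiableAt (by simp)

theorem AVSection.locDeriv_add (σ : A.AVSection) (h : C^∞⟮𝓘(ℝ, E × F), A.Base; ℝ⟯)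
    {i : A.Idx} {x₀ : M} {b : A.Base} (hb : b.1 ∈ A.dom i x₀) :
    (σ.add h).locDeriv i x₀ b = σ.locDeriv i x₀ b + A.cdiff i x₀ h b := by
  have h1 : (σ.add h).loc i x₀ = σ.loc i x₀ + fun q => h (A.coordSymm i x₀ q) := by
    funext q
    exact σ.loc_add h i x₀ q
  rw [AVSection.locDeriv, h1, fderiv_add (σ.differentiableAt_loc hb)
    (A.differentiableAt_comp_coordSymm hb h)]
  rfl

theorem v_ne_zero (x : M) : A.v x ≠ 0 := by
  intro h
  have := A.triv_v (A.idx x) x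
  rw [h, map_zero] at this
  simpa using congrArg Prod.snd this

theorem AVSection.add_injective (σ : A.AVSection) {h k : C^∞⟮𝓘(ℝ, E × F), A.Base; ℝ⟯}
    (H : σ.add h = σ.add k) : h = k := by
  ext b
  have h1 : (σ.add h).toFun b = (σ.add k).toFun b := by rw [H]
  rw [add_toFun, add_toFun] at h1
  have h2 := vadd_right_cancel _ h1
  have h3 := smul_left_injective ℝ (v_ne_zero (A := A) b.1) h2
  exact neg_injective h3

/-- Both sections project to the same class, so they differ by a multiple of v_A. The coefficient is
a difference of ℝ-coordinates in a trivialization, hence smooth; its sign is reversed because the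
distinguished vector of AV(A) is -v_A. -/
theorem AVSection.exists_add (σ τ : A.AVSection) :
    ∃ h : C^∞⟮𝓘(ℝ, E × F), A.Base; ℝ⟯, τ = σ.add h := by
  have h1 : ∀ b : A.Base, ∃ t : ℝ, τ.toFun b = t • A.v b.1 +ᵥ σ.toFun b := by
    intro b
    exact (A.qmk_eq _ _).1 ((σ.proj b).trans (τ.proj b).symm)
  choose t ht using h1
  have h2 : ∀ (i : A.Idx) (b : A.Base), -t b =
      (A.triv i b.1 (σ.toFun b)).2 - (A.triv i b.1 (τ.toFun b)).2 := by
    intro i b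
    rw [ht, A.triv_smul_v_vadd]
    ring
  refine ⟨⟨fun b => -t b, fun b => ?_⟩, ?_⟩
  · have h3 : ContMDiffOn 𝓘(ℝ, E × F) 𝓘(ℝ, ℝ) ∞ (fun c : A.Base =>
        (A.triv (A.idx b.1) c.1 (σ.toFun c)).2 - (A.triv (A.idx b.1) c.1 (τ.toFun c)).2)
        {c | c.1 ∈ A.U (A.idx b.1)} :=
      (contDiff_snd.contMDiff.comp_contMDiffOn (σ.smooth _)).sub
        (contDiff_snd.contMDiff.comp_contMDiffOn (τ.smooth _))
    have h4 := h3.contMDiffAt ((A.isOpen_over_U _).mem_nhds (A.mem_U b.1))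
    refine h4.congr_of_eventuallyEq (Filter.Eventually.of_forall fun c => ?_)
    exact h2 _ c
  · apply AVSection.ext
    funext b
    refine (ht b).trans (Eq.trans ?_ (σ.add_toFun _ b).symm)
    congr 2
    exact (neg_neg _).symm

theorem AVSection.dd_add_eq_iff (σ : A.AVSection) (h k : C^∞⟮𝓘(ℝ, E × F), A.Base; ℝ⟯)
    (b : A.Base) : (σ.add h).dd b = (σ.add k).dd b ↔ A.dfun h b = A.dfun k b := by
  have h0 : (σ.add h).dd b = (σ.add k).dd b ↔ (A.phaseSetoid b).r (σ.add h) (σ.add k) :=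
    Quotient.eq (r := A.phaseSetoid b)
  rw [h0]
  constructor
  · rintro ⟨l, hl, hl'⟩
    rw [AVSection.add_add] at hl
    rw [σ.add_injective hl, A.dfun_add, hl', _root_.add_zero]
  · intro H
    refine ⟨k - h, ?_, ?_⟩
    · rw [AVSection.add_add, add_sub_cancel]
    · rw [sub_eq_add_neg, A.dfun_add, A.dfun_neg, H, add_neg_cancel]

/-- This makes the local derivative a coordinate on the phase fibre: it separates affine
differentials, and `exists_locDeriv_eq` shows that it takes every value. -/
theorem AVSection.dd_eq_iff (σ τ : A.AVSection) {i : A.Idx} {x₀ : M} {b : A.Base}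
    (hb : b.1 ∈ A.dom i x₀) : σ.dd b = τ.dd b ↔ σ.locDeriv i x₀ b = τ.locDeriv i x₀ b := by
  obtain ⟨h, rfl⟩ := σ.exists_add τ
  have h1 := σ.dd_add_eq_iff 0 h b
  rw [AVSection.add_zero] at h1
  rw [h1, A.dfun_eq_iff hb, σ.locDeriv_add h hb]
  have h2 := A.cdiff_comp_coord hb (fun _ => (0 : ℝ))
  rw [fderiv_fun_const] at h2
  have h3 : A.cdiff i x₀ ((0 : C^∞⟮𝓘(ℝ, E × F), A.Base; ℝ⟯)) b = 0 := h2
  rw [h3]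
  constructor
  · intro H
    rw [← H, _root_.add_zero]
  · intro H
    exact (add_eq_left.1 H.symm).symm

theorem exists_dd_eq {b : A.Base} (q : A.PhaseFib b) : ∃ σ : A.AVSection, σ.dd b = q :=
  Quotient.exists_rep q

theorem AVSection.exists_locDeriv_eq (σ : A.AVSection) {i : A.Idx} {x₀ : M} {b : A.Base}
    (hb : b.1 ∈ A.dom i x₀) (L : E × F →L[ℝ] ℝ) : ∃ τ : A.AVSection, τ.locDeriv i x₀ b = L := by
  obtain ⟨h, hh⟩ := A.exists_cdiff_eq hb (L - σ.locDeriv i x₀ b)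
  refine ⟨σ.add h, ?_⟩
  rw [σ.locDeriv_add h hb, hh, add_sub_cancel]

/-! ### Existence of sections -/

variable [SigmaCompactSpace M]

/-- Local zero sections are averaged with a partition of unity. The weights sum to 1, so the average
is an affine combination and commutes with every trivialization. -/
theorem nonempty_sec (A : SpecialAffineBundle E M F) : Nonempty A.Sec := by
  obtain ⟨ρ, hρ⟩ := SmoothPartitionOfUnity.exists_isSubordinate 𝓘(ℝ, E) (s := (univ : Set M))
    isClosed_univ (fun x => A.U (A.idx x)) (fun x => A.isOpen_U _)
    (fun x _ => mem_iUnion.2 ⟨x, A.mem_U x⟩)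
  let c : M → ∀ x, A.Fib x := fun j x => (A.triv (A.idx j) x).symm 0
  -- A mere base point for writing the affine combination. It need not depend smoothly on x, and it
  -- cancels in `h1`.
  let b : ∀ x, A.Fib x := fun x => (A.triv (A.idx x) x).symm 0
  refine ⟨⟨fun x => (∑ᶠ j, ρ j x • (c j x -ᵥ b x)) +ᵥ b x, fun i x hx => ?_⟩⟩
  have h1 : ∀ y, A.triv i y ((∑ᶠ j, ρ j y • (c j y -ᵥ b y)) +ᵥ b y) =
      ∑ᶠ j, ρ j y • A.triv i y (c j y) := by
    intro y
    rw [← ρ.sum_finsupport_smul_eq_finsum (x₀ := y) (fun j _ => c j y -ᵥ b y),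
      ← ρ.sum_finsupport_smul_eq_finsum (x₀ := y) (fun j _ => A.triv i y (c j y)),
      AffineEquiv.map_vadd, map_sum]
    have h2 : ∀ j, A.triv i y (c j y) = (A.triv i y).linear (c j y -ᵥ b y) + A.triv i y (b y) := by
      intro j
      rw [← vadd_eq_add, ← AffineEquiv.map_vadd, vsub_vadd]
    simp only [h2, smul_add, Finset.sum_add_distrib, ← Finset.sum_smul]
    rw [ρ.sum_finsupport y (mem_univ y)]
    simp
  simp only [h1]
  refine (ρ.contMDiffAt_finsum (fun j hj => ?_)).contMDiffWithinAt
  have hj' := hρ j hj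
  have h3 := A.contMDiffOn_trans_comp (A.idx j) i (U := A.U (A.idx j) ∩ A.U i) (contMDiffOn_id)
    (contMDiffOn_const (c := (0 : F × ℝ))) (fun n hn => hn)
  exact h3.contMDiffAt (((A.isOpen_U _).inter (A.isOpen_U i)).mem_nhds ⟨hj', hx⟩)

/-- The difference of two sections of `A`. -/
theorem exists_vadd (a b : A.Sec) : ∃ X : A.SecV, b = vadd a X := by
  refine ⟨⟨fun x => b.1 x -ᵥ a.1 x, fun i => ?_⟩, ?_⟩
  · refine ((b.2 i).sub (a.2 i)).congr (fun x _ => ?_)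
    have h := (A.triv i x).toAffineMap.linearMap_vsub (b.1 x) (a.1 x)
    exact h
  · apply Subtype.ext
    funext x
    exact (vsub_vadd _ _).symm

/-- A smooth local section of `A` extends to a section, after shrinking. -/
theorem exists_sec_eventuallyEq (i : A.Idx) {x₁ : M} {O : Set M} (hO : IsOpen O) (hx : x₁ ∈ O)
    (hi : x₁ ∈ A.U i) {s : M → F × ℝ} (hs : ContMDiffOn 𝓘(ℝ, E) 𝓘(ℝ, F × ℝ) ∞ s O) :
    ∃ a : A.Sec, ∀ᶠ x in 𝓝 x₁, A.triv i x (a.1 x) = s x := by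
  obtain ⟨a₀⟩ := A.nonempty_sec
  obtain ⟨X, hX⟩ := A.exists_secV_eventuallyEq i (hO.inter (A.isOpen_U i)) ⟨hx, hi⟩ hi
    (s := fun x => s x - A.triv i x (a₀.1 x))
    ((hs.mono inter_subset_left).sub ((a₀.2 i).mono inter_subset_right))
  refine ⟨vadd a₀ X, ?_⟩
  filter_upwards [hX] with x hx
  change A.triv i x (X.1 x +ᵥ a₀.1 x) = s x
  rw [AffineEquiv.map_vadd, hx]
  simp

end

section

/-! ### Evaluation in local coordinates -/

theorem hasFDerivAt_apply_add {E F : Type*} [NormedAddCommGroup E] [NormedSpace ℝ E]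
    [NormedAddCommGroup F] [NormedSpace ℝ F] {u : E → F × ℝ} {x : E} {u' : E →L[ℝ] F × ℝ}
    (hu : HasFDerivAt u u' x) (ξ : F →L[ℝ] ℝ) :
    HasFDerivAt (fun q : E × (F →L[ℝ] ℝ) => q.2 (u q.1).1 + (u q.1).2)
      ((ξ.comp ((ContinuousLinearMap.fst ℝ F ℝ).comp u') +
        (ContinuousLinearMap.snd ℝ F ℝ).comp u').coprod (ContinuousLinearMap.apply ℝ ℝ (u x).1))
      (x, ξ) := by
  have h1 : HasFDerivAt (fun q : E × (F →L[ℝ] ℝ) => u q.1)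
      (u'.comp (ContinuousLinearMap.fst ℝ E (F →L[ℝ] ℝ))) (x, ξ) := hu.comp (x, ξ) hasFDerivAt_fst
  have h2 := (hasFDerivAt_snd (𝕜 := ℝ) (p := (x, ξ))).clm_apply h1.fst
  have h3 := h2.add h1.snd
  refine h3.congr_fderiv ?_
  refine ContinuousLinearMap.ext fun w => ?_
  simp
  ring

theorem hasFDerivAt_apply_add' {E F : Type*} [NormedAddCommGroup E] [NormedSpace ℝ E]
    [NormedAddCommGroup F] [NormedSpace ℝ F] {u : E → (F →L[ℝ] ℝ) × ℝ} {x : E}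
    {u' : E →L[ℝ] (F →L[ℝ] ℝ) × ℝ} (hu : HasFDerivAt u u' x) (y : F) :
    HasFDerivAt (fun q : E × F => (u q.1).1 q.2 + (u q.1).2)
      (((ContinuousLinearMap.apply ℝ ℝ y).comp ((ContinuousLinearMap.fst ℝ (F →L[ℝ] ℝ) ℝ).comp u') +
        (ContinuousLinearMap.snd ℝ (F →L[ℝ] ℝ) ℝ).comp u').coprod (u x).1)
      (x, y) := by
  have h1 : HasFDerivAt (fun q : E × F => u q.1)
      (u'.comp (ContinuousLinearMap.fst ℝ E F)) (x, y) := hu.comp (x, y) hasFDerivAt_fst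
  have h2 := h1.fst.clm_apply (hasFDerivAt_snd (𝕜 := ℝ) (p := (x, y)))
  have h3 := h2.add h1.snd
  refine h3.congr_fderiv ?_
  refine ContinuousLinearMap.ext fun w => ?_
  simp
  ring

variable {A}

/-- The local expression of a section of `A`. -/
def Sec.loc (a : A.Sec) (i : A.Idx) (x₀ : M) (e : E) : F × ℝ :=
  A.triv i ((chartAt E x₀).symm e) (a.1 ((chartAt E x₀).symm e))

/-- The local expression of a section of `V(A)`. -/
def SecV.loc (X : A.SecV) (i : A.Idx) (x₀ : M) (e : E) : F × ℝ :=
  (A.triv i ((chartAt E x₀).symm e)).linear (X.1 ((chartAt E x₀).symm e))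

theorem contDiffAt_comp_chart_symm {G : Type*} [NormedAddCommGroup G] [NormedSpace ℝ G]
    {s : M → G} {U : Set M} (hU : IsOpen U) (hs : ContMDiffOn 𝓘(ℝ, E) 𝓘(ℝ, G) ∞ s U) {x₀ x : M}
    (hx : x ∈ U) (hx₀ : x ∈ (chartAt E x₀).source) :
    ContDiffAt ℝ ∞ (fun e => s ((chartAt E x₀).symm e)) (chartAt E x₀ x) := by
  rw [← contMDiffAt_iff_contDiffAt]
  have h1 : ContMDiffAt 𝓘(ℝ, E) 𝓘(ℝ, E) ∞ (chartAt E x₀).symm (chartAt E x₀ x) :=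
    (contMDiffOn_chart_symm (x := x₀)).contMDiffAt
      ((chartAt E x₀).open_target.mem_nhds ((chartAt E x₀).map_source hx₀))
  refine ContMDiffAt.comp (chartAt E x₀ x) ?_ h1
  rw [(chartAt E x₀).left_inv hx₀]
  exact hs.contMDiffAt (hU.mem_nhds hx)

theorem Sec.differentiableAt_loc (a : A.Sec) {i : A.Idx} {x₀ x : M} (hx : x ∈ A.dom i x₀) :
    DifferentiableAt ℝ (a.loc i x₀) (chartAt E x₀ x) :=
  (contDiffAt_comp_chart_symm (A.isOpen_U i) (a.2 i) hx.1 hx.2).differentiableAt (by simp)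

theorem SecV.differentiableAt_loc (X : A.SecV) {i : A.Idx} {x₀ x : M} (hx : x ∈ A.dom i x₀) :
    DifferentiableAt ℝ (SecV.loc X i x₀) (chartAt E x₀ x) :=
  (contDiffAt_comp_chart_symm (A.isOpen_U i) (X.2 i) hx.1 hx.2).differentiableAt (by simp)

/-- A local condition in a chart. -/
theorem eventually_chart_symm {x₀ x : M} (hx₀ : x ∈ (chartAt E x₀).source) {p : M → Prop}
    (h : ∀ᶠ z in 𝓝 x, p z) : ∀ᶠ e in 𝓝 (chartAt E x₀ x), p ((chartAt E x₀).symm e) := by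
  have h1 := (chartAt E x₀).continuousAt_symm ((chartAt E x₀).map_source hx₀)
  rw [ContinuousAt, (chartAt E x₀).left_inv hx₀] at h1
  exact h1.eventually h

section dual

variable [FiniteDimensional ℝ F]

theorem dualInv_linear (i : A.Idx) (x : M) (q : (F →L[ℝ] ℝ) × ℝ) (u : A.Mod x) :
    (A.dualInv i x q).1.linear u = q.1 ((A.triv i x).linear u).1 + ((A.triv i x).linear u).2 := by
  have h1 := (A.dualInv i x q).1.map_vadd ((A.triv i x).symm 0) u
  rw [A.dualInv_apply, A.dualInv_apply, AffineEquiv.map_vadd] at h1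
  simp only [vadd_eq_add, AffineEquiv.apply_symm_apply, Prod.fst_zero, Prod.snd_zero, map_zero,
    add_zero, zero_add] at h1
  linarith

theorem iotaSec_loc (a : A.Sec) (i : A.Idx) (x₀ : M) (q : E × (F →L[ℝ] ℝ)) :
    (iotaSec a).loc i x₀ q = q.2 (a.loc i x₀ q.1).1 + (a.loc i x₀ q.1).2 := by
  set x := (chartAt E x₀).symm q.1 with hx
  have h1 := A.dual.triv_smul_v_vadd i x (-((A.dualInv i x (q.2, 0)).1 (a.1 x)))
    (show A.dual.Fib x from A.dualInv i x (q.2, 0))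
  have h2 : (iotaSec a).loc i x₀ q = -(A.dual.triv i x (-((A.dualInv i x (q.2, 0)).1 (a.1 x)) •
      A.dual.v x +ᵥ (show A.dual.Fib x from A.dualInv i x (q.2, 0)))).2 := rfl
  have h3 : A.dual.triv i x (A.dualInv i x (q.2, 0)) = (q.2, 0) := A.affCoord_dualInv i x _
  rw [h2, h1, h3, A.dualInv_apply]
  simp only [Sec.loc]
  ring

theorem iotaFun_coordSymm (X : A.SecV) (i : A.Idx) (x₀ : M) (q : E × (F →L[ℝ] ℝ)) :
    iotaFun X (A.dual.coordSymm i x₀ q) = q.2 (SecV.loc X i x₀ q.1).1 + (SecV.loc X i x₀ q.1).2 :=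
  dualInv_linear i _ (q.2, 0) _

theorem iotaSec_locDeriv (a : A.Sec) {i : A.Idx} {x₀ : M} {φ : A.dual.Base}
    {u' : E →L[ℝ] F × ℝ}
    (hu : HasFDerivAt (a.loc i x₀) u' (chartAt E x₀ φ.1)) :
    (iotaSec a).locDeriv i x₀ φ = ((A.dual.coord i x₀ φ).2.comp
      ((ContinuousLinearMap.fst ℝ F ℝ).comp u') +
        (ContinuousLinearMap.snd ℝ F ℝ).comp u').coprod
      (ContinuousLinearMap.apply ℝ ℝ (a.loc i x₀ (chartAt E x₀ φ.1)).1) := by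
  have h1 : (iotaSec a).loc i x₀ =
      fun q : E × (F →L[ℝ] ℝ) => q.2 (a.loc i x₀ q.1).1 + (a.loc i x₀ q.1).2 := by
    funext q
    exact iotaSec_loc a i x₀ q
  change fderiv ℝ ((iotaSec a).loc i x₀) _ = _
  rw [h1]
  exact (hasFDerivAt_apply_add hu (A.dual.coord i x₀ φ).2).fderiv

theorem iotaFun_cdiff (X : A.SecV) {i : A.Idx} {x₀ : M} {φ : A.dual.Base}
    {u' : E →L[ℝ] F × ℝ}
    (hu : HasFDerivAt (SecV.loc X i x₀) u' (chartAt E x₀ φ.1)) :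
    A.dual.cdiff i x₀ (iotaFun X) φ = ((A.dual.coord i x₀ φ).2.comp
      ((ContinuousLinearMap.fst ℝ F ℝ).comp u') +
        (ContinuousLinearMap.snd ℝ F ℝ).comp u').coprod
      (ContinuousLinearMap.apply ℝ ℝ (SecV.loc X i x₀ (chartAt E x₀ φ.1)).1) := by
  have h1 : (fun q => iotaFun X (A.dual.coordSymm i x₀ q)) =
      fun q : E × (F →L[ℝ] ℝ) => q.2 (SecV.loc X i x₀ q.1).1 + (SecV.loc X i x₀ q.1).2 := by
    funext q
    exact iotaFun_coordSymm X i x₀ q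
  change fderiv ℝ (fun q => iotaFun X (A.dual.coordSymm i x₀ q)) _ = _
  rw [h1]
  exact (hasFDerivAt_apply_add hu (A.dual.coord i x₀ φ).2).fderiv

/-- The point of `A` over a class in `A / ⟨v⟩` at which an affine function vanishes. -/
def zeroShift {x : M} (φ : A.DualFib x) : A.QFib x → A.Fib x :=
  Quotient.lift (fun a : A.Fib x => (-(φ.1 a)) • A.v x +ᵥ a) (by
    rintro a _ ⟨t, rfl⟩
    have h : φ.1 (t • A.v x +ᵥ a) = t + φ.1 a := by
      rw [AffineMap.map_vadd, map_smul, φ.2]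
      simp
    change (-(φ.1 a)) • A.v x +ᵥ a = (-(φ.1 (t • A.v x +ᵥ a))) • A.v x +ᵥ t • A.v x +ᵥ a
    rw [h, vadd_vadd, ← add_smul]
    congr 2
    ring)

theorem zeroShift_triv {x : M} (φ : A.DualFib x) (i : A.Idx) (b : A.QFib x) :
    A.triv i x (zeroShift φ b) =
      (A.qcoord i x b, -((A.affCoord i x φ.1).1 (A.qcoord i x b) + (A.affCoord i x φ.1).2)) := by
  induction b using Quotient.inductionOn with
  | _ a =>
    refine (A.triv_smul_v_vadd i x (-(φ.1 a)) a).trans ?_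
    refine Prod.ext rfl ?_
    have h6 := A.affine_eq i x φ.1 a
    rw [φ.2] at h6
    change (A.triv i x a).2 + -(φ.1 a) = -((A.affCoord i x φ.1).1 (A.triv i x a).1 + _)
    rw [h6]
    ring

/-- The section of `AV(A)` consisting of the zeros of a section of the special dual. -/
def zeroSec (φ : A.dual.Sec) : A.AVSection where
  toFun b := zeroShift (A := A) (φ.1 b.1) b.2
  proj := by
    rintro ⟨x, b⟩
    induction b using Quotient.inductionOn with
    | _ a => exact ((A.qmk_eq _ _).2 ⟨-((φ.1 x).1 a), rfl⟩).symm
  smooth i := by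
    have h1 := A.contMDiffOn_qcoord i
    have h2 : ContMDiffOn 𝓘(ℝ, E × F) 𝓘(ℝ, (F →L[ℝ] ℝ) × ℝ) ∞
        (fun b : A.Base => A.affCoord i b.1 (φ.1 b.1).1) {b | b.1 ∈ A.U i} :=
      (φ.2 i).comp A.contMDiff_fst.contMDiffOn (fun φ hφ => hφ)
    have h3 := contDiff_fst (𝕜 := ℝ) (E := F →L[ℝ] ℝ) (F := ℝ) (n := ∞)
      |>.contMDiff.comp_contMDiffOn h2
    have h4 := contDiff_snd (𝕜 := ℝ) (E := F →L[ℝ] ℝ) (F := ℝ) (n := ∞)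
      |>.contMDiff.comp_contMDiffOn h2
    refine (h1.prodMk_space ((h3.clm_apply h1).add h4).neg).congr ?_
    intro b _
    exact zeroShift_triv (φ.1 b.1) i b.2

theorem zeroSec_loc (φ : A.dual.Sec) (i : A.Idx) (x₀ : M) (q : E × F) :
    (zeroSec φ).loc i x₀ q =
      (Sec.loc (A := A.dual) φ i x₀ q.1).1 q.2 + (Sec.loc (A := A.dual) φ i x₀ q.1).2 := by
  have h := zeroShift_triv (φ.1 ((chartAt E x₀).symm q.1)) i (A.qinv i _ q.2)
  rw [A.qcoord_qinv] at h
  have h2 : (zeroSec φ).loc i x₀ q = -(A.triv i ((chartAt E x₀).symm q.1)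
    (zeroShift (A := A) (φ.1 ((chartAt E x₀).symm q.1)) (A.qinv i _ q.2))).2 := rfl
  rw [h2, h, neg_neg]
  rfl

theorem zeroSec_locDeriv (φ : A.dual.Sec) {i : A.Idx} {x₀ : M} {b : A.Base}
    {u' : E →L[ℝ] (F →L[ℝ] ℝ) × ℝ}
    (hu : HasFDerivAt (Sec.loc (A := A.dual) φ i x₀) u' (chartAt E x₀ b.1)) :
    (zeroSec φ).locDeriv i x₀ b = ((ContinuousLinearMap.apply ℝ ℝ (A.coord i x₀ b).2).comp
      ((ContinuousLinearMap.fst ℝ (F →L[ℝ] ℝ) ℝ).comp u') +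
        (ContinuousLinearMap.snd ℝ (F →L[ℝ] ℝ) ℝ).comp u').coprod
      (Sec.loc (A := A.dual) φ i x₀ (chartAt E x₀ b.1)).1 := by
  have h1 : (zeroSec φ).loc i x₀ =
      fun q : E × F => (Sec.loc (A := A.dual) φ i x₀ q.1).1 q.2 +
        (Sec.loc (A := A.dual) φ i x₀ q.1).2 := by
    funext q
    exact zeroSec_loc φ i x₀ q
  rw [AVSection.locDeriv, h1]
  exact (hasFDerivAt_apply_add' hu (A.coord i x₀ b).2).fderiv

theorem apply_bijective : Function.Bijective
    (fun y : F => (ContinuousLinearMap.apply ℝ ℝ y : (F →L[ℝ] ℝ) →L[ℝ] ℝ)) := by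
  constructor
  · intro y z h
    have h1 : ∀ g : F →L[ℝ] ℝ, g y = g z := fun g =>
      congrArg (fun L : (F →L[ℝ] ℝ) →L[ℝ] ℝ => L g) h
    exact (SeparatingDual.eq_iff_forall_dual_eq (R := ℝ)).2 h1
  · intro L
    let L' : Module.Dual ℝ (Module.Dual ℝ F) :=
      (L : (F →L[ℝ] ℝ) →ₗ[ℝ] ℝ).comp
        (LinearMap.toContinuousLinearMap (𝕜 := ℝ) (E := F) (F' := ℝ)).toLinearMap
    refine ⟨(Module.evalEquiv ℝ F).symm L', ?_⟩
    refine ContinuousLinearMap.ext fun g => ?_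
    have h1 : (Module.evalEquiv ℝ F) ((Module.evalEquiv ℝ F).symm L') (g : F →ₗ[ℝ] ℝ) =
        L' (g : F →ₗ[ℝ] ℝ) := by rw [LinearEquiv.apply_symm_apply]
    rw [Module.evalEquiv_apply, Module.Dual.eval_apply] at h1
    refine h1.trans ?_
    change L _ = L g
    congr 1

end dual

end

/-! ### Affine local models: the differentials of ι_a and ι_X exhaust the phase and cotangent
fibres. -/

section

variable {A}

theorem exists_secV_loc {i : A.Idx} {x₀ x₁ : M} (hx : x₁ ∈ A.dom i x₀) {s : E → F × ℝ}
    (hs : ContDiff ℝ ∞ s) :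
    ∃ X : A.SecV, ∀ᶠ x in 𝓝 x₁, (A.triv i x).linear (X.1 x) = s (chartAt E x₀ x) :=
  A.exists_secV_eventuallyEq i (chartAt E x₀).open_source hx.2 hx.1
    (hs.contMDiff.comp_contMDiffOn (contMDiffOn_chart (x := x₀)))

theorem eventually_loc {G : Type*} {x₀ x₁ : M} (hx : x₁ ∈ (chartAt E x₀).source) {u : M → G}
    {s : E → G} (h : ∀ᶠ x in 𝓝 x₁, u x = s (chartAt E x₀ x)) :
    (fun e => u ((chartAt E x₀).symm e)) =ᶠ[𝓝 (chartAt E x₀ x₁)] s := by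
  filter_upwards [eventually_chart_symm hx h,
    (chartAt E x₀).open_target.mem_nhds ((chartAt E x₀).map_source hx)] with e h1 h2
  rw [h1, (chartAt E x₀).right_inv h2]

variable [SigmaCompactSpace M]

theorem exists_sec_loc {i : A.Idx} {x₀ x₁ : M} (hx : x₁ ∈ A.dom i x₀) {s : E → F × ℝ}
    (hs : ContDiff ℝ ∞ s) :
    ∃ a : A.Sec, ∀ᶠ x in 𝓝 x₁, A.triv i x (a.1 x) = s (chartAt E x₀ x) :=
  exists_sec_eventuallyEq i (chartAt E x₀).open_source hx.2 hx.1
    (hs.contMDiff.comp_contMDiffOn (contMDiffOn_chart (x := x₀)))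

theorem contDiff_affine {E G : Type*} [NormedAddCommGroup E] [NormedSpace ℝ E]
    [NormedAddCommGroup G] [NormedSpace ℝ G] (g : G) (p : E →L[ℝ] ℝ) (e₁ : E) :
    ContDiff ℝ ∞ (fun e => (g, p (e - e₁))) :=
  contDiff_const.prodMk (p.contDiff.comp (contDiff_id.sub contDiff_const))

theorem hasFDerivAt_affine {E G : Type*} [NormedAddCommGroup E] [NormedSpace ℝ E]
    [NormedAddCommGroup G] [NormedSpace ℝ G] (g : G) (p : E →L[ℝ] ℝ) (e₁ e : E) :
    HasFDerivAt (fun e => (g, p (e - e₁))) ((0 : E →L[ℝ] G).prod p) e :=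
  (hasFDerivAt_const g e).prodMk (p.hasFDerivAt.comp e ((hasFDerivAt_id e).sub_const e₁))

variable [FiniteDimensional ℝ F]

/-- In general the p-coordinate of the differential of ι_a contains the derivative of the
F-component of a, paired with ξ. With a constant F-component this term disappears, and p and y can
be prescribed independently. -/
theorem iotaSec_locDeriv_affine {a : A.Sec} {i : A.Idx} {x₀ : M} {φ : A.dual.Base}
    (hφ : φ.1 ∈ A.dom i x₀) {y : F} {p : E →L[ℝ] ℝ} {e₁ : E}
    (h : ∀ᶠ x in 𝓝 φ.1, A.triv i x (a.1 x) = (y, p (chartAt E x₀ x - e₁))) :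
    (iotaSec a).locDeriv i x₀ φ = p.coprod (ContinuousLinearMap.apply ℝ ℝ y) := by
  have h1 : a.loc i x₀ =ᶠ[𝓝 (chartAt E x₀ φ.1)] fun e => (y, p (e - e₁)) :=
    eventually_loc (u := fun x => A.triv i x (a.1 x)) hφ.2 h
  rw [iotaSec_locDeriv a ((hasFDerivAt_affine y p e₁ _).congr_of_eventuallyEq h1),
    h1.self_of_nhds]
  refine ContinuousLinearMap.ext fun w => ?_
  simp

theorem iotaFun_cdiff_affine {X : A.SecV} {i : A.Idx} {x₀ : M} {φ : A.dual.Base}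
    (hφ : φ.1 ∈ A.dom i x₀) {y : F} {p : E →L[ℝ] ℝ} {e₁ : E}
    (h : ∀ᶠ x in 𝓝 φ.1, (A.triv i x).linear (X.1 x) = (y, p (chartAt E x₀ x - e₁))) :
    A.dual.cdiff i x₀ (iotaFun X) φ = p.coprod (ContinuousLinearMap.apply ℝ ℝ y) := by
  have h1 : SecV.loc X i x₀ =ᶠ[𝓝 (chartAt E x₀ φ.1)] fun e => (y, p (e - e₁)) :=
    eventually_loc (u := fun x => (A.triv i x).linear (X.1 x)) hφ.2 h
  rw [iotaFun_cdiff X ((hasFDerivAt_affine y p e₁ _).congr_of_eventuallyEq h1),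
    h1.self_of_nhds]
  refine ContinuousLinearMap.ext fun w => ?_
  simp

theorem zeroSec_locDeriv_affine {ψ : A.dual.Sec} {i : A.Idx} {x₀ : M} {b : A.Base}
    (hb : b.1 ∈ A.dom i x₀) {ξ : F →L[ℝ] ℝ} {p : E →L[ℝ] ℝ} {e₁ : E}
    (h : ∀ᶠ x in 𝓝 b.1, A.dual.triv i x (ψ.1 x) = (ξ, p (chartAt E x₀ x - e₁))) :
    (zeroSec ψ).locDeriv i x₀ b = p.coprod ξ := by
  have h1 : Sec.loc (A := A.dual) ψ i x₀ =ᶠ[𝓝 (chartAt E x₀ b.1)] fun e => (ξ, p (e - e₁)) :=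
    eventually_loc (u := fun x => A.dual.triv i x (ψ.1 x)) hb.2 h
  rw [zeroSec_locDeriv ψ ((hasFDerivAt_affine ξ p e₁ _).congr_of_eventuallyEq h1),
    h1.self_of_nhds]
  refine ContinuousLinearMap.ext fun w => ?_
  simp

theorem exists_coprod (L : E × (F →L[ℝ] ℝ) →L[ℝ] ℝ) :
    ∃ (p : E →L[ℝ] ℝ) (y : F), L = p.coprod (ContinuousLinearMap.apply ℝ ℝ y) := by
  obtain ⟨y, hy⟩ := apply_bijective.2 (L.comp (ContinuousLinearMap.inr ℝ E (F →L[ℝ] ℝ)))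
  refine ⟨L.comp (ContinuousLinearMap.inl ℝ E (F →L[ℝ] ℝ)), y, ?_⟩
  have hy' : ContinuousLinearMap.apply ℝ ℝ y = L.comp (ContinuousLinearMap.inr ℝ E (F →L[ℝ] ℝ)) := hy
  rw [hy']
  exact L.coprod_comp_inl_inr.symm

/-- The coordinates (p, y) of the given element are those of ι_a for a section with constant
F-component y and ℝ-component p, up to a constant. Every pointwise statement about P(A^#) is reduced
to the sections ι_a in this way. -/
theorem exists_iotaSec_dd_eq {φ : A.dual.Base} (q : A.dual.PhaseFib φ) :
    ∃ a : A.Sec, (iotaSec a).dd φ = q := by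
  obtain ⟨τ, rfl⟩ := exists_dd_eq q
  have hφ : φ.1 ∈ A.dom (A.idx φ.1) φ.1 := ⟨A.mem_U φ.1, mem_chart_source E φ.1⟩
  obtain ⟨p, y, h⟩ := exists_coprod (τ.locDeriv (A.idx φ.1) φ.1 φ)
  obtain ⟨a, ha⟩ := exists_sec_loc hφ (contDiff_affine y p (chartAt E φ.1 φ.1))
  refine ⟨a, (AVSection.dd_eq_iff _ _ (A := A.dual) hφ).2 ?_⟩
  rw [h]
  exact iotaSec_locDeriv_affine hφ ha

theorem cdiff_injective {B : SpecialAffineBundle E M F} {i : B.Idx} {x₀ : M} {b : B.Base}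
    (hb : b.1 ∈ B.dom i x₀) (η : TangentSpace 𝓘(ℝ, E × F) b →L[ℝ] ℝ) :
    ∃ L : E × F →L[ℝ] ℝ, ∀ f : C^∞⟮𝓘(ℝ, E × F), B.Base; ℝ⟯, B.cdiff i x₀ f b = L →
      B.dfun f b = η := by
  let e : TangentSpace 𝓘(ℝ, E × F) b ≃ₗ[ℝ] E × F := LinearEquiv.ofBijective
    (mfderiv 𝓘(ℝ, E × F) 𝓘(ℝ, E × F) (B.coord i x₀) b).toLinearMap (B.mfderiv_coord_bijective hb)
  let L' : E × F →ₗ[ℝ] ℝ := (η : TangentSpace 𝓘(ℝ, E × F) b →ₗ[ℝ] ℝ).comp e.symm.toLinearMap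
  refine ⟨LinearMap.toContinuousLinearMap L', fun f hf => ?_⟩
  refine ContinuousLinearMap.ext fun w => ?_
  rw [B.dfun_apply hb, hf]
  change η (e.symm (e w)) = η w
  rw [e.symm_apply_apply]

theorem exists_iotaFun_dfun_eq {φ : A.dual.Base}
    (η : TangentSpace 𝓘(ℝ, E × (F →L[ℝ] ℝ)) φ →L[ℝ] ℝ) :
    ∃ X : A.SecV, A.dual.dfun (iotaFun X) φ = η := by
  have hφ : φ.1 ∈ A.dom (A.idx φ.1) φ.1 := ⟨A.mem_U φ.1, mem_chart_source E φ.1⟩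
  obtain ⟨L, hL⟩ := cdiff_injective (B := A.dual) (i := A.idx φ.1) (x₀ := φ.1) hφ η
  obtain ⟨p, y, h⟩ := exists_coprod L
  obtain ⟨X, hX⟩ := exists_secV_loc hφ (contDiff_affine y p (chartAt E φ.1 φ.1))
  refine ⟨X, hL _ ?_⟩
  rw [h]
  exact iotaFun_cdiff_affine hφ hX

/-! ### The canonical isomorphism -/

/-- The graph of the canonical isomorphism: the affine differential of the zero section of an
affine function `ψ` along a section `a` corresponds to the affine differential of the zero section
of `a` along `ψ` if `ψ(a)` is locally constant. -/
def Rel (α : A.Phase) (β : A.dual.Phase) : Prop :=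
  ∃ (a : A.Sec) (ψ : A.dual.Sec) (b : A.Base) (φ : A.dual.Base),
    φ.1 = b.1 ∧ (∀ i, A.qcoord i b.1 b.2 = (A.triv i b.1 (a.1 b.1)).1) ∧
    (∀ i, A.dual.qcoord i φ.1 φ.2 = (A.dual.triv i φ.1 (ψ.1 φ.1)).1) ∧
    (∃ c : ℝ, ∀ᶠ z in 𝓝 b.1, (show A.DualFib z from ψ.1 z).1 (a.1 z) = c) ∧
    α = (zeroSec ψ).ddP b ∧ β = (iotaSec a).ddP φ

/-- In a trivialization ψ(a) = ξ(y) + s + c, where (y, s) and (ξ, c) are the expressions of a and ψ.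
The derivative of this constant function is the sum of the p-coordinate of the zero section of ψ
along a and the p-coordinate of ι_a along ψ, so the two are opposite. The argument works in every
chart at once since the constancy of ψ(a) is intrinsic. -/
theorem Rel.coord {b : A.Base} {φ : A.dual.Base} {σ : A.AVSection} {τ : A.dual.AVSection}
    (h : Rel (σ.ddP b) (τ.ddP φ)) :
    φ.1 = b.1 ∧ ∀ (i : A.Idx) (x₀ : M), b.1 ∈ A.dom i x₀ → ∃ (x : E) (y : F) (p : E →L[ℝ] ℝ)
      (ξ : F →L[ℝ] ℝ), A.coord i x₀ b = (x, y) ∧ σ.locDeriv i x₀ b = p.coprod ξ ∧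
        A.dual.coord i x₀ φ = (x, ξ) ∧
        τ.locDeriv i x₀ φ = (-p).coprod (ContinuousLinearMap.apply ℝ ℝ y) := by
  obtain ⟨a, ψ, b', φ', hbφ, ha, hψ, ⟨c, hc⟩, h1, h2⟩ := h
  obtain ⟨rfl, h1⟩ := Sigma.mk.inj h1
  obtain ⟨rfl, h2⟩ := Sigma.mk.inj h2
  have h1 := eq_of_heq h1
  have h2 := eq_of_heq h2
  refine ⟨hbφ, fun i x₀ hb => ?_⟩
  have hφ : φ.1 ∈ A.dom i x₀ := by rw [hbφ]; exact hb
  rw [AVSection.dd_eq_iff _ _ hb] at h1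
  rw [AVSection.dd_eq_iff _ _ (A := A.dual) (i := i) (x₀ := x₀) hφ] at h2
  have hA := (a.differentiableAt_loc hb).hasFDerivAt
  have hP := (Sec.differentiableAt_loc (A := A.dual) ψ (i := i) (x₀ := x₀) hb).hasFDerivAt
  set u' := fderiv ℝ (a.loc i x₀) (chartAt E x₀ b.1)
  set w' := fderiv ℝ (Sec.loc (A := A.dual) ψ i x₀) (chartAt E x₀ b.1)
  have hA0 : a.loc i x₀ (chartAt E x₀ b.1) = A.triv i b.1 (a.1 b.1) := by
    simp only [Sec.loc]
    rw [(chartAt E x₀).left_inv hb.2]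
  have hP0 : Sec.loc (A := A.dual) ψ i x₀ (chartAt E x₀ b.1) = A.dual.triv i b.1 (ψ.1 b.1) := by
    simp only [Sec.loc]
    rw [(chartAt E x₀).left_inv hb.2]
  have hφb : A.dual.qcoord i φ.1 φ.2 = (A.dual.triv i b.1 (ψ.1 b.1)).1 := by
    rw [hψ i, hbφ]
  refine ⟨chartAt E x₀ b.1, (A.triv i b.1 (a.1 b.1)).1,
    (ContinuousLinearMap.apply ℝ ℝ (A.coord i x₀ b).2).comp
      ((ContinuousLinearMap.fst ℝ (F →L[ℝ] ℝ) ℝ).comp w') +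
        (ContinuousLinearMap.snd ℝ (F →L[ℝ] ℝ) ℝ).comp w', (A.dual.triv i b.1 (ψ.1 b.1)).1,
    Prod.ext rfl (ha i), ?_, ?_, ?_⟩
  · rw [h1, zeroSec_locDeriv ψ hP, hP0]
  · exact Prod.ext (by change chartAt E x₀ φ.1 = _; rw [hbφ]) hφb
  · rw [← hbφ] at hA
    rw [h2, iotaSec_locDeriv a hA, hbφ, hA0]
    congr 1
    have hsum : HasFDerivAt (fun e => (Sec.loc (A := A.dual) ψ i x₀ e).1 (a.loc i x₀ e).1 +
        (a.loc i x₀ e).2 + (Sec.loc (A := A.dual) ψ i x₀ e).2) (0 : E →L[ℝ] ℝ)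
        (chartAt E x₀ b.1) := by
      refine (hasFDerivAt_const c _).congr_of_eventuallyEq ?_
      filter_upwards [eventually_chart_symm hb.2 hc] with e he
      rw [← he, A.affine_eq i, (show A.DualFib _ from ψ.1 ((chartAt E x₀).symm e)).2, mul_one]
      rfl
    rw [hbφ] at hA
    have hsum' := ((hP.fst.clm_apply hA.fst).add hA.snd).add hP.snd
    have h0 := hsum.unique hsum'
    refine ContinuousLinearMap.ext fun w => ?_
    have h0w := congrArg (fun L : E →L[ℝ] ℝ => L w) h0
    rw [hA0, hP0] at h0w
    have hy : (A.coord i x₀ b).2 = (A.triv i b.1 (a.1 b.1)).1 := ha i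
    have hξ : (A.dual.coord i x₀ φ).2 = (A.dual.triv i b.1 (ψ.1 b.1)).1 := hφb
    rw [hy, hξ]
    simp at h0w ⊢
    linarith

theorem exists_rel {i : A.Idx} {x₀ x₁ : M} (hx : x₁ ∈ A.dom i x₀) (y : F) (p : E →L[ℝ] ℝ)
    (ξ : F →L[ℝ] ℝ) : ∃ (b : A.Base) (φ : A.dual.Base) (σ : A.AVSection) (τ : A.dual.AVSection),
      b.1 = x₁ ∧ φ.1 = x₁ ∧ A.coord i x₀ b = (chartAt E x₀ x₁, y) ∧
      σ.locDeriv i x₀ b = p.coprod ξ ∧ A.dual.coord i x₀ φ = (chartAt E x₀ x₁, ξ) ∧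
      τ.locDeriv i x₀ φ = (-p).coprod (ContinuousLinearMap.apply ℝ ℝ y) ∧
      Rel (σ.ddP b) (τ.ddP φ) := by
  -- Opposite linear terms in the ℝ-components of a and ψ make ψ(a) locally equal to the constant
  -- ξ(y).
  obtain ⟨a, ha⟩ := exists_sec_loc hx (contDiff_affine y (-p) (chartAt E x₀ x₁))
  obtain ⟨ψ, hψ⟩ := exists_sec_loc (A := A.dual) (i := i) (x₀ := x₀) hx
    (contDiff_affine ξ p (chartAt E x₀ x₁))
  refine ⟨⟨x₁, A.qmk (a.1 x₁)⟩, ⟨x₁, A.dual.qmk (ψ.1 x₁)⟩, zeroSec ψ, iotaSec a, rfl, rfl,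
    ?_, ?_, ?_, ?_, ⟨a, ψ, _, _, rfl, fun i => rfl, fun i => rfl, ?_, rfl, rfl⟩⟩
  · exact Prod.ext rfl (congrArg Prod.fst ha.self_of_nhds)
  · exact zeroSec_locDeriv_affine hx hψ
  · exact Prod.ext rfl (congrArg Prod.fst hψ.self_of_nhds)
  · exact iotaSec_locDeriv_affine hx ha
  · refine ⟨ξ y, ?_⟩
    filter_upwards [ha, hψ] with z h1 h2
    have h3 : A.affCoord i z (show A.DualFib z from ψ.1 z).1 = (ξ, p (chartAt E x₀ z - chartAt E x₀ x₁)) := h2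
    rw [A.affine_eq i, (show A.DualFib _ from ψ.1 z).2, mul_one, h3, h1]
    simp
    ring

theorem ddP_eq {B : SpecialAffineBundle E M F} {i : B.Idx} {x₀ : M} {b c : B.Base}
    {σ τ : B.AVSection} (hb : b.1 ∈ B.dom i x₀) (hc : c.1 ∈ B.dom i x₀)
    (h : B.coord i x₀ b = B.coord i x₀ c) (h' : σ.locDeriv i x₀ b = τ.locDeriv i x₀ c) :
    σ.ddP b = τ.ddP c := by
  obtain rfl := B.coord_injOn hb hc h
  exact congrArg (Sigma.mk b) ((AVSection.dd_eq_iff _ _ hb).2 h')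

theorem coprod_inj {V W : Type*} [NormedAddCommGroup V] [NormedSpace ℝ V] [NormedAddCommGroup W]
    [NormedSpace ℝ W] {p p' : V →L[ℝ] ℝ} {q q' : W →L[ℝ] ℝ} (h : p.coprod q = p'.coprod q') :
    p = p' ∧ q = q' := by
  constructor
  · refine ContinuousLinearMap.ext fun w => ?_
    simpa using congrArg (fun L : V × W →L[ℝ] ℝ => L (w, 0)) h
  · refine ContinuousLinearMap.ext fun w => ?_
    simpa using congrArg (fun L : V × W →L[ℝ] ℝ => L (0, w)) h

theorem exists_ddP_eq (α : A.Phase) : ∃ (b : A.Base) (σ : A.AVSection), α = σ.ddP b := by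
  obtain ⟨b, q⟩ := α
  obtain ⟨σ, rfl⟩ := exists_dd_eq q
  exact ⟨b, σ, rfl⟩

theorem Rel.right_unique {α : A.Phase} {β β' : A.dual.Phase} (h : Rel α β) (h' : Rel α β') :
    β = β' := by
  obtain ⟨b, σ, rfl⟩ := exists_ddP_eq α
  obtain ⟨φ, τ, rfl⟩ := exists_ddP_eq β
  obtain ⟨φ', τ', rfl⟩ := exists_ddP_eq β'
  have hb : b.1 ∈ A.dom (A.idx b.1) b.1 := ⟨A.mem_U b.1, mem_chart_source E b.1⟩
  obtain ⟨e, h⟩ := h.coord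
  obtain ⟨e', h'⟩ := h'.coord
  obtain ⟨x, y, p, ξ, h1, h2, h3, h4⟩ := h _ _ hb
  obtain ⟨x', y', p', ξ', h1', h2', h3', h4'⟩ := h' _ _ hb
  obtain ⟨rfl, rfl⟩ := Prod.mk.inj (h1.symm.trans h1')
  obtain ⟨rfl, rfl⟩ := coprod_inj (h2.symm.trans h2')
  refine ddP_eq (B := A.dual) (i := A.idx b.1) (x₀ := b.1) ?_ ?_ (h3.trans h3'.symm)
    (h4.trans h4'.symm)
  · rw [e]; exact hb
  · rw [e']; exact hb

theorem Rel.left_unique {α α' : A.Phase} {β : A.dual.Phase} (h : Rel α β) (h' : Rel α' β) :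
    α = α' := by
  obtain ⟨b, σ, rfl⟩ := exists_ddP_eq α
  obtain ⟨b', σ', rfl⟩ := exists_ddP_eq α'
  obtain ⟨φ, τ, rfl⟩ := exists_ddP_eq β
  have hb : b.1 ∈ A.dom (A.idx b.1) b.1 := ⟨A.mem_U b.1, mem_chart_source E b.1⟩
  obtain ⟨e, h⟩ := h.coord
  obtain ⟨e', h'⟩ := h'.coord
  have hb' : b'.1 ∈ A.dom (A.idx b.1) b.1 := by rw [← e', e]; exact hb
  obtain ⟨x, y, p, ξ, h1, h2, h3, h4⟩ := h _ _ hb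
  obtain ⟨x', y', p', ξ', h1', h2', h3', h4'⟩ := h' _ _ hb'
  obtain ⟨rfl, rfl⟩ := Prod.mk.inj (h3.symm.trans h3')
  obtain ⟨hp, hy⟩ := coprod_inj (h4.symm.trans h4')
  obtain rfl := neg_injective hp
  obtain rfl := apply_bijective.1 hy
  exact ddP_eq hb hb' (h1.trans h1'.symm) (h2.trans h2'.symm)

theorem exists_rel_left (α : A.Phase) : ∃ β, Rel α β := by
  obtain ⟨b, σ, rfl⟩ := exists_ddP_eq α
  have hb : b.1 ∈ A.dom (A.idx b.1) b.1 := ⟨A.mem_U b.1, mem_chart_source E b.1⟩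
  obtain ⟨b', φ, σ', τ, e, -, h1, h2, -, -, h⟩ := exists_rel hb (A.coord (A.idx b.1) b.1 b).2
    ((σ.locDeriv (A.idx b.1) b.1 b).comp (ContinuousLinearMap.inl ℝ E F))
    ((σ.locDeriv (A.idx b.1) b.1 b).comp (ContinuousLinearMap.inr ℝ E F))
  have hb' : b'.1 ∈ A.dom (A.idx b.1) b.1 := by rw [e]; exact hb
  rw [(σ.locDeriv (A.idx b.1) b.1 b).coprod_comp_inl_inr] at h2
  rw [ddP_eq hb' hb h1 h2] at h
  exact ⟨_, h⟩

theorem exists_rel_right (β : A.dual.Phase) : ∃ α, Rel α β := by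
  obtain ⟨φ, τ, rfl⟩ := exists_ddP_eq β
  have hb : φ.1 ∈ A.dom (A.idx φ.1) φ.1 := ⟨A.mem_U φ.1, mem_chart_source E φ.1⟩
  obtain ⟨p, y, hp⟩ := exists_coprod (τ.locDeriv (A.idx φ.1) φ.1 φ)
  obtain ⟨b, φ', σ, τ', -, e, -, -, h1, h2, h⟩ := exists_rel hb y (-p)
    (A.dual.coord (A.idx φ.1) φ.1 φ).2
  have hb' : φ'.1 ∈ A.dom (A.idx φ.1) φ.1 := by rw [e]; exact hb
  rw [neg_neg, ← hp] at h2
  have h3 : τ'.ddP φ' = τ.ddP φ :=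
    ddP_eq (B := A.dual) (i := A.idx φ.1) (x₀ := φ.1) hb' hb h1 h2
  rw [h3] at h
  exact ⟨_, h⟩

variable (A) in
/-- The canonical isomorphism `PA → P(A^#)`. -/
def canonicalIso : A.Phase ≃ A.dual.Phase where
  toFun α := (exists_rel_left α).choose
  invFun β := (exists_rel_right β).choose
  left_inv α := (exists_rel_right _).choose_spec.left_unique (exists_rel_left α).choose_spec
  right_inv β := (exists_rel_left _).choose_spec.right_unique (exists_rel_right β).choose_spec

theorem rel_canonicalIso (α : A.Phase) : Rel α (A.canonicalIso α) :=
  (exists_rel_left α).choose_spec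

theorem isCanonicalIso_canonicalIso : IsCanonicalIso A.canonicalIso := by
  intro i x₀ b hb σ φ τ h
  have hR := rel_canonicalIso (σ.ddP b)
  rw [h] at hR
  refine ⟨hR.coord.1, fun x y p ξ h1 h2 => ?_⟩
  obtain ⟨x', y', p', ξ', h1', h2', h3', h4'⟩ := hR.coord.2 i x₀ hb
  rw [AVSection.phaseCoord_eq_iff] at h2
  obtain ⟨rfl, rfl⟩ := Prod.mk.inj (h1.symm.trans h1')
  obtain ⟨rfl, rfl⟩ := coprod_inj (h2.symm.trans h2')
  exact ⟨h3', (AVSection.phaseCoord_eq_iff (A := A.dual) τ i x₀ φ _ _).2 h4'⟩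

end

/-! ### Contraction of tensors, and tensors from maps with the local form of a morphism. -/

section

section tensor

theorem sharpAt_add {b : A.Base} (t t' : A.Ttilde b ⊗[ℝ] TangentSpace 𝓘(ℝ, E × F) b)
    (p : A.PhaseFib b) : A.sharpAt (t + t') p = A.sharpAt t p + A.sharpAt t' p := by
  simp only [sharpAt, map_add]

theorem sharpAt_tmul {b : A.Base} (g : A.Ttilde b) (w : TangentSpace 𝓘(ℝ, E × F) b)
    (p : A.PhaseFib b) : A.sharpAt (g ⊗ₜ w) p = g.1 p • w := by
  simp only [sharpAt, TensorProduct.map_tmul, TensorProduct.lid_tmul]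
  rfl

theorem contract_eq {b : A.Base} (t : A.Ttilde b ⊗[ℝ] TangentSpace 𝓘(ℝ, E × F) b)
    (p : A.PhaseFib b) (η : TangentSpace 𝓘(ℝ, E × F) b →L[ℝ] ℝ) :
    A.contract t p η = η (A.sharpAt t p) := by
  induction t with
  | zero => simp [contract, sharpAt]
  | tmul g w =>
    rw [sharpAt_tmul, map_smul]
    simp only [contract, TensorProduct.map_tmul, TensorProduct.lid_tmul]
    rfl
  | add t t' h h' =>
    rw [sharpAt_add, map_add, ← h, ← h']
    simp only [contract, map_add]

theorem exists_linear_sharpAt {b : A.Base} (t : A.Ttilde b ⊗[ℝ] TangentSpace 𝓘(ℝ, E × F) b) :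
    ∃ L : (TangentSpace 𝓘(ℝ, E × F) b →L[ℝ] ℝ) →ₗ[ℝ] TangentSpace 𝓘(ℝ, E × F) b,
      ∀ (σ : A.AVSection) (h : C^∞⟮𝓘(ℝ, E × F), A.Base; ℝ⟯),
      A.sharpAt t ((σ.add h).dd b) = A.sharpAt t (σ.dd b) + L (A.dfun h b) := by
  induction t with
  | zero => exact ⟨0, fun σ h => by simp [sharpAt]⟩
  | tmul g w =>
    obtain ⟨L, hL⟩ := g.2
    refine ⟨L.smulRight w, fun σ h => ?_⟩
    rw [sharpAt_tmul, sharpAt_tmul, hL, add_smul]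
    rfl
  | add t t' h h' =>
    obtain ⟨L, hL⟩ := h
    obtain ⟨L', hL'⟩ := h'
    refine ⟨L + L', fun σ h => ?_⟩
    rw [sharpAt_add, sharpAt_add, hL, hL', LinearMap.add_apply]
    abel

variable [FiniteDimensional ℝ F]

instance instFiniteDimensionalTangentBase (b : A.Base) : FiniteDimensional ℝ (TangentSpace 𝓘(ℝ, E × F) b) :=
  inferInstanceAs (FiniteDimensional ℝ (E × F))

/-- Expanded along a basis of the tangent space, a tensor has coefficients that are functions on the
phase fibre. Contraction with all points of the fibre detects each of them. -/
theorem sharpAt_injective {b : A.Base} {t t' : A.Ttilde b ⊗[ℝ] TangentSpace 𝓘(ℝ, E × F) b}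
    (H : ∀ p, A.sharpAt t p = A.sharpAt t' p) : t = t' := by
  rw [← sub_eq_zero]
  have H' : ∀ p, A.sharpAt (t - t') p = 0 := by
    intro p
    have := A.sharpAt_add (t - t') t' p
    rw [sub_add_cancel, H] at this
    exact right_eq_add.1 this
  generalize t - t' = u at H'
  let β := Module.finBasis ℝ (TangentSpace 𝓘(ℝ, E × F) b)
  obtain ⟨c, hc⟩ := TensorProduct.eq_repr_basis_right β u
  have hc' : u = ∑ k, c k ⊗ₜ[ℝ] β k := by
    rw [← hc]
    exact Finsupp.sum_fintype c _ (fun k => TensorProduct.zero_tmul _ _)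
  have h1 : ∀ p, ∑ k, (c k).1 p • β k = 0 := by
    intro p
    rw [← H' p, hc']
    simp only [sharpAt, map_sum, TensorProduct.map_tmul, TensorProduct.lid_tmul]
    rfl
  have h2 : ∀ k, c k = 0 := by
    intro k
    apply Subtype.ext
    funext p
    exact Fintype.linearIndependent_iff.1 β.linearIndependent _ (h1 p) k
  rw [hc']
  simp [h2]

/-- The components of G in a basis of the tangent space are affine functions on the phase fibre,
with linear parts the components of L; they are the coefficients of the tensor. -/
theorem exists_tensor {b : A.Base} (G : A.PhaseFib b → TangentSpace 𝓘(ℝ, E × F) b)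
    (L : (TangentSpace 𝓘(ℝ, E × F) b →L[ℝ] ℝ) →ₗ[ℝ] TangentSpace 𝓘(ℝ, E × F) b)
    (hL : ∀ (σ : A.AVSection) (h : C^∞⟮𝓘(ℝ, E × F), A.Base; ℝ⟯),
      G ((σ.add h).dd b) = G (σ.dd b) + L (A.dfun h b)) :
    ∃ t : A.Ttilde b ⊗[ℝ] TangentSpace 𝓘(ℝ, E × F) b, ∀ p, A.sharpAt t p = G p := by
  let β := Module.finBasis ℝ (TangentSpace 𝓘(ℝ, E × F) b)
  let g : ∀ _ : Fin (Module.finrank ℝ (TangentSpace 𝓘(ℝ, E × F) b)), A.Ttilde b := fun k =>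
    ⟨fun p => β.coord k (G p), (β.coord k).comp L, fun σ h => by
      dsimp only
      rw [hL, map_add]
      rfl⟩
  refine ⟨∑ k, g k ⊗ₜ[ℝ] β k, fun p => ?_⟩
  simp only [sharpAt, map_sum, TensorProduct.map_tmul, TensorProduct.lid_tmul]
  exact β.sum_repr (G p)

/-- The derivative of the coordinates as a linear isomorphism. -/
theorem exists_coord_equiv {i : A.Idx} {x₀ : M} {b : A.Base} (hb : b.1 ∈ A.dom i x₀) :
    ∃ e : TangentSpace 𝓘(ℝ, E × F) b ≃ₗ[ℝ] E × F,
      ∀ w, e w = mfderiv 𝓘(ℝ, E × F) 𝓘(ℝ, E × F) (A.coord i x₀) b w :=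
  ⟨LinearEquiv.ofBijective
    (mfderiv 𝓘(ℝ, E × F) 𝓘(ℝ, E × F) (A.coord i x₀) b).toLinearMap (A.mfderiv_coord_bijective hb),
    fun _ => rfl⟩

theorem exists_tensor_of_coord {b : A.Base} (G : A.PhaseFib b → TangentSpace 𝓘(ℝ, E × F) b)
    {i : A.Idx} {x₀ : M} (hb : b.1 ∈ A.dom i x₀)
    (T : (E →L[ℝ] ℝ) × (F →L[ℝ] ℝ) →ᵃ[ℝ] E × F)
    (hT : ∀ σ : A.AVSection, mfderiv 𝓘(ℝ, E × F) 𝓘(ℝ, E × F) (A.coord i x₀) b (G (σ.dd b)) =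
      T (σ.phaseCoord i x₀ b)) :
    ∃ t : A.Ttilde b ⊗[ℝ] TangentSpace 𝓘(ℝ, E × F) b, ∀ p, A.sharpAt t p = G p := by
  obtain ⟨e, he⟩ := A.exists_coord_equiv hb
  let m : (TangentSpace 𝓘(ℝ, E × F) b →L[ℝ] ℝ) →ₗ[ℝ] (E →L[ℝ] ℝ) × (F →L[ℝ] ℝ) :=
    { toFun := fun η => (LinearMap.toContinuousLinearMap
          (((η : TangentSpace 𝓘(ℝ, E × F) b →ₗ[ℝ] ℝ).comp e.symm.toLinearMap).comp
            (LinearMap.inl ℝ E F)),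
          LinearMap.toContinuousLinearMap
          (((η : TangentSpace 𝓘(ℝ, E × F) b →ₗ[ℝ] ℝ).comp e.symm.toLinearMap).comp
            (LinearMap.inr ℝ E F)))
      map_add' := fun η θ => by rfl
      map_smul' := fun c η => by rfl }
  refine A.exists_tensor G (e.symm.toLinearMap.comp (T.linear.comp m)) fun σ h => ?_
  apply e.injective
  rw [map_add, he, hT, he, hT]
  have h1 : (σ.add h).phaseCoord i x₀ b = m (A.dfun h b) +ᵥ σ.phaseCoord i x₀ b := by
    rw [AVSection.phaseCoord_eq, AVSection.phaseCoord_eq, σ.locDeriv_add h hb]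
    have h2 : ∀ w, A.dfun h b (e.symm w) = A.cdiff i x₀ h b w := by
      intro w
      rw [A.dfun_apply hb, ← he, e.apply_symm_apply]
    refine Prod.ext ?_ ?_
    · refine ContinuousLinearMap.ext fun w => ?_
      change _ = A.dfun h b (e.symm _) + _
      rw [h2]
      simp [add_comm]
    · refine ContinuousLinearMap.ext fun w => ?_
      change _ = A.dfun h b (e.symm _) + _
      rw [h2]
      simp [add_comm]
  rw [h1, AffineMap.map_vadd]
  change T.linear (m _) + _ = _ + e (e.symm (T.linear (m _)))
  rw [e.apply_symm_apply, add_comm]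

end tensor

variable {A} [SigmaCompactSpace M] [FiniteDimensional ℝ F]

/-- The canonical isomorphism with the double dual. -/
def bidual : F ≃L[ℝ] ((F →L[ℝ] ℝ) →L[ℝ] ℝ) :=
  (LinearEquiv.ofBijective (ContinuousLinearMap.apply ℝ ℝ : F →L[ℝ] _).toLinearMap
    apply_bijective).toContinuousLinearEquiv

theorem bidual_apply (y : F) : bidual y = ContinuousLinearMap.apply ℝ ℝ y := rfl

/-- Used to pass between F and its double dual in the second variable and to insert p ↦ -p in the
third, as the canonical isomorphism requires. -/
theorem IsTrivialDoubleAffineMorphism.precomp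
    {K₁ K₂ K K₁' K₂' K' J₂ J : Type*}
    [NormedAddCommGroup K₁] [NormedSpace ℝ K₁] [NormedAddCommGroup K₂] [NormedSpace ℝ K₂]
    [NormedAddCommGroup K] [NormedSpace ℝ K] [NormedAddCommGroup K₁'] [NormedSpace ℝ K₁']
    [NormedAddCommGroup K₂'] [NormedSpace ℝ K₂'] [NormedAddCommGroup K'] [NormedSpace ℝ K']
    [NormedAddCommGroup J₂] [NormedSpace ℝ J₂] [NormedAddCommGroup J] [NormedSpace ℝ J]
    {W : Set E} {Φ₁ : E → K₁ → K₁'} {Φ₂ : E → K₂ → K₂'} {Φ₀ : E → K₁ → K₂ → K → K'}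
    (H : IsTrivialDoubleAffineMorphism W Φ₁ Φ₂ Φ₀) (u : J₂ →L[ℝ] K₂) (v : J →L[ℝ] K) :
    IsTrivialDoubleAffineMorphism W Φ₁ (fun x y => Φ₂ x (u y))
      (fun x k y p => Φ₀ x k (u y) (v p)) where
  smooth₁ := H.smooth₁
  smooth₂ := H.smooth₂.comp (f := fun q : E × J₂ => (q.1, u q.2)) (by fun_prop)
    (fun q hq => ⟨hq.1, mem_univ _⟩)
  smooth₀ := H.smooth₀.comp (f := fun q : E × K₁ × J₂ × J => (q.1, q.2.1, u q.2.2.1, v q.2.2.2))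
    (by fun_prop) (fun q hq => ⟨hq.1, mem_univ _⟩)
  affine₁ x hx k := by
    obtain ⟨T, hT⟩ := H.affine₁ x hx k
    exact ⟨T.comp (u.prodMap v).toLinearMap.toAffineMap, fun y p => hT (u y) (v p)⟩
  affine₂ x hx y := by
    obtain ⟨T, hT⟩ := H.affine₂ x hx (u y)
    exact ⟨T.comp ((ContinuousLinearMap.id ℝ K₁).prodMap v).toLinearMap.toAffineMap,
      fun k p => hT k (v p)⟩

theorem contMDiff_of_coord {B : SpecialAffineBundle E M F} {f : B.Base → ℝ}
    (H : ∀ b : B.Base, ∃ s : E × F → ℝ,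
      ContDiffOn ℝ ∞ s (B.baseChart (B.idx b.1) b.1).target ∧
      ∀ c : B.Base, c.1 ∈ B.dom (B.idx b.1) b.1 → f c = s (B.coord (B.idx b.1) b.1 c)) :
    ContMDiff 𝓘(ℝ, E × F) 𝓘(ℝ, ℝ) ∞ f := by
  intro b
  obtain ⟨s, hs, h⟩ := H b
  have h1 := (contMDiffOn_iff_contDiffOn.2 hs).comp (B.contMDiffOn_coord (B.idx b.1) b.1)
    (fun c hc => B.coord_mem_target hc)
  have hb : b.1 ∈ B.dom (B.idx b.1) b.1 := ⟨B.mem_U b.1, mem_chart_source E b.1⟩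
  exact (h1.congr (fun c hc => h c hc)).contMDiffAt ((B.isOpen_over_dom _ _).mem_nhds hb)

theorem mem_chart_image {B : SpecialAffineBundle E M F} {i : B.Idx} {x₀ : M} {q : E × F}
    (hq : q ∈ (B.baseChart i x₀).target) : q.1 ∈ chartAt E x₀ '' B.dom i x₀ :=
  ⟨_, ⟨hq.2, (chartAt E x₀).map_target hq.1⟩, (chartAt E x₀).right_inv hq.1⟩

/-- A family of maps from the phase bundle to the tangent bundle with the local form of a morphism
of double affine bundles is the contraction with an affine tensor. -/
theorem exists_affineTensor (G : ∀ φ : A.dual.Base, A.dual.PhaseFib φ →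
      TangentSpace 𝓘(ℝ, E × (F →L[ℝ] ℝ)) φ)
    (hG : ∀ (i : A.Idx) (x₀ : M), ∃ (Φ₂ : E → ((F →L[ℝ] ℝ) →L[ℝ] ℝ) → E)
      (Φ₀ : E → (F →L[ℝ] ℝ) → ((F →L[ℝ] ℝ) →L[ℝ] ℝ) → (E →L[ℝ] ℝ) → (F →L[ℝ] ℝ)),
      IsTrivialDoubleAffineMorphism (chartAt E x₀ '' A.dom i x₀) (fun _ ξ => ξ) Φ₂ Φ₀ ∧
      ∀ φ : A.dual.Base, φ.1 ∈ A.dom i x₀ → ∀ (σ : A.dual.AVSection) (x : E) (ξ : F →L[ℝ] ℝ)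
        (p : E →L[ℝ] ℝ) (y : (F →L[ℝ] ℝ) →L[ℝ] ℝ),
        A.dual.coord i x₀ φ = (x, ξ) → σ.phaseCoord i x₀ φ = (p, y) →
          A.dual.tangentCoord i x₀ ⟨φ, G φ (σ.dd φ)⟩ = ((x, ξ), (Φ₂ x y, Φ₀ x ξ y p))) :
    ∃ Γ : A.AffineTensor, ∀ φ q, A.dual.sharpAt (Γ.toFun φ) q = G φ q := by
  have h1 : ∀ φ : A.dual.Base,
      ∃ t : A.dual.Ttilde φ ⊗[ℝ] TangentSpace 𝓘(ℝ, E × (F →L[ℝ] ℝ)) φ,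
        ∀ q, A.dual.sharpAt t q = G φ q := by
    intro φ
    have hφ : φ.1 ∈ A.dom (A.idx φ.1) φ.1 := ⟨A.mem_U φ.1, mem_chart_source E φ.1⟩
    obtain ⟨Φ₂, Φ₀, hΦ, h⟩ := hG (A.idx φ.1) φ.1
    -- With the base point φ, hence ξ, held fixed, affineness on the fibres over N says that the
    -- local form is affine in (y, p), which is what a tensor at φ needs. The factors are swapped
    -- because phase coordinates list p before y.
    obtain ⟨T, hT⟩ := hΦ.affine₁ (chartAt E φ.1 φ.1) ⟨_, hφ, rfl⟩
      (A.dual.coord (A.idx φ.1) φ.1 φ).2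
    refine A.dual.exists_tensor_of_coord (G φ) (i := A.idx φ.1) (x₀ := φ.1) hφ
      (T.comp (LinearEquiv.prodComm ℝ (E →L[ℝ] ℝ) ((F →L[ℝ] ℝ) →L[ℝ] ℝ)).toLinearMap.toAffineMap)
      fun σ => ?_
    have h2 := congrArg Prod.snd (h φ hφ σ _ _ _ _ rfl rfl)
    refine Eq.trans h2 ?_
    exact (hT _ _).symm
  choose t ht using h1
  refine ⟨⟨t, fun σ f => ?_, fun i x₀ => ?_⟩, fun φ q => ht φ q⟩
  · simp only [contract_eq, ht]
    apply contMDiff_of_coord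
    intro φ₀
    obtain ⟨Φ₂, Φ₀, hΦ, h⟩ := hG (A.idx φ₀.1) φ₀.1
    set i := A.idx φ₀.1
    set x₀ := φ₀.1
    have hfd : ∀ {s : E × (F →L[ℝ] ℝ) → ℝ}, ContDiffOn ℝ ∞ s (A.dual.baseChart i x₀).target →
        ContDiffOn ℝ ∞ (fderiv ℝ s) (A.dual.baseChart i x₀).target := fun hs =>
      hs.fderiv_of_isOpen (A.dual.isOpen_baseChart_target i x₀) (by simp)
    -- P and Y are the phase coordinates of σ as functions of the base coordinates. The pairing
    -- becomes the differential of f applied to (Φ₂, Φ₀) along them, a composition of smooth maps.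
    let P : E × (F →L[ℝ] ℝ) → (E →L[ℝ] ℝ) := fun q =>
      (fderiv ℝ (σ.loc i x₀) q).comp (ContinuousLinearMap.inl ℝ E (F →L[ℝ] ℝ))
    let Y : E × (F →L[ℝ] ℝ) → ((F →L[ℝ] ℝ) →L[ℝ] ℝ) := fun q =>
      (fderiv ℝ (σ.loc i x₀) q).comp (ContinuousLinearMap.inr ℝ E (F →L[ℝ] ℝ))
    have hP : ContDiffOn ℝ ∞ P (A.dual.baseChart i x₀).target :=
      (hfd (σ.contDiffOn_loc i x₀)).clm_comp contDiffOn_const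
    have hY : ContDiffOn ℝ ∞ Y (A.dual.baseChart i x₀).target :=
      (hfd (σ.contDiffOn_loc i x₀)).clm_comp contDiffOn_const
    refine ⟨fun q => fderiv ℝ (fun q => f (A.dual.coordSymm i x₀ q)) q
      (Φ₂ q.1 (Y q), Φ₀ q.1 q.2 (Y q) (P q)), ?_, fun φ hφ => ?_⟩
    · refine (hfd (A.dual.contDiffOn_fun_comp_coordSymm i x₀ f)).clm_apply
        (ContDiffOn.prodMk ?_ ?_)
      · exact hΦ.smooth₂.comp (contDiff_fst.contDiffOn.prodMk hY)
          (fun q hq => ⟨mem_chart_image (B := A.dual) hq, mem_univ _⟩)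
      · exact hΦ.smooth₀.comp (contDiff_fst.contDiffOn.prodMk (contDiff_snd.contDiffOn.prodMk
          (hY.prodMk hP))) (fun q hq => ⟨mem_chart_image (B := A.dual) hq, mem_univ _⟩)
    · rw [A.dual.dfun_apply (i := i) (x₀ := x₀) hφ]
      have h2 := congrArg Prod.snd (h φ hφ σ _ _ _ _ rfl rfl)
      exact congrArg (A.dual.cdiff i x₀ f φ) h2
  · obtain ⟨Φ₂, Φ₀, hΦ, h⟩ := hG i x₀
    refine ⟨Φ₂, Φ₀, hΦ, fun φ hφ σ x ξ p y hx hσ => ?_⟩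
    rw [ht]
    exact h φ hφ σ x ξ p y hx hσ

theorem AffineTensor.ext_sharp {Γ Γ' : A.AffineTensor} (h : ∀ β, Γ.sharp β = Γ'.sharp β) :
    Γ = Γ' := by
  apply AffineTensor.ext
  funext φ
  apply A.dual.sharpAt_injective
  intro p
  have h1 := h ⟨φ, p⟩
  exact eq_of_heq (Bundle.TotalSpace.mk.inj h1).2

end

/-! ### Special affgebroids correspond to affine tensors. -/

section

variable {A}

theorem mem_dom_self (x : M) : x ∈ A.dom (A.idx x) x := ⟨A.mem_U x, mem_chart_source E x⟩

theorem mfderiv_chart_injective {x₀ x : M} (hx : x ∈ (chartAt E x₀).source) :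
    Function.Injective (mfderiv 𝓘(ℝ, E) 𝓘(ℝ, E) (chartAt E x₀) x) :=
  ((mdifferentiable_chart (I := 𝓘(ℝ, E)) x₀).mfderiv_bijective hx).1

theorem mfderiv_chart_fst {i : A.Idx} {x₀ : M} {b : A.Base} (hb : b.1 ∈ A.dom i x₀)
    (w : TangentSpace 𝓘(ℝ, E × F) b) :
    mfderiv 𝓘(ℝ, E) 𝓘(ℝ, E) (chartAt E x₀) b.1
      (mfderiv 𝓘(ℝ, E × F) 𝓘(ℝ, E) (fun c : A.Base => c.1) b w) =
    (show E × F from mfderiv 𝓘(ℝ, E × F) 𝓘(ℝ, E × F) (A.coord i x₀) b w).1 := by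
  have h1 : MDifferentiableAt 𝓘(ℝ, E) 𝓘(ℝ, E) (chartAt E x₀) b.1 :=
    ((contMDiffOn_chart (I := 𝓘(ℝ, E)) (n := ∞) (x := x₀)).contMDiffAt
      ((chartAt E x₀).open_source.mem_nhds hb.2)).mdifferentiableAt (by simp)
  have h2 : MDifferentiableAt 𝓘(ℝ, E × F) 𝓘(ℝ, E) (fun c : A.Base => c.1) b :=
    A.contMDiff_fst.mdifferentiableAt (by simp)
  have h3 := mfderiv_comp b h1 h2
  have h4 : MDifferentiableAt 𝓘(ℝ, E × F) 𝓘(ℝ, E) (Prod.fst : E × F → E) (A.coord i x₀ b) :=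
    differentiableAt_fst.mdifferentiableAt
  have h5 := mfderiv_comp b h4 (A.mdifferentiableAt_coord hb)
  have h6 : (Prod.fst : E × F → E) ∘ A.coord i x₀ =
    (chartAt E x₀) ∘ (fun c : A.Base => c.1) := rfl
  rw [h6, h3] at h5
  have h7 := congrArg (fun L : TangentSpace 𝓘(ℝ, E × F) b →L[ℝ] E => L w) h5
  refine Eq.trans h7 ?_
  rw [mfderiv_eq_fderiv, fderiv_fst]
  rfl

/-- The projection to TM reads only the ẋ-coordinate, and the derivative of a chart of M is
injective. -/
theorem tangentMap_fst_eq {i : A.Idx} {x₀ : M} {w w' : TangentBundle 𝓘(ℝ, E × F) A.Base}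
    (hw : w.proj.1 ∈ A.dom i x₀) (hw' : w.proj.1 = w'.proj.1)
    (h : (A.tangentCoord i x₀ w).2.1 = (A.tangentCoord i x₀ w').2.1) :
    tangentMap 𝓘(ℝ, E × F) 𝓘(ℝ, E) (fun b : A.Base => b.1) w =
      tangentMap 𝓘(ℝ, E × F) 𝓘(ℝ, E) (fun b : A.Base => b.1) w' := by
  obtain ⟨⟨x, c⟩, u⟩ := w
  obtain ⟨⟨x', c'⟩, u'⟩ := w'
  obtain rfl : x = x' := hw'
  have h1 := mfderiv_chart_fst (A := A) (b := (⟨x, c⟩ : Σ x : M, A.QFib x)) hw u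
  have h2 := mfderiv_chart_fst (A := A) (b := (⟨x, c'⟩ : Σ x : M, A.QFib x)) hw u'
  have h3 := mfderiv_chart_injective hw.2 (h1.trans (Eq.trans h h2.symm))
  exact congrArg (fun u => (⟨x, u⟩ : TangentBundle 𝓘(ℝ, E) M)) h3

variable [SigmaCompactSpace M] [FiniteDimensional ℝ F]

theorem nonempty_avSection (A : SpecialAffineBundle E M F) : Nonempty A.AVSection := by
  obtain ⟨ψ⟩ := A.dual.nonempty_sec
  exact ⟨zeroSec ψ⟩

/-- The covered map is no extra datum: over each point of A / ⟨v⟩ there is an element of PA, because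
AV(A) has a global section, and compatibility with the projections then fixes the value. -/
theorem SpecialAffgebroid.ext_toFun {ℰ ℰ' : A.SpecialAffgebroid}
    (h : ∀ α, ℰ.toFun α = ℰ'.toFun α) : ℰ = ℰ' := by
  apply SpecialAffgebroid.ext (funext h)
  funext b
  obtain ⟨σ⟩ := A.nonempty_avSection
  have h1 := ℰ.comm_left (σ.ddP b)
  have h2 := ℰ'.comm_left (σ.ddP b)
  rw [h] at h1
  exact h1.symm.trans h2

theorem exists_rel_symm (φ : A.dual.Base) (τ : A.dual.AVSection) :
    ∃ (b : A.Base) (σ : A.AVSection), A.canonicalIso.symm (τ.ddP φ) = σ.ddP b ∧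
      Rel (σ.ddP b) (τ.ddP φ) := by
  obtain ⟨b, σ, h⟩ := exists_ddP_eq (A.canonicalIso.symm (τ.ddP φ))
  refine ⟨b, σ, h, ?_⟩
  have := rel_canonicalIso (σ.ddP b)
  rwa [← h, Equiv.apply_symm_apply, h] at this

/-- Composing with the inverse of the canonical isomorphism changes the local form only by the
linear substitution (y, p) ↦ (bidual⁻¹ y, -p), so `exists_affineTensor` applies to the composite. -/
theorem exists_affineTensor_of_affgebroid (ℰ : A.SpecialAffgebroid) :
    ∃ Γ : A.AffineTensor, ∀ α, ℰ.toFun α = Γ.sharp (A.canonicalIso α) := by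
  have key : ∀ (i : A.Idx) (x₀ : M), ∃ (Φ₂ : E → ((F →L[ℝ] ℝ) →L[ℝ] ℝ) → E)
      (Φ₀ : E → (F →L[ℝ] ℝ) → ((F →L[ℝ] ℝ) →L[ℝ] ℝ) → (E →L[ℝ] ℝ) → (F →L[ℝ] ℝ)),
      IsTrivialDoubleAffineMorphism (chartAt E x₀ '' A.dom i x₀) (fun _ ξ => ξ) Φ₂ Φ₀ ∧
      ∀ φ : A.dual.Base, φ.1 ∈ A.dom i x₀ → ∀ (τ : A.dual.AVSection) (x : E) (ξ : F →L[ℝ] ℝ)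
        (p : E →L[ℝ] ℝ) (y : (F →L[ℝ] ℝ) →L[ℝ] ℝ),
        A.dual.coord i x₀ φ = (x, ξ) → τ.phaseCoord i x₀ φ = (p, y) →
          A.dual.tangentCoord i x₀ (ℰ.toFun (A.canonicalIso.symm (τ.ddP φ))) =
            ((x, ξ), (Φ₂ x y, Φ₀ x ξ y p)) := by
    intro i x₀
    obtain ⟨Φ₂, Φ₀, hΦ, h⟩ := ℰ.isMorphism i x₀
    refine ⟨_, _, hΦ.precomp (bidual (F := F)).symm.toContinuousLinearMap
      (-ContinuousLinearMap.id ℝ (E →L[ℝ] ℝ)), fun φ hφ τ x ξ p y hx hτ => ?_⟩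
    obtain ⟨b, σ, h1, h2⟩ := exists_rel_symm φ τ
    obtain ⟨e, h2⟩ := h2.coord
    have hb : b.1 ∈ A.dom i x₀ := by rw [← e]; exact hφ
    obtain ⟨x', y', p', ξ', h3, h4, h5, h6⟩ := h2 i x₀ hb
    obtain ⟨rfl, rfl⟩ := Prod.mk.inj (hx.symm.trans h5)
    replace hτ := (AVSection.phaseCoord_eq_iff (A := A.dual) τ i x₀ φ p y).1 hτ
    obtain ⟨rfl, rfl⟩ := coprod_inj (hτ.symm.trans h6)
    rw [h1, h b hb σ x y' p' ξ h3 ((AVSection.phaseCoord_eq_iff _ _ _ _ _ _).2 h4)]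
    rw [← bidual_apply]
    simp
  have hG : ∀ (φ : A.dual.Base) (q : A.dual.PhaseFib φ),
      ∃ w : TangentSpace 𝓘(ℝ, E × (F →L[ℝ] ℝ)) φ,
        ℰ.toFun (A.canonicalIso.symm ⟨φ, q⟩) = ⟨φ, w⟩ := by
    intro φ q
    obtain ⟨τ, rfl⟩ := exists_dd_eq q
    obtain ⟨Φ₂, Φ₀, -, h⟩ := key (A.idx φ.1) φ.1
    have h1 := congrArg Prod.fst (h φ (mem_dom_self φ.1) τ _ _ _ _ rfl rfl)
    obtain ⟨b, σ, h2, h3⟩ := exists_rel_symm φ τ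
    -- Coordinates separate only points already known to lie over the chart domain. `over_base`
    -- supplies that, and equality of the coordinates (x, ξ) then puts the value over φ itself.
    have h4 : (ℰ.toFun (A.canonicalIso.symm (τ.ddP φ))).proj.1 = φ.1 := by
      rw [ℰ.over_base, h2]
      exact h3.coord.1.symm
    have h5 : (ℰ.toFun (A.canonicalIso.symm (τ.ddP φ))).proj = φ := by
      refine A.dual.coord_injOn (i := A.idx φ.1) (x₀ := φ.1) ?_ (mem_dom_self (A := A) φ.1) h1
      rw [h4]
      exact mem_dom_self (A := A) φ.1
    change ∃ w, ℰ.toFun (A.canonicalIso.symm (τ.ddP φ)) = ⟨φ, w⟩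
    generalize ℰ.toFun (A.canonicalIso.symm (τ.ddP φ)) = z at h5
    obtain ⟨z1, z2⟩ := z
    obtain rfl : z1 = φ := h5
    exact ⟨z2, rfl⟩
  choose G hG using hG
  obtain ⟨Γ, hΓ⟩ := exists_affineTensor G (by
    intro i x₀
    obtain ⟨Φ₂, Φ₀, hΦ, h⟩ := key i x₀
    refine ⟨Φ₂, Φ₀, hΦ, fun φ hφ τ x ξ p y hx hτ => ?_⟩
    rw [← hG φ (τ.dd φ)]
    exact h φ hφ τ x ξ p y hx hτ)
  refine ⟨Γ, fun α => ?_⟩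
  have h1 := hG (A.canonicalIso α).1 (A.canonicalIso α).2
  have h2 : A.canonicalIso.symm ⟨(A.canonicalIso α).1, (A.canonicalIso α).2⟩ = α :=
    A.canonicalIso.symm_apply_apply α
  rw [h2] at h1
  rw [h1, ← hΓ]
  rfl

theorem exists_affgebroid_of_affineTensor (Γ : A.AffineTensor) :
    ∃ ℰ : A.SpecialAffgebroid, ∀ α, ℰ.toFun α = Γ.sharp (A.canonicalIso α) := by
  obtain ⟨σ₀⟩ := A.nonempty_avSection
  have hov : ∀ α : A.Phase, (A.canonicalIso α).1.1 = α.1.1 := by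
    intro α
    obtain ⟨b, σ, rfl⟩ := exists_ddP_eq α
    have h := rel_canonicalIso (σ.ddP b)
    obtain ⟨φ, τ, h1⟩ := exists_ddP_eq (A.canonicalIso (σ.ddP b))
    rw [h1] at h ⊢
    exact h.coord.1
  have key : ∀ (i : A.Idx) (x₀ : M), ∃ (Φ₂ : E → F → E)
      (Φ₀ : E → (F →L[ℝ] ℝ) → F → (E →L[ℝ] ℝ) → (F →L[ℝ] ℝ)),
      IsTrivialDoubleAffineMorphism (chartAt E x₀ '' A.dom i x₀) (fun _ ξ => ξ) Φ₂ Φ₀ ∧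
      ∀ b : A.Base, b.1 ∈ A.dom i x₀ → ∀ (σ : A.AVSection) (x : E) (y : F) (p : E →L[ℝ] ℝ)
        (ξ : F →L[ℝ] ℝ), A.coord i x₀ b = (x, y) → σ.phaseCoord i x₀ b = (p, ξ) →
          A.dual.tangentCoord i x₀ (Γ.sharp (A.canonicalIso (σ.ddP b))) =
            ((x, ξ), (Φ₂ x y, Φ₀ x ξ y p)) := by
    intro i x₀
    obtain ⟨Φ₂, Φ₀, hΦ, h⟩ := Γ.isMorphism i x₀
    refine ⟨_, _, hΦ.precomp (bidual (F := F)).toContinuousLinearMap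
      (-ContinuousLinearMap.id ℝ (E →L[ℝ] ℝ)), fun b hb σ x y p ξ hx hσ => ?_⟩
    have h1 := rel_canonicalIso (σ.ddP b)
    obtain ⟨φ, τ, h2⟩ := exists_ddP_eq (A.canonicalIso (σ.ddP b))
    rw [h2] at h1 ⊢
    obtain ⟨e, h1⟩ := h1.coord
    have hφ : φ.1 ∈ A.dom i x₀ := by rw [e]; exact hb
    obtain ⟨x', y', p', ξ', h3, h4, h5, h6⟩ := h1 i x₀ hb
    obtain ⟨rfl, rfl⟩ := Prod.mk.inj (hx.symm.trans h3)
    rw [AVSection.phaseCoord_eq_iff] at hσ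
    obtain ⟨rfl, rfl⟩ := coprod_inj (hσ.symm.trans h4)
    exact h φ hφ τ x ξ (-p) _ h5 ((AVSection.phaseCoord_eq_iff (A := A.dual) _ _ _ _ _ _).2 h6)
  -- The covered map is computed from the auxiliary section σ₀. The choice is harmless because in
  -- local coordinates ẋ = Φ₂(x, y) does not depend on p and ξ.
  refine ⟨⟨fun α => Γ.sharp (A.canonicalIso α), fun b => tangentMap 𝓘(ℝ, E × (F →L[ℝ] ℝ)) 𝓘(ℝ, E)
    (fun φ : A.dual.Base => φ.1) (Γ.sharp (A.canonicalIso (σ₀.ddP b))), hov, fun α => ?_, key⟩,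
    fun α => rfl⟩
  obtain ⟨b, σ, rfl⟩ := exists_ddP_eq α
  obtain ⟨Φ₂, Φ₀, hΦ, h⟩ := key (A.idx b.1) b.1
  have hb := mem_dom_self (A := A) b.1
  refine tangentMap_fst_eq (A := A.dual) (i := A.idx b.1) (x₀ := b.1) ?_ ?_ ?_
  · have := hov (σ.ddP b)
    change (A.canonicalIso (σ.ddP b)).1.1 ∈ _
    rw [this]
    exact hb
  · exact (hov (σ.ddP b)).trans (hov (σ₀.ddP b)).symm
  · rw [h b hb σ _ _ _ _ rfl rfl]
    change _ = (A.dual.tangentCoord (A.idx b.1) b.1 (Γ.sharp (A.canonicalIso (σ₀.ddP b)))).2.1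
    rw [h b hb σ₀ _ _ _ _ rfl rfl]

end

/-! ### Fibrewise affine functions and sections over N are the ι_X and ι_a. -/

section

variable {A}

theorem dfun_mul (h k : C^∞⟮𝓘(ℝ, E × F), A.Base; ℝ⟯) (b : A.Base) :
    A.dfun (h * k) b = h b • A.dfun k b + k b • A.dfun h b := by
  have hb := mem_dom_self (A := A) b.1
  refine ContinuousLinearMap.ext fun w => ?_
  change A.dfun (h * k) b w = h b * A.dfun k b w + k b * A.dfun h b w
  simp only [A.dfun_apply hb, cdiff]
  have h1 : (fun q => (h * k) (A.coordSymm (A.idx b.1) b.1 q)) =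
      (fun q => h (A.coordSymm (A.idx b.1) b.1 q)) * fun q => k (A.coordSymm (A.idx b.1) b.1 q) := rfl
  rw [h1, fderiv_mul (A.differentiableAt_comp_coordSymm hb h)
    (A.differentiableAt_comp_coordSymm hb k), A.coordSymm_coord hb]
  rfl

theorem dfun_smul (c : ℝ) (h : C^∞⟮𝓘(ℝ, E × F), A.Base; ℝ⟯) (b : A.Base) :
    A.dfun (c • h) b = c • A.dfun h b := by
  have hb := mem_dom_self (A := A) b.1
  refine ContinuousLinearMap.ext fun w => ?_
  change A.dfun (c • h) b w = c * A.dfun h b w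
  simp only [A.dfun_apply hb, cdiff]
  have h1 : (fun q => (c • h) (A.coordSymm (A.idx b.1) b.1 q)) =
      c • (fun q => h (A.coordSymm (A.idx b.1) b.1 q)) := rfl
  rw [h1, fderiv_const_smul (A.differentiableAt_comp_coordSymm hb h)]
  rfl

theorem dfun_pull (g : C^∞⟮𝓘(ℝ, E), M; ℝ⟯) (b : A.Base) (w : TangentSpace 𝓘(ℝ, E × F) b) :
    A.dfun (A.pull g) b w =
      dirDeriv g b.1 (mfderiv 𝓘(ℝ, E × F) 𝓘(ℝ, E) (fun c : A.Base => c.1) b w) := by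
  have h1 : MDifferentiableAt 𝓘(ℝ, E) 𝓘(ℝ, ℝ) g b.1 := g.contMDiff.mdifferentiableAt (by simp)
  have h2 : MDifferentiableAt 𝓘(ℝ, E × F) 𝓘(ℝ, E) (fun c : A.Base => c.1) b :=
    A.contMDiff_fst.mdifferentiableAt (by simp)
  have h3 := mfderiv_comp b h1 h2
  exact congrArg (fun L : TangentSpace 𝓘(ℝ, E × F) b →L[ℝ] ℝ => L w) h3

/-- The point of `A / ⟨v⟩` over `x` with fibre coordinate `y`. -/
def qpoint (A : SpecialAffineBundle E M F) (i : A.Idx) (y : F) (x : M) : A.Base := ⟨x, A.qinv i x y⟩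

theorem contMDiffOn_qinv (i : A.Idx) (y : F) :
    ContMDiffOn 𝓘(ℝ, E) 𝓘(ℝ, E × F) ∞ (A.qpoint i y) (A.U i) := by
  intro x₁ hx
  have h1 : ContMDiffOn 𝓘(ℝ, E) 𝓘(ℝ, E × F) ∞ (fun x => A.coordSymm i x₁ (chartAt E x₁ x, y))
      (A.dom i x₁) := by
    refine (A.contMDiffOn_coordSymm i x₁).comp
      (((contMDiffOn_chart (x := x₁)).mono inter_subset_right).prodMk_space contMDiffOn_const)
      (fun x hx => ⟨(chartAt E x₁).map_source hx.2, ?_⟩)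
    change (chartAt E x₁).symm (chartAt E x₁ x) ∈ A.U i
    rw [(chartAt E x₁).left_inv hx.2]
    exact hx.1
  have h2 : ∀ x ∈ A.dom i x₁, A.qpoint i y x =
      A.coordSymm i x₁ (chartAt E x₁ x, y) := by
    intro x hx
    change _ = A.qpoint i y ((chartAt E x₁).symm (chartAt E x₁ x))
    rw [(chartAt E x₁).left_inv hx.2]
  exact ((h1.congr h2).contMDiffAt ((A.isOpen_dom i x₁).mem_nhds
    ⟨hx, mem_chart_source E x₁⟩)).contMDiffWithinAt

theorem base_eq_qinv (i : A.Idx) (b : A.Base) :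
    b = A.qpoint i (A.qcoord i b.1 b.2) b.1 := by
  rw [qpoint, A.qinv_qcoord]
  rfl

theorem IsAffineFun.of_qcoord {f : C^∞⟮𝓘(ℝ, E × F), A.Base; ℝ⟯}
    (H : ∀ x, ∃ (i : A.Idx) (T : F →ᵃ[ℝ] ℝ), ∀ b : A.Base, b.1 = x → f b = T (A.qcoord i b.1 b.2)) :
    A.IsAffineFun f := by
  intro x
  obtain ⟨i, T, hT⟩ := H x
  refine ⟨(T.comp (LinearMap.fst ℝ F ℝ).toAffineMap).comp (A.triv i x).toAffineMap, fun a => ?_⟩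
  exact hT ⟨x, A.qmk a⟩ rfl

theorem IsAffineFun.exists_qcoord {f : C^∞⟮𝓘(ℝ, E × F), A.Base; ℝ⟯} (h : A.IsAffineFun f)
    (i : A.Idx) (x : M) : ∃ T : F →ᵃ[ℝ] ℝ, ∀ b : A.Base, b.1 = x → f b = T (A.qcoord i b.1 b.2) := by
  obtain ⟨T, hT⟩ := h x
  refine ⟨(T.comp (A.triv i x).symm.toAffineMap).comp (LinearMap.inl ℝ F ℝ).toAffineMap, ?_⟩
  rintro b rfl
  have h1 := hT ((A.triv i b.1).symm (A.qcoord i b.1 b.2, 0))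
  refine Eq.trans ?_ h1
  exact congrArg f (base_eq_qinv i b)

variable [FiniteDimensional ℝ F]

theorem linPart_qinv (i : A.Idx) (x : M) (u : A.Mod x) (ξ : F →L[ℝ] ℝ) :
    A.linPart u (A.dual.qinv i x ξ) = ξ ((A.triv i x).linear u).1 + ((A.triv i x).linear u).2 :=
  dualInv_linear i x (ξ, 0) u

theorem linPart_eq (i : A.Idx) {x : M} (u : A.Mod x) (q : A.dual.QFib x) :
    A.linPart u q = A.dual.qcoord i x q ((A.triv i x).linear u).1 + ((A.triv i x).linear u).2 := by
  conv_lhs => rw [← A.dual.qinv_qcoord i x q]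
  exact linPart_qinv i x u _

/-- The value at ξ = 0 gives the ℝ-component; after subtracting it, the functionals ξ separate the
points of F. -/
theorem linPart_injective {x : M} {u u' : A.Mod x}
    (h : ∀ q : A.dual.QFib x, A.linPart u q = A.linPart u' q) : u = u' := by
  apply (A.triv (A.idx x) x).linear.injective
  have h1 : ∀ ξ : F →L[ℝ] ℝ, ξ ((A.triv (A.idx x) x).linear u).1 +
      ((A.triv (A.idx x) x).linear u).2 = ξ ((A.triv (A.idx x) x).linear u').1 +
      ((A.triv (A.idx x) x).linear u').2 := by
    intro ξ
    rw [← linPart_qinv, ← linPart_qinv, h]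
  have h2 := h1 0
  simp only [zero_apply, zero_add] at h2
  refine Prod.ext ((SeparatingDual.eq_iff_forall_dual_eq (R := ℝ)).2 fun ξ => ?_) h2
  have h3 := h1 ξ
  rw [h2] at h3
  exact add_right_cancel h3

theorem iotaFun_apply (X : A.SecV) (φ : A.dual.Base) : iotaFun X φ = A.linPart (X.1 φ.1) φ.2 := rfl

theorem iotaFun_injective {X Y : A.SecV} (h : iotaFun X = iotaFun Y) : X = Y := by
  apply Subtype.ext
  funext x
  apply linPart_injective
  intro q
  have := congrArg (fun f : C^∞⟮𝓘(ℝ, E × (F →L[ℝ] ℝ)), A.dual.Base; ℝ⟯ => f ⟨x, q⟩) h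
  exact this

theorem linPart_add {x : M} (u u' : A.Mod x) (q : A.dual.QFib x) :
    A.linPart (u + u') q = A.linPart u q + A.linPart u' q := by
  simp only [linPart_eq (A.idx x), map_add, Prod.fst_add, Prod.snd_add]
  ring

theorem linPart_smul {x : M} (c : ℝ) (u : A.Mod x) (q : A.dual.QFib x) :
    A.linPart (c • u) q = c * A.linPart u q := by
  simp only [linPart_eq (A.idx x), map_smul, Prod.smul_fst, Prod.smul_snd, smul_eq_mul]
  ring

theorem linPart_v {x : M} (q : A.dual.QFib x) : A.linPart (A.v x) q = 1 := by
  rw [linPart_eq (A.idx x), A.triv_v]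
  simp

theorem iotaFun_add (X Y : A.SecV) : iotaFun (X + Y) = iotaFun X + iotaFun Y := by
  ext φ
  exact linPart_add _ _ _

theorem iotaFun_smul (c : ℝ) (X : A.SecV) : iotaFun (c • X) = c • iotaFun X := by
  ext φ
  exact linPart_smul _ _ _

theorem iotaFun_sub (X Y : A.SecV) : iotaFun (X - Y) = iotaFun X - iotaFun Y := by
  have h := iotaFun_add (X - Y) Y
  rw [sub_add_cancel] at h
  exact eq_sub_of_add_eq h.symm

theorem iotaFun_zero : iotaFun (0 : A.SecV) = 0 := by
  have h := iotaFun_smul (0 : ℝ) (0 : A.SecV)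
  rwa [smul_zero, zero_smul] at h

theorem iotaFun_smulV (g : C^∞⟮𝓘(ℝ, E), M; ℝ⟯) (X : A.SecV) :
    iotaFun (smulV g X) = A.dual.pull g * iotaFun X := by
  ext φ
  exact linPart_smul _ _ _

theorem iotaFun_vSec : iotaFun A.vSec = 1 := by
  ext φ
  exact linPart_v _

/-- Thus a ↦ ι_a is affine with linear part X ↦ ι_X; the distinguished vector -v in the definition
of AV is what makes the sign positive. -/
theorem iotaSec_vadd (a : A.Sec) (X : A.SecV) :
    iotaSec (vadd a X) = (iotaSec a).add (iotaFun X) := by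
  apply AVSection.ext
  funext φ
  refine Eq.trans ?_ (AVSection.add_toFun (A := A.dual) (iotaSec a) (iotaFun X) φ).symm
  obtain ⟨x, q⟩ := φ
  induction q using Quotient.inductionOn with
  | _ φ =>
    apply Subtype.ext
    ext c
    change (-(φ.1 (X.1 x +ᵥ a.1 x))) * 1 + φ.1 c =
      (-(φ.1.linear (X.1 x))) * 1 + ((-(φ.1 (a.1 x))) * 1 + φ.1 c)
    rw [AffineMap.map_vadd]
    simp only [vadd_eq_add]
    ring

theorem iotaSec_isAffine (a : A.Sec) : (iotaSec a).IsAffine := by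
  intro x
  let S : A.DualMod x →ₗ[ℝ] A.DualMod x :=
    { toFun := fun ψ => (-(ψ.1 (a.1 x))) • A.dualOne x + ψ
      map_add' := fun ψ ψ' => by
        apply Subtype.ext
        ext c
        change (-(ψ.1 (a.1 x) + ψ'.1 (a.1 x))) * 1 + (ψ.1 c + ψ'.1 c) =
          ((-(ψ.1 (a.1 x))) * 1 + ψ.1 c) + ((-(ψ'.1 (a.1 x))) * 1 + ψ'.1 c)
        ring
      map_smul' := fun r ψ => by
        apply Subtype.ext
        ext c
        change (-(r * ψ.1 (a.1 x))) * 1 + r * ψ.1 c = r * ((-(ψ.1 (a.1 x))) * 1 + ψ.1 c)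
        ring }
  refine ⟨⟨fun φ : A.DualFib x => A.dualShift (a.1 x) (A.dual.qmk φ), S, fun φ ψ => ?_⟩,
    fun φ => rfl⟩
  apply Subtype.ext
  ext c
  change (-(ψ.1 (a.1 x) + φ.1 (a.1 x))) * 1 + (ψ.1 c + φ.1 c) =
    ((-(ψ.1 (a.1 x))) * 1 + ψ.1 c) + ((-(φ.1 (a.1 x))) * 1 + φ.1 c)
  ring

theorem iotaFun_isAffineFun (X : A.SecV) : A.dual.IsAffineFun (iotaFun X) := by
  apply IsAffineFun.of_qcoord
  intro x
  refine ⟨A.idx x, (LinearMap.toAffineMap ((ContinuousLinearMap.apply ℝ ℝ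
    ((A.triv (A.idx x) x).linear (X.1 x)).1 : (F →L[ℝ] ℝ) →L[ℝ] ℝ) : (F →L[ℝ] ℝ) →ₗ[ℝ] ℝ)) +
      AffineMap.const ℝ _ ((A.triv (A.idx x) x).linear (X.1 x)).2, ?_⟩
  rintro φ rfl
  exact linPart_eq (A.idx φ.1) (X.1 φ.1) φ.2

/-- An affine function T on the dual of F is ξ ↦ ξ(u) + T(0), where the coordinates of u are the
increments of T along the dual basis. Evaluating f along the smooth sections with constant ξ shows
that u and T(0) vary smoothly. The resulting vectors do not depend on the trivialization since
`linPart_injective` recovers them from f. -/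
theorem IsAffineFun.exists_iotaFun {f : C^∞⟮𝓘(ℝ, E × (F →L[ℝ] ℝ)), A.dual.Base; ℝ⟯}
    (hf : A.dual.IsAffineFun f) : ∃ X : A.SecV, f = iotaFun X := by
  let β := Module.finBasis ℝ F
  let fi : A.Idx → M → (F →L[ℝ] ℝ) → ℝ := fun i x ξ => f ⟨x, A.dual.qinv i x ξ⟩
  let s : A.Idx → M → F × ℝ := fun i x =>
    (∑ k, (fi i x (β.coord k).toContinuousLinearMap - fi i x 0) • β k, fi i x 0)
  have hs : ∀ i, ContMDiffOn 𝓘(ℝ, E) 𝓘(ℝ, F × ℝ) ∞ (s i) (A.U i) := by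
    intro i
    have h1 : ∀ ξ, ContMDiffOn 𝓘(ℝ, E) 𝓘(ℝ, ℝ) ∞ (fun x => fi i x ξ) (A.U i) := fun ξ =>
      f.contMDiff.comp_contMDiffOn (contMDiffOn_qinv (A := A.dual) i ξ)
    refine ContMDiffOn.prodMk_space ?_ (h1 0)
    apply contMDiffOn_finsetSum
    intro k _
    exact ((h1 _).sub (h1 0)).smul contMDiffOn_const
  have hl : ∀ (i : A.Idx) (φ : A.dual.Base),
      A.linPart ((A.triv i φ.1).linear.symm (s i φ.1)) φ.2 = f φ := by
    intro i φ
    obtain ⟨T, hT⟩ := hf.exists_qcoord (A := A.dual) i φ.1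
    have h1 : ∀ ξ, fi i φ.1 ξ = T ξ := by
      intro ξ
      refine (hT ⟨φ.1, A.dual.qinv i φ.1 ξ⟩ rfl).trans ?_
      exact congrArg T (A.dual.qcoord_qinv i φ.1 ξ)
    rw [linPart_eq i, LinearEquiv.apply_symm_apply, hT φ rfl]
    set ξ := A.dual.qcoord i φ.1 φ.2
    simp only [s, h1, map_sum, map_smul, smul_eq_mul]
    have h3 : ∀ k, T k - T 0 = T.linear k := by
      intro k
      have := T.linearMap_vsub k 0
      simpa using this.symm
    have h4 : ξ = ∑ k, ξ (β k) • (β.coord k).toContinuousLinearMap := by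
      refine ContinuousLinearMap.ext fun w => ?_
      conv_lhs => rw [← β.sum_repr w, map_sum]
      simp [mul_comm]
    have h5 : T.linear ξ = ∑ k, ξ (β k) * T.linear (β.coord k).toContinuousLinearMap := by
      conv_lhs => rw [h4, map_sum]
      simp
    simp only [h3]
    rw [sub_eq_iff_eq_add.1 (h3 ξ), h5]
    exact congrArg (· + T 0) (Finset.sum_congr rfl fun k _ => mul_comm _ _)
  refine ⟨⟨fun x => (A.triv (A.idx x) x).linear.symm (s (A.idx x) x), fun i => ?_⟩, ?_⟩
  · refine (hs i).congr fun x _ => ?_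
    have h1 : (A.triv (A.idx x) x).linear.symm (s (A.idx x) x) =
        (A.triv i x).linear.symm (s i x) := by
      apply linPart_injective
      intro q
      exact (hl (A.idx x) ⟨x, q⟩).trans (hl i ⟨x, q⟩).symm
    dsimp only
    rw [h1, LinearEquiv.apply_symm_apply]
  · ext φ
    exact (hl (A.idx φ.1) φ).symm

variable [SigmaCompactSpace M]

/-- Compare with any ι_a: the difference of two affine sections is a fibrewise affine function,
hence some ι_X, and ι_a + ι_X is again of the required form. -/
theorem AVSection.IsAffine.exists_iotaSec {σ : A.dual.AVSection} (hσ : σ.IsAffine) :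
    ∃ a : A.Sec, σ = iotaSec a := by
  obtain ⟨a⟩ := A.nonempty_sec
  obtain ⟨h, rfl⟩ := (iotaSec a).exists_add σ
  have hh : A.dual.IsAffineFun h := by
    intro x
    obtain ⟨T, hT⟩ := hσ x
    obtain ⟨S, hS⟩ := iotaSec_isAffine a x
    let i := A.idx x
    refine ⟨(LinearMap.snd ℝ (F →L[ℝ] ℝ) ℝ).toAffineMap.comp
      ((A.dual.triv i x).toAffineMap.comp S) - (LinearMap.snd ℝ (F →L[ℝ] ℝ) ℝ).toAffineMap.comp
      ((A.dual.triv i x).toAffineMap.comp T), fun φ => ?_⟩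
    change _ = (A.dual.triv i x (S φ)).2 - (A.dual.triv i x (T φ)).2
    rw [← hS, ← hT]
    have h1 := A.dual.triv_smul_v_vadd i x (-h ⟨x, A.dual.qmk φ⟩)
      ((iotaSec a).toFun ⟨x, A.dual.qmk φ⟩)
    have h2 := (iotaSec a).add_toFun h ⟨x, A.dual.qmk φ⟩
    rw [h2]
    have h3 := congrArg Prod.snd h1
    dsimp only at h3
    linarith
  obtain ⟨X, rfl⟩ := hh.exists_iotaFun
  exact ⟨vadd a X, (iotaSec_vadd a X).symm⟩

end

/-! ### The biderivation of an affine tensor; uniqueness from values on ι_a and ι_X. -/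

section

variable {A} [SigmaCompactSpace M] [FiniteDimensional ℝ F]

theorem AffineTensor.pair_apply (Γ : A.AffineTensor) (σ : A.dual.AVSection)
    (f : C^∞⟮𝓘(ℝ, E × (F →L[ℝ] ℝ)), A.dual.Base; ℝ⟯) (φ : A.dual.Base) :
    Γ.pair σ f φ = A.dual.dfun f φ (A.dual.sharpAt (Γ.toFun φ) (σ.dd φ)) :=
  A.dual.contract_eq _ _ _

theorem AffineTensor.exists_derivation_right (Γ : A.AffineTensor) (σ : A.dual.AVSection) :
    ∃ D : Derivation ℝ C^∞⟮𝓘(ℝ, E × (F →L[ℝ] ℝ)), A.dual.Base; ℝ⟯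
      C^∞⟮𝓘(ℝ, E × (F →L[ℝ] ℝ)), A.dual.Base; ℝ⟯, ∀ f, Γ.pair σ f = D f := by
  refine ⟨Derivation.mk' ⟨⟨Γ.pair σ, fun f g => ?_⟩, fun c f => ?_⟩ fun f g => ?_, fun f => rfl⟩
  · ext φ
    change Γ.pair σ (f + g) φ = Γ.pair σ f φ + Γ.pair σ g φ
    simp only [Γ.pair_apply, A.dual.dfun_add]
    rfl
  · ext φ
    change Γ.pair σ (c • f) φ = c * Γ.pair σ f φ
    simp only [Γ.pair_apply, dfun_smul]
    rfl
  · ext φ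
    change Γ.pair σ (f * g) φ = f φ * Γ.pair σ g φ + g φ * Γ.pair σ f φ
    simp only [Γ.pair_apply, dfun_mul]
    rfl

/-- The derivation is the difference of two pairings at one reference section, so its values are
smooth functions. The linear parts L are chosen point by point and serve only to verify the
identities. -/
theorem AffineTensor.exists_derivation_left (Γ : A.AffineTensor)
    (f : C^∞⟮𝓘(ℝ, E × (F →L[ℝ] ℝ)), A.dual.Base; ℝ⟯) :
    ∃ D : Derivation ℝ C^∞⟮𝓘(ℝ, E × (F →L[ℝ] ℝ)), A.dual.Base; ℝ⟯
      C^∞⟮𝓘(ℝ, E × (F →L[ℝ] ℝ)), A.dual.Base; ℝ⟯,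
      ∀ σ h, Γ.pair (σ.add h) f = Γ.pair σ f + D h := by
  obtain ⟨σ₀⟩ := A.dual.nonempty_avSection
  choose L hL using fun φ => A.dual.exists_linear_sharpAt (Γ.toFun φ)
  have key : ∀ σ h φ, Γ.pair (σ.add h) f φ = Γ.pair σ f φ +
      A.dual.dfun f φ (L φ (A.dual.dfun h φ)) := by
    intro σ h φ
    rw [Γ.pair_apply, Γ.pair_apply, hL, map_add]
  have key' : ∀ h φ, (Γ.pair (σ₀.add h) f - Γ.pair σ₀ f) φ =
      A.dual.dfun f φ (L φ (A.dual.dfun h φ)) := by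
    intro h φ
    change Γ.pair (σ₀.add h) f φ - Γ.pair σ₀ f φ = _
    rw [key]
    ring
  refine ⟨Derivation.mk' ⟨⟨fun h => Γ.pair (σ₀.add h) f - Γ.pair σ₀ f, fun h k => ?_⟩,
    fun c h => ?_⟩ fun h k => ?_, fun σ h => ?_⟩
  · ext φ
    change _ = (Γ.pair (σ₀.add h) f - Γ.pair σ₀ f) φ + (Γ.pair (σ₀.add k) f - Γ.pair σ₀ f) φ
    rw [key', key', key', A.dual.dfun_add, map_add, map_add]
  · ext φ
    change _ = c * (Γ.pair (σ₀.add h) f - Γ.pair σ₀ f) φ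
    rw [key', key', dfun_smul, map_smul, map_smul]
    rfl
  · ext φ
    change (Γ.pair (σ₀.add (h * k)) f - Γ.pair σ₀ f) φ =
      h φ * (Γ.pair (σ₀.add k) f - Γ.pair σ₀ f) φ + k φ * (Γ.pair (σ₀.add h) f - Γ.pair σ₀ f) φ
    rw [key', key', key', dfun_mul, map_add, map_add, map_smul, map_smul, map_smul, map_smul]
    rfl
  · ext φ
    change _ = Γ.pair σ f φ + (Γ.pair (σ₀.add h) f - Γ.pair σ₀ f) φ
    rw [key', key]

theorem AffineTensor.pair_coord (Γ : A.AffineTensor) {i : A.Idx} {x₀ : M} {φ : A.dual.Base}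
    (hφ : φ.1 ∈ A.dom i x₀) (σ : A.dual.AVSection)
    (f : C^∞⟮𝓘(ℝ, E × (F →L[ℝ] ℝ)), A.dual.Base; ℝ⟯) :
    Γ.pair σ f φ = A.dual.cdiff i x₀ f φ
      (A.dual.tangentCoord i x₀ ⟨φ, A.dual.sharpAt (Γ.toFun φ) (σ.dd φ)⟩).2 := by
  rw [Γ.pair_apply, A.dual.dfun_apply (i := i) (x₀ := x₀) hφ]
  rfl

/-- On one fibre of N the y-coordinate of the differential of ι_a is constant and p depends affinely
on ξ. Hence ẋ = Φ₂(x, y) is constant along the fibre, and the fibre component of the velocity,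
jointly affine in (ξ, p), is affine in ξ. In the pairing with the differential of ι_X the former
meets a coefficient affine in ξ and the latter a constant one, so no quadratic term arises. This is
where affineness on the fibres of the second projection is used. -/
theorem AffineTensor.pair_iota_isAffineFun (Γ : A.AffineTensor) (a : A.Sec) (X : A.SecV) :
    A.dual.IsAffineFun (Γ.pair (iotaSec a) (iotaFun X)) := by
  apply IsAffineFun.of_qcoord
  intro x
  have hx := mem_dom_self (A := A) x
  set i := A.idx x
  obtain ⟨Φ₂, Φ₀, hΦ, h⟩ := Γ.isMorphism i x
  have hA := (a.differentiableAt_loc hx).hasFDerivAt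
  have hX := (SecV.differentiableAt_loc X hx).hasFDerivAt
  set u' := fderiv ℝ (a.loc i x) (chartAt E x x)
  set w' := fderiv ℝ (SecV.loc X i x) (chartAt E x x)
  set e := chartAt E x x
  set y := (a.loc i x e).1
  set X₀ := (SecV.loc X i x e).1
  obtain ⟨T, hT⟩ := hΦ.affine₂ e ⟨_, hx, rfl⟩ (ContinuousLinearMap.apply ℝ ℝ y)
  let P : (F →L[ℝ] ℝ) →ᵃ[ℝ] (E →L[ℝ] ℝ) :=
    (ContinuousLinearMap.precomp ℝ ((ContinuousLinearMap.fst ℝ F ℝ).comp u')).toLinearMap.toAffineMap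
      + AffineMap.const ℝ _ ((ContinuousLinearMap.snd ℝ F ℝ).comp u')
  let Q : (F →L[ℝ] ℝ) →ᵃ[ℝ] ℝ :=
    (ContinuousLinearMap.apply ℝ ℝ (w' (Φ₂ e (ContinuousLinearMap.apply ℝ ℝ y))).1 :
      (F →L[ℝ] ℝ) →L[ℝ] ℝ).toLinearMap.toAffineMap +
      AffineMap.const ℝ _ (w' (Φ₂ e (ContinuousLinearMap.apply ℝ ℝ y))).2
  let S : (F →L[ℝ] ℝ) × (F →L[ℝ] ℝ) →ₗ[ℝ] ℝ :=
    (ContinuousLinearMap.apply ℝ ℝ X₀ : (F →L[ℝ] ℝ) →L[ℝ] ℝ).toLinearMap.comp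
      (LinearMap.snd ℝ _ _)
  refine ⟨i, Q + S.toAffineMap.comp (T.comp ((AffineMap.id ℝ (F →L[ℝ] ℝ)).prod P)), ?_⟩
  intro φ hφ
  have hφ' : φ.1 ∈ A.dom i x := by rw [hφ]; exact hx
  have hA' : HasFDerivAt (a.loc i x) u' (chartAt E x φ.1) := by rw [hφ]; exact hA
  have hX' : HasFDerivAt (SecV.loc X i x) w' (chartAt E x φ.1) := by rw [hφ]; exact hX
  have h1 := iotaSec_locDeriv a hA'
  have h2 := iotaFun_cdiff X hX'
  set ξ := A.dual.qcoord i φ.1 φ.2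
  have he : chartAt E x φ.1 = e := by rw [hφ]
  have hc : A.dual.coord i x φ = (e, ξ) := Prod.ext he rfl
  rw [hc, he] at h1 h2
  have h3 := h φ hφ' (iotaSec a) e ξ _ _ hc
    ((AVSection.phaseCoord_eq_iff (A := A.dual) _ _ _ _ _ _).2 h1)
  rw [Γ.pair_coord (i := i) (x₀ := x) hφ', h2, h3]
  have h4 := hT ξ (P ξ)
  change _ = (ξ (w' _).1 + (w' _).2) + (T (ξ, P ξ)).2 X₀
  rw [h4]
  rfl

theorem cdiff_pull (g : C^∞⟮𝓘(ℝ, E), M; ℝ⟯) {i : A.Idx} {x₀ : M} {b : A.Base}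
    (hb : b.1 ∈ A.dom i x₀) (w : E × F) :
    A.cdiff i x₀ (A.pull g) b w = fderiv ℝ (fun e => g ((chartAt E x₀).symm e))
      (chartAt E x₀ b.1) w.1 := by
  have h1 : DifferentiableAt ℝ (fun e => g ((chartAt E x₀).symm e)) (chartAt E x₀ b.1) :=
    (contDiffAt_comp_chart_symm isOpen_univ g.contMDiff.contMDiffOn (mem_univ _)
      hb.2).differentiableAt (by simp)
  have h2 := h1.hasFDerivAt.comp (A.coord i x₀ b) (hasFDerivAt_fst (𝕜 := ℝ))
  have h3 : A.cdiff i x₀ (A.pull g) b = _ := h2.fderiv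
  rw [h3]
  rfl

theorem AVSection.phaseCoord_add_pull (σ : A.AVSection) (f : C^∞⟮𝓘(ℝ, E), M; ℝ⟯) {i : A.Idx}
    {x₀ : M} {b : A.Base} (hb : b.1 ∈ A.dom i x₀) :
    ((σ.add (A.pull f)).phaseCoord i x₀ b).2 = (σ.phaseCoord i x₀ b).2 := by
  rw [AVSection.phaseCoord_eq, AVSection.phaseCoord_eq]
  dsimp only
  rw [AVSection.locDeriv_add σ _ hb]
  refine ContinuousLinearMap.ext fun w => ?_
  change _ + A.cdiff i x₀ (A.pull f) b (0, w) = _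
  rw [cdiff_pull f hb]
  simp

/-- A function pulled back from M changes p only, and pairing with another such function reads only
ẋ, which is independent of p. -/
theorem AffineTensor.pair_add_pull_pull (Γ : A.AffineTensor) (σ : A.dual.AVSection)
    (f g : C^∞⟮𝓘(ℝ, E), M; ℝ⟯) :
    Γ.pair (σ.add (A.dual.pull f)) (A.dual.pull g) = Γ.pair σ (A.dual.pull g) := by
  ext φ
  have hφ := mem_dom_self (A := A) φ.1
  obtain ⟨Φ₂, Φ₀, hΦ, h⟩ := Γ.isMorphism (A.idx φ.1) φ.1
  rw [Γ.pair_coord (i := A.idx φ.1) (x₀ := φ.1) hφ, Γ.pair_coord (i := A.idx φ.1) (x₀ := φ.1) hφ,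
    cdiff_pull (A := A.dual) (i := A.idx φ.1) (x₀ := φ.1) g hφ,
    cdiff_pull (A := A.dual) (i := A.idx φ.1) (x₀ := φ.1) g hφ]
  have key : ∀ τ : A.dual.AVSection, _ := fun τ => congrArg (fun w => w.2.1)
    (h φ hφ τ (A.dual.coord (A.idx φ.1) φ.1 φ).1 (A.dual.coord (A.idx φ.1) φ.1 φ).2
      (τ.phaseCoord (A := A.dual) (A.idx φ.1) φ.1 φ).1
      (τ.phaseCoord (A := A.dual) (A.idx φ.1) φ.1 φ).2 rfl rfl)
  refine congrArg _ ((key _).trans (Eq.trans ?_ (key _).symm))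
  exact congrArg (Φ₂ _) (AVSection.phaseCoord_add_pull (A := A.dual) (i := A.idx φ.1) (x₀ := φ.1)
    σ f hφ)

/-- The biderivation of an affine tensor. -/
def AffineTensor.toBiderivation (Γ : A.AffineTensor) : A.AffineBiderivation where
  br := Γ.pair
  derivation_left := Γ.exists_derivation_left
  derivation_right := Γ.exists_derivation_right
  affine_closed σ f hσ hf := by
    obtain ⟨a, rfl⟩ := hσ.exists_iotaSec
    obtain ⟨X, rfl⟩ := hf.exists_iotaFun
    exact Γ.pair_iota_isAffineFun a X

theorem AffineTensor.pair_congr {Γ Γ' : A.AffineTensor}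
    (h : ∀ a X, Γ.pair (iotaSec a) (iotaFun X) = Γ'.pair (iotaSec a) (iotaFun X)) : Γ = Γ' := by
  apply AffineTensor.ext
  funext φ
  apply A.dual.sharpAt_injective
  intro q
  obtain ⟨a, rfl⟩ := exists_iotaSec_dd_eq q
  refine (SeparatingDual.eq_iff_forall_dual_eq (R := ℝ)
    (V := E × (F →L[ℝ] ℝ))).2 fun (η : TangentSpace 𝓘(ℝ, E × (F →L[ℝ] ℝ)) φ →L[ℝ] ℝ) => ?_
  obtain ⟨X, rfl⟩ := exists_iotaFun_dfun_eq η
  exact (Γ.pair_apply _ _ _).symm.trans ((congrArg (fun f :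
    C^∞⟮𝓘(ℝ, E × (F →L[ℝ] ℝ)), A.dual.Base; ℝ⟯ => f φ) (h a X)).trans (Γ'.pair_apply _ _ _))

/-- By Hadamard's lemma a biderivation at φ sees its arguments only through their differentials, and
those are realized by some ι_a and ι_X. -/
theorem AffineBiderivation.ext_iota {D D' : A.AffineBiderivation}
    (h : ∀ a X, D.br (iotaSec a) (iotaFun X) = D'.br (iotaSec a) (iotaFun X)) : D = D' := by
  have key : ∀ (D : A.AffineBiderivation) (σ τ : A.dual.AVSection)
      (f g : C^∞⟮𝓘(ℝ, E × (F →L[ℝ] ℝ)), A.dual.Base; ℝ⟯) (φ : A.dual.Base),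
      σ.dd φ = τ.dd φ → A.dual.dfun f φ = A.dual.dfun g φ → D.br σ f φ = D.br τ g φ := by
    intro D σ τ f g φ hσ hf
    obtain ⟨k, rfl⟩ := σ.exists_add τ
    have h1 : D.br σ f φ = D.br σ g φ := by
      obtain ⟨V, hV⟩ := D.derivation_right σ
      rw [hV, hV]
      exact A.dual.derivation_congr_dfun V hf
    obtain ⟨V, hV⟩ := D.derivation_left g
    rw [h1, hV]
    have h2 := (σ.dd_add_eq_iff 0 k φ).1 (by rw [AVSection.add_zero]; exact hσ)
    rw [A.dual.dfun_zero] at h2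
    change _ = D.br σ g φ + V k φ
    rw [A.dual.derivation_eq_zero_of_dfun_eq_zero V h2.symm, add_zero]
  apply AffineBiderivation.ext
  funext σ f
  ext φ
  obtain ⟨a, ha⟩ := exists_iotaSec_dd_eq (σ.dd φ)
  obtain ⟨X, hX⟩ := exists_iotaFun_dfun_eq (A.dual.dfun f φ)
  rw [key D σ (iotaSec a) f (iotaFun X) φ ha.symm hX.symm,
    key D' σ (iotaSec a) f (iotaFun X) φ ha.symm hX.symm, h]

end

/-! ### Derivations as tangent vectors, and smoothness of maps into the tangent bundle of M. -/

section

variable {A} [SigmaCompactSpace M]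

theorem exists_fun_chart (l : E →L[ℝ] ℝ) {x₀ x₁ : M} (hx : x₁ ∈ (chartAt E x₀).source) :
    ∃ g : C^∞⟮𝓘(ℝ, E), M; ℝ⟯, ∀ᶠ x in 𝓝 x₁, g x = l (chartAt E x₀ x) :=
  exists_fun_eventuallyEq (chartAt E x₀).open_source hx
    (l.contDiff.contMDiff.comp_contMDiffOn (contMDiffOn_chart (x := x₀)))

theorem dirDeriv_of_eventually_chart {l : E →L[ℝ] ℝ} {x₀ x : M} (hx : x ∈ (chartAt E x₀).source)
    {g : C^∞⟮𝓘(ℝ, E), M; ℝ⟯} {c : ℝ} (hg : ∀ᶠ z in 𝓝 x, g z = l (chartAt E x₀ z) + c)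
    (w : TangentSpace 𝓘(ℝ, E) x) :
    dirDeriv g x w = l (mfderiv 𝓘(ℝ, E) 𝓘(ℝ, E) (chartAt E x₀) x w) := by
  have h1 : MDifferentiableAt 𝓘(ℝ, E) 𝓘(ℝ, E) (chartAt E x₀) x :=
    ((contMDiffOn_chart (I := 𝓘(ℝ, E)) (n := ∞) (x := x₀)).contMDiffAt
      ((chartAt E x₀).open_source.mem_nhds hx)).mdifferentiableAt (by simp)
  have h2 : HasFDerivAt (fun e => l e + c) l (chartAt E x₀ x) := l.hasFDerivAt.add_const c
  have h3 := h2.hasMFDerivAt.comp x h1.hasMFDerivAt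
  have h4 : HasMFDerivAt 𝓘(ℝ, E) 𝓘(ℝ, ℝ) g x _ := h3.congr_of_eventuallyEq hg
  rw [dirDeriv, h4.mfderiv]
  rfl

theorem dirDeriv_ext {x : M} {w w' : TangentSpace 𝓘(ℝ, E) x}
    (h : ∀ g : C^∞⟮𝓘(ℝ, E), M; ℝ⟯, dirDeriv g x w = dirDeriv g x w') : w = w' := by
  have hx := mem_chart_source E x
  apply mfderiv_chart_injective hx
  refine (SeparatingDual.eq_iff_forall_dual_eq (R := ℝ) (V := E)).2 fun l => ?_
  obtain ⟨g, hg⟩ := exists_fun_chart l hx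
  have hg' : ∀ᶠ z in 𝓝 x, g z = l (chartAt E x z) + 0 := hg.mono fun z hz => by rw [hz, add_zero]
  have h1 := dirDeriv_of_eventually_chart hx hg' w
  have h2 := dirDeriv_of_eventually_chart hx hg' w'
  exact h1.symm.trans ((h g).trans h2)

theorem dirDeriv_add (g : C^∞⟮𝓘(ℝ, E), M; ℝ⟯) (x : M) (w w' : TangentSpace 𝓘(ℝ, E) x) :
    dirDeriv g x (w + w') = dirDeriv g x w + dirDeriv g x w' := map_add _ _ _

theorem dirDeriv_smul (g : C^∞⟮𝓘(ℝ, E), M; ℝ⟯) (x : M) (c : ℝ) (w : TangentSpace 𝓘(ℝ, E) x) :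
    dirDeriv g x (c • w) = c * dirDeriv g x w := map_smul _ _ _

theorem exists_sec_apply_eq {x : M} (c : A.Fib x) : ∃ a : A.Sec, a.1 x = c := by
  obtain ⟨a, ha⟩ := A.exists_sec_eventuallyEq (A.idx x) (A.isOpen_U (A.idx x)) (A.mem_U x)
    (A.mem_U x) (s := fun _ => A.triv (A.idx x) x c) contMDiffOn_const
  exact ⟨a, (A.triv _ x).injective ha.self_of_nhds⟩

theorem exists_secV_apply_eq {x : M} (u : A.Mod x) : ∃ X : A.SecV, X.1 x = u := by
  obtain ⟨X, hX⟩ := A.exists_secV_eventuallyEq (A.idx x) (A.isOpen_U (A.idx x)) (A.mem_U x)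
    (A.mem_U x) (s := fun _ => (A.triv (A.idx x) x).linear u) contMDiffOn_const
  exact ⟨X, (A.triv _ x).linear.injective hX.self_of_nhds⟩

/-- The functional h ↦ D h b vanishes when the differential of h at b does, and all covectors at b
are differentials; so it factors through the cotangent space and is given by a vector. -/
theorem exists_tangent_of_derivation
    (D : Derivation ℝ C^∞⟮𝓘(ℝ, E × F), A.Base; ℝ⟯ C^∞⟮𝓘(ℝ, E × F), A.Base; ℝ⟯)
    [FiniteDimensional ℝ F] (b : A.Base) :
    ∃ w : TangentSpace 𝓘(ℝ, E × F) b, ∀ h, D h b = A.dfun h b w := by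
  have : T2Space (TangentSpace 𝓘(ℝ, E × F) b) := inferInstanceAs (T2Space (E × F))
  refine exists_vector_of_ker_le (fun h => A.dfun h b) ⟨fun h k => A.dfun_add h k b,
    fun c h => dfun_smul c h b⟩ (fun η => ?_) (fun h => D h b) ⟨fun h k => ?_, fun c h => ?_⟩
    fun h hh => A.derivation_eq_zero_of_dfun_eq_zero D hh
  · obtain ⟨L, hL⟩ := cdiff_injective (B := A) (i := A.idx b.1) (x₀ := b.1) (mem_dom_self b.1) η
    obtain ⟨h, hh⟩ := A.exists_cdiff_eq (i := A.idx b.1) (x₀ := b.1) (mem_dom_self b.1) L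
    exact ⟨h, hL h hh⟩
  · rw [map_add]; rfl
  · rw [show D (c • h) = c • D h from D.toLinearMap.map_smul c h]; rfl

/-- A derivation of the functions on `A / ⟨v⟩`, restricted to functions on `M`, is at each point
given by a tangent vector of `M`. -/
theorem exists_dirDeriv_of_derivation
    (D : Derivation ℝ C^∞⟮𝓘(ℝ, E × F), A.Base; ℝ⟯ C^∞⟮𝓘(ℝ, E × F), A.Base; ℝ⟯)
    [FiniteDimensional ℝ F] (b : A.Base) :
    ∃ w : TangentSpace 𝓘(ℝ, E) b.1, ∀ g, D (A.pull g) b = dirDeriv g b.1 w := by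
  obtain ⟨w, hw⟩ := exists_tangent_of_derivation D b
  exact ⟨_, fun g => (hw _).trans (dfun_pull g b w)⟩

theorem contDiffAt_of_forall_dual {K V : Type*} [NormedAddCommGroup K] [NormedSpace ℝ K]
    [NormedAddCommGroup V] [NormedSpace ℝ V] [FiniteDimensional ℝ V] {f : K → V} {k : K}
    (h : ∀ l : V →L[ℝ] ℝ, ContDiffAt ℝ ∞ (fun k => l (f k)) k) : ContDiffAt ℝ ∞ f k := by
  let b := Module.finBasis ℝ V
  have hf : f = fun k => ∑ j, (LinearMap.toContinuousLinearMap (b.coord j)) (f k) • b j := by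
    funext k
    exact (b.sum_repr (f k)).symm
  rw [hf]
  exact ContDiffAt.sum fun j _ => (h _).smul contDiffAt_const

theorem exists_affineMap_of_forall_dual {K V : Type*} [AddCommGroup K] [Module ℝ K]
    [NormedAddCommGroup V] [NormedSpace ℝ V] [FiniteDimensional ℝ V] {f : K → V}
    (h : ∀ l : V →L[ℝ] ℝ, ∃ T : K →ᵃ[ℝ] ℝ, ∀ k, l (f k) = T k) :
    ∃ T : K →ᵃ[ℝ] V, ∀ k, f k = T k := by
  let b := Module.finBasis ℝ V
  choose T hT using fun j => h (LinearMap.toContinuousLinearMap (b.coord j))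
  refine ⟨∑ j, (LinearMap.toSpanSingleton ℝ V (b j)).toAffineMap.comp (T j), fun k => ?_⟩
  have h1 : (∑ j, (LinearMap.toSpanSingleton ℝ V (b j)).toAffineMap.comp (T j)) k =
      ∑ j, T j k • b j := by
    have := map_sum (⟨⟨fun S : K →ᵃ[ℝ] V => S k, rfl⟩, fun _ _ => rfl⟩ : (K →ᵃ[ℝ] V) →+ V)
      (fun j => (LinearMap.toSpanSingleton ℝ V (b j)).toAffineMap.comp (T j)) Finset.univ
    exact this
  rw [h1, ← b.sum_repr (f k)]
  exact Finset.sum_congr rfl fun j _ => congrArg (· • b j) (hT j k)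

/-- Smoothness of a map into the tangent bundle that is affine in a parameter. -/
theorem contMDiffOn_tangent_of_dirDeriv {U : Set M} (hU : IsOpen U) {K : Type*}
    [NormedAddCommGroup K] [NormedSpace ℝ K] [FiniteDimensional ℝ K]
    (l : ∀ x : M, K →ᵃ[ℝ] TangentSpace 𝓘(ℝ, E) x)
    (h : ∀ x₁ ∈ U, ∀ (y : K) (g : C^∞⟮𝓘(ℝ, E), M; ℝ⟯),
      ContMDiffAt 𝓘(ℝ, E) 𝓘(ℝ, ℝ) ∞ (fun x => dirDeriv g x (l x y)) x₁) :
    ContMDiffOn (𝓘(ℝ, E).prod 𝓘(ℝ, K)) 𝓘(ℝ, E).tangent ∞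
      (fun q : M × K => (⟨q.1, l q.1 q.2⟩ : TangentBundle 𝓘(ℝ, E) M)) (U ×ˢ univ) := by
  rintro ⟨x₁, y₁⟩ ⟨hx₁, -⟩
  apply ContMDiffAt.contMDiffWithinAt
  rw [Bundle.contMDiffAt_totalSpace]
  refine ⟨contMDiffAt_fst, ?_⟩
  have hc := mem_chart_source E x₁
  set c := chartAt E x₁ with hcdef
  let k : E → K → E := fun e y => mfderiv 𝓘(ℝ, E) 𝓘(ℝ, E) c (c.symm e) (l (c.symm e) y)
  let s : Set E := c.target ∩ c.symm ⁻¹' U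
  have hs : IsOpen s := c.isOpen_inter_preimage_symm hU
  have h1 : ∀ y, ContDiffOn ℝ ∞ (fun e => k e y) s := by
    intro y e he
    refine ContDiffAt.contDiffWithinAt (contDiffAt_of_forall_dual fun m => ?_)
    have hx : c.symm e ∈ c.source := c.map_target he.1
    obtain ⟨g, hg⟩ := exists_fun_chart m hx
    have h2 : ContMDiffAt 𝓘(ℝ, E) 𝓘(ℝ, ℝ) ∞ (fun x => dirDeriv g x (l x y)) (c.symm e) :=
      h _ he.2 y g
    have h3 : ContMDiffAt 𝓘(ℝ, E) 𝓘(ℝ, E) ∞ c.symm e :=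
      (contMDiffOn_chart_symm (x := x₁)).contMDiffAt (c.open_target.mem_nhds he.1)
    have h4 := (h2.comp e h3).contDiffAt
    refine h4.congr_of_eventuallyEq ?_
    have h5 : ∀ᶠ x in 𝓝 (c.symm e), ∀ᶠ z in 𝓝 x, g z = m (c z) := hg.eventually_nhds
    have h6 := h3.continuousAt.eventually h5
    filter_upwards [h6, c.open_target.mem_nhds he.1] with e' he' he''
    exact (dirDeriv_of_eventually_chart (c := 0) (c.map_target he'')
      (he'.mono fun z hz => by rw [hz, add_zero]) _).symm
  have h2 := contDiffOn_of_affine_right (f := k) h1 fun e _ =>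
    ⟨(mfderiv 𝓘(ℝ, E) 𝓘(ℝ, E) c (c.symm e)).toLinearMap.toAffineMap.comp (l (c.symm e)),
      fun y => rfl⟩
  have h3 : ContMDiffAt (𝓘(ℝ, E).prod 𝓘(ℝ, K)) 𝓘(ℝ, E × K) ∞ (fun q : M × K => (c q.1, q.2))
      (x₁, y₁) := by
    refine ContMDiffAt.prodMk_space ?_ contMDiffAt_snd
    exact ((contMDiffOn_chart (x := x₁)).contMDiffAt (c.open_source.mem_nhds hc)).comp
      (x₁, y₁) contMDiffAt_fst
  have hmem : (c x₁, y₁) ∈ s ×ˢ (univ : Set K) :=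
    ⟨⟨c.map_source hc, by change c.symm (c x₁) ∈ U; rw [c.left_inv hc]; exact hx₁⟩, mem_univ _⟩
  have h4 := ((h2.contDiffAt ((hs.prod isOpen_univ).mem_nhds hmem)).contMDiffAt).comp
    (x₁, y₁) h3
  refine h4.congr_of_eventuallyEq ?_
  have h5 : ∀ᶠ q : M × K in 𝓝 (x₁, y₁), q.1 ∈ c.source :=
    continuousAt_fst.eventually (c.open_source.mem_nhds hc)
  filter_upwards [h5] with q hq
  have h6 := TangentBundle.continuousLinearMapAt_trivializationAt (I := 𝓘(ℝ, E)) (x₀ := x₁)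
    (x := q.1) hq
  have h7 : (trivializationAt E (TangentSpace 𝓘(ℝ, E)) x₁
      (⟨q.1, l q.1 q.2⟩ : TangentBundle 𝓘(ℝ, E) M)).2 =
      mfderiv 𝓘(ℝ, E) 𝓘(ℝ, E) c q.1 (l q.1 q.2) := by
    have := congrArg (fun L : TangentSpace 𝓘(ℝ, E) q.1 →L[ℝ] E => L (l q.1 q.2)) h6
    refine Eq.trans ?_ this
    rw [Bundle.Trivialization.continuousLinearMapAt_apply, Bundle.Trivialization.linearMapAt_apply, if_pos]
    simpa using hq
  refine h7.trans ?_
  change _ = mfderiv 𝓘(ℝ, E) 𝓘(ℝ, E) c (c.symm (c q.1)) (l (c.symm (c q.1)) q.2)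
  have : ∀ x, x = q.1 → (mfderiv 𝓘(ℝ, E) 𝓘(ℝ, E) c q.1 (l q.1 q.2) : E) =
    mfderiv 𝓘(ℝ, E) 𝓘(ℝ, E) c x (l x q.2) := by
    rintro x rfl
    rfl
  exact this _ (c.left_inv hq)

end

/-! ### Anchors from their values on sections, and recognition of pull-backs from M. -/

section

variable {A} [SigmaCompactSpace M]

theorem dirDeriv_sub (g : C^∞⟮𝓘(ℝ, E), M; ℝ⟯) (x : M) (w w' : TangentSpace 𝓘(ℝ, E) x) :
    dirDeriv g x (w - w') = dirDeriv g x w - dirDeriv g x w' := map_sub _ _ _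

theorem vadd_eq_iff {a : A.Sec} {X : A.SecV} {x : M} : (vadd a X).1 x = a.1 x ↔ X.1 x = 0 := by
  constructor
  · intro h
    have h1 : X.1 x +ᵥ a.1 x = (0 : A.Mod x) +ᵥ a.1 x := by rw [zero_vadd]; exact h
    exact vadd_right_cancel _ h1
  · intro h
    change X.1 x +ᵥ a.1 x = _
    rw [h, zero_vadd]

/-- Tested on functions, the value of r at x depends only on X at x, so it descends to the fibre.
Smoothness is checked on sections that are constant in a trivialization. -/
theorem exists_linearAnchor [FiniteDimensional ℝ F] (r : A.SecV → ∀ x : M, TangentSpace 𝓘(ℝ, E) x)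
    (hs : ∀ X (g : C^∞⟮𝓘(ℝ, E), M; ℝ⟯),
      ContMDiff 𝓘(ℝ, E) 𝓘(ℝ, ℝ) ∞ (fun x => dirDeriv g x (r X x)))
    (hr : ∀ (g : C^∞⟮𝓘(ℝ, E), M; ℝ⟯) x, ∃ L : A.SecV →ₗ[ℝ] ℝ,
      (∀ X, dirDeriv g x (r X x) = L X) ∧ ∀ X, X.1 x = 0 → L X = 0) :
    ∃ R : A.LinearAnchor, ∀ X x, R.toFun x (X.1 x) = r X x := by
  choose L hL hL0 using hr
  choose S hS using fun x => fun u : A.Mod x => exists_secV_apply_eq u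
  have key : ∀ X Y x, X.1 x = Y.1 x → r X x = r Y x := by
    intro X Y x h
    apply dirDeriv_ext
    intro g
    rw [hL, hL, ← sub_eq_zero, ← map_sub]
    exact hL0 g x _ (sub_eq_zero.2 h)
  let T : ∀ x, A.Mod x →ₗ[ℝ] TangentSpace 𝓘(ℝ, E) x := fun x =>
    { toFun := fun u => r (S x u) x
      map_add' := fun u u' => by
        apply dirDeriv_ext
        intro g
        rw [key _ (S x u + S x u') x (by
          rw [hS]; change _ = (S x u).1 x + (S x u').1 x; rw [hS, hS]), dirDeriv_add, hL, hL, hL,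
          map_add]
      map_smul' := fun c u => by
        apply dirDeriv_ext
        intro g
        rw [key _ (c • S x u) x (by
          rw [hS]; change _ = c • (S x u).1 x; rw [hS]), RingHom.id_apply, dirDeriv_smul, hL, hL,
          map_smul, smul_eq_mul] }
  have hT : ∀ X x, T x (X.1 x) = r X x := fun X x => key _ _ x (hS x _)
  refine ⟨⟨T, fun i => ?_⟩, hT⟩
  refine contMDiffOn_tangent_of_dirDeriv (A.isOpen_U i)
    (fun x => ((T x).comp (A.triv i x).linear.symm.toLinearMap).toAffineMap) fun x₁ hx₁ y g => ?_
  obtain ⟨X, hX⟩ := A.exists_secV_eventuallyEq i (A.isOpen_U i) hx₁ hx₁ (s := fun _ => y)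
    contMDiffOn_const
  refine (hs X g x₁).congr_of_eventuallyEq (hX.mono fun x hx => ?_)
  dsimp only
  rw [← hT, ← hx]
  change dirDeriv g x (T x ((A.triv i x).linear.symm ((A.triv i x).linear (X.1 x)))) = _
  rw [LinearEquiv.symm_apply_apply]

theorem exists_affineAnchor [FiniteDimensional ℝ F] (l : A.Sec → ∀ x : M, TangentSpace 𝓘(ℝ, E) x)
    (hs : ∀ a (g : C^∞⟮𝓘(ℝ, E), M; ℝ⟯),
      ContMDiff 𝓘(ℝ, E) 𝓘(ℝ, ℝ) ∞ (fun x => dirDeriv g x (l a x)))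
    (hl : ∀ (g : C^∞⟮𝓘(ℝ, E), M; ℝ⟯) x, ∃ L : A.SecV →ₗ[ℝ] ℝ,
      (∀ a X, dirDeriv g x (l (vadd a X) x) = dirDeriv g x (l a x) + L X) ∧
      ∀ X, X.1 x = 0 → L X = 0) :
    ∃ R : A.AffineAnchor, ∀ a x, R.toFun x (a.1 x) = l a x := by
  choose L hL hL0 using hl
  choose S hS using fun x => fun u : A.Mod x => exists_secV_apply_eq u
  choose s hs' using fun x => fun c : A.Fib x => exists_sec_apply_eq c
  obtain ⟨a₀⟩ := A.nonempty_sec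
  have key : ∀ a b x, a.1 x = b.1 x → l a x = l b x := by
    intro a b x h
    obtain ⟨X, rfl⟩ := exists_vadd a b
    apply dirDeriv_ext
    intro g
    rw [hL, hL0 g x X (vadd_eq_iff.1 h.symm), add_zero]
  have keyL : ∀ g x X Y, X.1 x = Y.1 x → L g x X = L g x Y := by
    intro g x X Y h
    rw [← sub_eq_zero, ← map_sub]
    exact hL0 g x _ (sub_eq_zero.2 h)
  have hlin : ∀ g x X, dirDeriv g x (l (vadd a₀ X) x - l a₀ x) = L g x X := by
    intro g x X
    rw [dirDeriv_sub, hL]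
    ring
  let T : ∀ x, A.Mod x →ₗ[ℝ] TangentSpace 𝓘(ℝ, E) x := fun x =>
    { toFun := fun u => l (vadd a₀ (S x u)) x - l a₀ x
      map_add' := fun u u' => by
        apply dirDeriv_ext
        intro g
        rw [dirDeriv_add, hlin, hlin, hlin, ← map_add]
        apply keyL
        rw [hS]; change _ = (S x u).1 x + (S x u').1 x; rw [hS, hS]
      map_smul' := fun c u => by
        apply dirDeriv_ext
        intro g
        rw [RingHom.id_apply, dirDeriv_smul, hlin, hlin, ← smul_eq_mul, ← map_smul]
        apply keyL
        rw [hS]; change _ = c • (S x u).1 x; rw [hS] }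
  let R : ∀ x, A.Fib x →ᵃ[ℝ] TangentSpace 𝓘(ℝ, E) x := fun x =>
    { toFun := fun c => l (s x c) x
      linear := T x
      map_vadd' := fun c u => by
        rw [key _ (vadd (s x c) (S x u)) x (by
          rw [hs']; change _ = (S x u).1 x +ᵥ (s x c).1 x; rw [hS, hs'])]
        apply dirDeriv_ext
        intro g
        rw [hL, vadd_eq_add, dirDeriv_add, add_comm]
        exact congrArg (· + _) (hlin g x _).symm }
  have hR : ∀ a x, R x (a.1 x) = l a x := fun a x => key _ _ x (hs' x _)
  refine ⟨⟨R, fun i => ?_⟩, hR⟩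
  refine contMDiffOn_tangent_of_dirDeriv (A.isOpen_U i)
    (fun x => (R x).comp (A.triv i x).symm.toAffineMap) fun x₁ hx₁ y g => ?_
  obtain ⟨a, ha⟩ := A.exists_sec_eventuallyEq i (A.isOpen_U i) hx₁ hx₁ (s := fun _ => y)
    contMDiffOn_const
  refine (hs a g x₁).congr_of_eventuallyEq (ha.mono fun x hx => ?_)
  dsimp only
  rw [← hR, ← hx]
  change dirDeriv g x (R x ((A.triv i x).symm (A.triv i x (a.1 x)))) = _
  rw [AffineEquiv.symm_apply_apply]

variable [FiniteDimensional ℝ F]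

theorem cdiff_pull_of_eventually_chart {l : E →L[ℝ] ℝ} {i : A.Idx} {x₀ : M} {b : A.Base}
    (hb : b.1 ∈ A.dom i x₀) {g : C^∞⟮𝓘(ℝ, E), M; ℝ⟯}
    (hg : ∀ᶠ z in 𝓝 b.1, g z = l (chartAt E x₀ z)) :
    A.cdiff i x₀ (A.pull g) b = l.coprod 0 := by
  refine ContinuousLinearMap.ext fun w => ?_
  rw [cdiff_pull g hb, (eventually_loc (s := fun e => l e) hb.2 hg).fderiv_eq, l.fderiv]
  simp

theorem SecV.loc_chart (X : A.SecV) (i : A.Idx) {x₀ x : M} (hx : x ∈ (chartAt E x₀).source) :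
    SecV.loc X i x₀ (chartAt E x₀ x) = (A.triv i x).linear (X.1 x) := by
  have : ∀ z, z = x → (A.triv i z).linear (X.1 z) = (A.triv i x).linear (X.1 x) := by
    rintro z rfl
    rfl
  exact this _ ((chartAt E x₀).left_inv hx)

/-- Where X vanishes the fibre derivative of ι_X vanishes too, and the rest of its differential is a
covector of M. This reduces the tensoriality of the anchors to the behaviour of the bracket on
pull-backs. -/
theorem exists_dfun_iotaFun_eq_pull (X : A.SecV) {φ : A.dual.Base} (hX : X.1 φ.1 = 0) :
    ∃ h : C^∞⟮𝓘(ℝ, E), M; ℝ⟯, A.dual.dfun (iotaFun X) φ = A.dual.dfun (A.dual.pull h) φ := by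
  have hφ := mem_dom_self (A := A) φ.1
  set i := A.idx φ.1
  have h1 := iotaFun_cdiff X (φ := φ) (SecV.differentiableAt_loc X hφ).hasFDerivAt
  have h2 : SecV.loc X i φ.1 (chartAt E φ.1 φ.1) = 0 := by
    rw [SecV.loc_chart X i (mem_chart_source E φ.1), hX, map_zero]
  rw [h2, Prod.fst_zero, map_zero] at h1
  obtain ⟨g, hg⟩ := exists_fun_chart (((A.dual.coord i φ.1 φ).2.comp
      ((ContinuousLinearMap.fst ℝ F ℝ).comp (fderiv ℝ (SecV.loc X i φ.1) (chartAt E φ.1 φ.1))) +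
        (ContinuousLinearMap.snd ℝ F ℝ).comp (fderiv ℝ (SecV.loc X i φ.1) (chartAt E φ.1 φ.1))))
    (mem_chart_source E φ.1)
  exact ⟨g, (A.dual.dfun_eq_iff (i := i) (x₀ := φ.1) hφ _ _).2 (h1.trans
    (cdiff_pull_of_eventually_chart (A := A.dual) (i := i) hφ hg).symm)⟩

/-- If the F-component u of Z were nonzero at some x, multiplying by ι_Y with Y = (u, 0) would
produce a genuinely quadratic function on the fibre. So Z is a multiple of v_A, and ι_Z is its
coefficient. -/
theorem exists_pull_eq_of_mul_isAffineFun {Z : A.SecV}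
    (hZ : ∀ Y : A.SecV, A.dual.IsAffineFun (iotaFun Y * iotaFun Z)) :
    ∃ h : C^∞⟮𝓘(ℝ, E), M; ℝ⟯, iotaFun Z = A.dual.pull h := by
  have h1 : ∀ x, ((A.triv (A.idx x) x).linear (Z.1 x)).1 = 0 := by
    intro x
    by_contra hu
    set i := A.idx x
    set u := ((A.triv i x).linear (Z.1 x)).1
    set c := ((A.triv i x).linear (Z.1 x)).2
    obtain ⟨Y, hY⟩ := exists_secV_apply_eq ((A.triv i x).linear.symm (u, 0))
    obtain ⟨T, hT⟩ := (hZ Y).exists_qcoord (A := A.dual) i x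
    have h2 : ∀ ξ : F →L[ℝ] ℝ, ξ u * (ξ u + c) = T ξ := by
      intro ξ
      have h3 := hT ⟨x, A.dual.qinv i x ξ⟩ rfl
      have h4 : A.linPart (Y.1 x) (A.dual.qinv i x ξ) = ξ u := by
        rw [linPart_qinv, hY, LinearEquiv.apply_symm_apply, add_zero]
      have h5 : A.linPart (Z.1 x) (A.dual.qinv i x ξ) = ξ u + c := linPart_qinv i x _ ξ
      have h6 : A.linPart (Y.1 x) (A.dual.qinv i x ξ) * A.linPart (Z.1 x) (A.dual.qinv i x ξ) =
        T (A.dual.qcoord i x (A.dual.qinv i x ξ)) := h3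
      rw [h4, h5] at h6
      exact h6.trans (congrArg T (A.dual.qcoord_qinv i x ξ))
    -- With ξ(u) = 1 the product takes the values 1 + c, 1 - c and 0 at ξ, -ξ and 0, whereas an
    -- affine T satisfies T(ξ) + T(-ξ) = 2 T(0).
    obtain ⟨ξ, hξ⟩ := SeparatingDual.exists_eq_one (R := ℝ) hu
    have h3 := h2 ξ
    have h4 := h2 (-ξ)
    have h5 := h2 0
    have h6 : ∀ ξ, T ξ = T.linear ξ + T 0 := fun ξ => congrFun T.decomp ξ
    rw [h6] at h3 h4
    rw [map_neg] at h4
    simp only [hξ, neg_apply, zero_apply, zero_mul] at h3 h4 h5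
    rw [← h5] at h3 h4
    linarith
  have h2 : ∀ x, Z.1 x = ((A.triv (A.idx x) x).linear (Z.1 x)).2 • A.v x := by
    intro x
    apply (A.triv (A.idx x) x).linear.injective
    rw [map_smul, A.triv_v]
    refine Prod.ext ?_ ?_
    · rw [h1]; simp
    · simp
  have h3 : ContMDiff 𝓘(ℝ, E) 𝓘(ℝ, ℝ) ∞
      (fun x => ((A.triv (A.idx x) x).linear (Z.1 x)).2) := by
    intro x₁
    have h4 : ContMDiffOn 𝓘(ℝ, E) 𝓘(ℝ, ℝ) ∞
        (fun x => ((A.triv (A.idx x₁) x).linear (Z.1 x)).2) (A.U (A.idx x₁)) :=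
      contDiff_snd.contMDiff.comp_contMDiffOn (Z.2 (A.idx x₁))
    refine (h4.congr fun x _ => ?_).contMDiffAt ((A.isOpen_U _).mem_nhds (A.mem_U x₁))
    conv_rhs => rw [h2 x, map_smul, A.triv_v]
    simp
  refine ⟨⟨_, h3⟩, ?_⟩
  ext φ
  rw [iotaFun_apply, h2, linPart_smul, linPart_v, mul_one]
  rfl

end

/-! ### From an affine-closed biderivation to a bracket with anchors. -/

section

variable {A} [SigmaCompactSpace M] [FiniteDimensional ℝ F]

theorem fun_add_apply (f g : C^∞⟮𝓘(ℝ, E × F), A.Base; ℝ⟯) (b : A.Base) :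
    (f + g) b = f b + g b := rfl

theorem fun_smul_apply (c : ℝ) (f : C^∞⟮𝓘(ℝ, E × F), A.Base; ℝ⟯) (b : A.Base) :
    (c • f) b = c * f b := rfl

theorem derivation_smul
    (D : Derivation ℝ C^∞⟮𝓘(ℝ, E × F), A.Base; ℝ⟯ C^∞⟮𝓘(ℝ, E × F), A.Base; ℝ⟯) (c : ℝ)
    (h : C^∞⟮𝓘(ℝ, E × F), A.Base; ℝ⟯) : D (c • h) = c • D h := D.toLinearMap.map_smul c h

namespace AffineBiderivation

theorem exists_iotaFun_eq (D : A.AffineBiderivation) (a : A.Sec) (X : A.SecV) :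
    ∃ Z : A.SecV, iotaFun Z = D.br (iotaSec a) (iotaFun X) := by
  obtain ⟨Z, hZ⟩ := (D.affine_closed _ _ (iotaSec_isAffine a) (iotaFun_isAffineFun X)).exists_iotaFun
  exact ⟨Z, hZ.symm⟩

theorem pull_eq_iotaFun (g : C^∞⟮𝓘(ℝ, E), M; ℝ⟯) :
    A.dual.pull g = iotaFun (smulV g A.vSec) := by
  rw [iotaFun_smulV, iotaFun_vSec, mul_one]

/-- The Leibniz rule writes ι_Y {ι_a, g} as the affine function {ι_a, g ι_Y} - g {ι_a, ι_Y} for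
every Y. Hence {ι_a, g} is pulled back from M, and as a derivation in g it is given by tangent
vectors. -/
theorem exists_left (D : A.AffineBiderivation) (a : A.Sec) :
    ∃ l : ∀ x : M, TangentSpace 𝓘(ℝ, E) x, ∀ g : C^∞⟮𝓘(ℝ, E), M; ℝ⟯,
      ContMDiff 𝓘(ℝ, E) 𝓘(ℝ, ℝ) ∞ (fun x => dirDeriv g x (l x)) ∧
      ∀ φ, D.br (iotaSec a) (A.dual.pull g) φ = dirDeriv g φ.1 (l φ.1) := by
  obtain ⟨V, hV⟩ := D.derivation_right (iotaSec a)
  have h1 : ∀ g, ∃ h, D.br (iotaSec a) (A.dual.pull g) = A.dual.pull h := by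
    intro g
    obtain ⟨Z, hZ⟩ := D.exists_iotaFun_eq a (smulV g A.vSec)
    rw [← pull_eq_iotaFun] at hZ
    rw [← hZ]
    apply exists_pull_eq_of_mul_isAffineFun
    intro Y
    obtain ⟨Z₁, hZ₁⟩ := D.exists_iotaFun_eq a (smulV g Y)
    obtain ⟨Z₂, hZ₂⟩ := D.exists_iotaFun_eq a Y
    have h2 : iotaFun Y * iotaFun Z = iotaFun (Z₁ - smulV g Z₂) := by
      rw [iotaFun_sub, iotaFun_smulV, hZ, hZ₁, hZ₂, iotaFun_smulV, hV, hV, hV, Derivation.leibniz]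
      simp only [smul_eq_mul]
      ring
    rw [h2]
    exact iotaFun_isAffineFun _
  choose h hh using h1
  -- Any point of the fibre over x would do, since the value of V on a pull-back is constant along
  -- fibres; the point with coordinate ξ = 0 is taken.
  choose l hl using fun x => exists_dirDeriv_of_derivation (A := A.dual) V
    (A.dual.qpoint (A.idx x) 0 x)
  have h2 : ∀ g x, h g x = dirDeriv g x (l x) := by
    intro g x
    refine Eq.trans ?_ (hl x g)
    rw [← hV, hh]
    rfl
  refine ⟨l, fun g => ⟨?_, fun φ => ?_⟩⟩
  · exact (h g).contMDiff.congr fun x => (h2 g x).symm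
  · rw [← h2, hh]
    rfl

/-- The argument of `exists_left`, applied to the linear part W of {·, ι_Y}. The anchor is taken
from -W because it enters the second Leibniz rule with a minus sign. -/
theorem exists_right (D : A.AffineBiderivation) (Y : A.SecV) :
    ∃ r : ∀ x : M, TangentSpace 𝓘(ℝ, E) x, ∀ f : C^∞⟮𝓘(ℝ, E), M; ℝ⟯,
      ContMDiff 𝓘(ℝ, E) 𝓘(ℝ, ℝ) ∞ (fun x => dirDeriv f x (r x)) ∧
      ∀ σ φ, D.br (σ.add (A.dual.pull f)) (iotaFun Y) φ =
        D.br σ (iotaFun Y) φ - dirDeriv f φ.1 (r φ.1) := by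
  obtain ⟨W, hW⟩ := D.derivation_left (iotaFun Y)
  obtain ⟨a⟩ := A.nonempty_sec
  have h0 : ∀ X, ∃ Z, iotaFun Z = W (iotaFun X) := by
    intro X
    obtain ⟨Z₁, hZ₁⟩ := D.exists_iotaFun_eq (vadd a X) Y
    obtain ⟨Z₂, hZ₂⟩ := D.exists_iotaFun_eq a Y
    refine ⟨Z₁ - Z₂, ?_⟩
    rw [iotaFun_sub, hZ₁, hZ₂, iotaSec_vadd, hW]
    ring
  have h1 : ∀ f, ∃ h, W (A.dual.pull f) = A.dual.pull h := by
    intro f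
    obtain ⟨Z, hZ⟩ := h0 (smulV f A.vSec)
    rw [← pull_eq_iotaFun] at hZ
    rw [← hZ]
    apply exists_pull_eq_of_mul_isAffineFun
    intro X
    obtain ⟨Z₁, hZ₁⟩ := h0 (smulV f X)
    obtain ⟨Z₂, hZ₂⟩ := h0 X
    have h2 : iotaFun X * iotaFun Z = iotaFun (Z₁ - smulV f Z₂) := by
      rw [iotaFun_sub, iotaFun_smulV, hZ, hZ₁, hZ₂, iotaFun_smulV, Derivation.leibniz]
      simp only [smul_eq_mul]
      ring
    rw [h2]
    exact iotaFun_isAffineFun _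
  choose h hh using h1
  choose r hr using fun x => exists_dirDeriv_of_derivation (A := A.dual) (-W)
    (A.dual.qpoint (A.idx x) 0 x)
  have h2 : ∀ f x, -h f x = dirDeriv f x (r x) := by
    intro f x
    refine Eq.trans ?_ (hr x f)
    rw [Derivation.neg_apply, hh]
    rfl
  refine ⟨r, fun f => ⟨?_, fun σ φ => ?_⟩⟩
  · exact (-h f).contMDiff.congr fun x => (h2 f x).symm
  · rw [← h2, hW, hh]
    change _ + h f φ.1 = _ - -h f φ.1
    ring

/-- The condition H says that the linear part of {·, g} kills pull-backs. The differential of ι_X is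
that of a pull-back where X vanishes, so {ι_a, g} at x depends only on a at x. -/
theorem exists_left_anchor (D : A.AffineBiderivation)
    (H : ∀ σ (f g : C^∞⟮𝓘(ℝ, E), M; ℝ⟯),
      D.br (σ.add (A.dual.pull f)) (A.dual.pull g) = D.br σ (A.dual.pull g)) :
    ∃ Λ : A.AffineAnchor, ∀ a (g : C^∞⟮𝓘(ℝ, E), M; ℝ⟯) φ,
      D.br (iotaSec a) (A.dual.pull g) φ = dirDeriv g φ.1 (Λ.toFun φ.1 (a.1 φ.1)) := by
  choose W hW using D.derivation_left
  choose l hl using D.exists_left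
  obtain ⟨a₀⟩ := A.nonempty_sec
  let q : ∀ x : M, A.dual.Base := fun x => A.dual.qpoint (A.idx x) 0 x
  have hWpull : ∀ f g, W (A.dual.pull g) (A.dual.pull f) = 0 := by
    intro f g
    have h1 := hW (A.dual.pull g) (iotaSec a₀) (A.dual.pull f)
    rw [H] at h1
    exact left_eq_add.1 h1
  obtain ⟨Λ, hΛ⟩ := exists_affineAnchor l (fun a g => (hl a g).1) (by
    intro g x
    refine ⟨⟨⟨fun X => W (A.dual.pull g) (iotaFun X) (q x), fun X Y => ?_⟩, fun c X => ?_⟩, ?_, ?_⟩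
    · rw [iotaFun_add, map_add]; rfl
    · dsimp only
      rw [iotaFun_smul, derivation_smul]; rfl
    · intro a X
      have h1 := (hl (vadd a X) g).2 (q x)
      have h2 := (hl a g).2 (q x)
      rw [iotaSec_vadd, hW] at h1
      exact h1.symm.trans (congrArg (· + W (A.dual.pull g) (iotaFun X) (q x)) h2)
    · intro X hX
      obtain ⟨h, hh⟩ := exists_dfun_iotaFun_eq_pull X (φ := q x) hX
      change W (A.dual.pull g) (iotaFun X) (q x) = 0
      rw [A.dual.derivation_congr_dfun _ hh, hWpull]
      rfl)
  exact ⟨Λ, fun a g φ => by rw [hΛ]; exact (hl a g).2 φ⟩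

theorem exists_right_anchor (D : A.AffineBiderivation)
    (H : ∀ σ (f g : C^∞⟮𝓘(ℝ, E), M; ℝ⟯),
      D.br (σ.add (A.dual.pull f)) (A.dual.pull g) = D.br σ (A.dual.pull g)) :
    ∃ R : A.LinearAnchor, ∀ Y (f : C^∞⟮𝓘(ℝ, E), M; ℝ⟯) σ φ,
      D.br (σ.add (A.dual.pull f)) (iotaFun Y) φ =
        D.br σ (iotaFun Y) φ - dirDeriv f φ.1 (R.toFun φ.1 (Y.1 φ.1)) := by
  choose V hV using D.derivation_right
  choose r hr using D.exists_right
  obtain ⟨a₀⟩ := A.nonempty_sec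
  let q : ∀ x : M, A.dual.Base := fun x => A.dual.qpoint (A.idx x) 0 x
  obtain ⟨R, hR⟩ := exists_linearAnchor r (fun a g => (hr a g).1) (by
    intro f x
    have h1 : ∀ Y, dirDeriv f x (r Y x) = V (iotaSec a₀) (iotaFun Y) (q x) -
        V ((iotaSec a₀).add (A.dual.pull f)) (iotaFun Y) (q x) := by
      intro Y
      have h1 := (hr Y f).2 (iotaSec a₀) (q x)
      rw [hV, hV] at h1
      change _ = _ - dirDeriv f x (r Y x) at h1
      linarith
    have h0 : ∀ Y, Y.1 x = 0 → dirDeriv f x (r Y x) = 0 := by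
      intro Y hY
      obtain ⟨h, hh⟩ := exists_dfun_iotaFun_eq_pull Y (φ := q x) hY
      have h2 : ∀ σ, V σ (iotaFun Y) (q x) = D.br σ (A.dual.pull h) (q x) := fun σ => by
        rw [hV]
        exact A.dual.derivation_congr_dfun _ hh
      rw [h1, h2, h2, H, sub_self]
    refine ⟨⟨⟨fun Y => dirDeriv f x (r Y x), fun X Y => ?_⟩, fun c X => ?_⟩, fun X => rfl, h0⟩
    · rw [h1, h1, h1, iotaFun_add, map_add, map_add]
      rw [fun_add_apply, fun_add_apply]
      ring
    · dsimp only
      rw [h1, h1, iotaFun_smul, derivation_smul, derivation_smul, fun_smul_apply, fun_smul_apply,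
        RingHom.id_apply, smul_eq_mul]
      ring)
  exact ⟨R, fun Y f σ φ => by rw [hR]; exact (hr Y f).2 σ φ⟩

/-- All axioms are read off after applying the injective map X ↦ ι_X. Multiplication of X by g
becomes multiplication by a pull-back, so the two derivation properties turn into the Leibniz rules;
ι of v_A is the constant 1, so derivations kill it and the bracket is special. -/
theorem exists_bracket (D : A.AffineBiderivation)
    (H : ∀ σ (f g : C^∞⟮𝓘(ℝ, E), M; ℝ⟯),
      D.br (σ.add (A.dual.pull f)) (A.dual.pull g) = D.br σ (A.dual.pull g)) :
    ∃ B : A.SpecialAffgebroidBracket,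
      ∀ a X, iotaFun (B.bracket a X) = D.br (iotaSec a) (iotaFun X) := by
  choose br hbr using D.exists_iotaFun_eq
  choose V hV using D.derivation_right
  choose W hW using D.derivation_left
  obtain ⟨Λ, hl⟩ := D.exists_left_anchor H
  obtain ⟨R, hr⟩ := D.exists_right_anchor H
  obtain ⟨a₀⟩ := A.nonempty_sec
  have hWr : ∀ Y f φ, W (iotaFun Y) (A.dual.pull f) φ =
      -dirDeriv f φ.1 (R.toFun φ.1 (Y.1 φ.1)) := by
    intro Y f φ
    have h1 := hr Y f (iotaSec a₀) φ
    rw [hW, fun_add_apply] at h1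
    linarith
  refine ⟨⟨br, Λ, R, fun a => ⟨fun X Y => ?_, fun c X => ?_⟩, fun Y => ?_, fun a X => ?_,
    fun a X => ?_, fun a g Y x => ?_, fun a f X Y x => ?_⟩, hbr⟩
  · apply iotaFun_injective
    rw [iotaFun_add, hbr, hbr, hbr, iotaFun_add, hV, hV, hV, map_add]
  · apply iotaFun_injective
    rw [iotaFun_smul, hbr, hbr, iotaFun_smul, hV, hV, derivation_smul]
  · have h1 : ∀ a X, iotaFun (br (vadd a X) Y - br a Y) = W (iotaFun Y) (iotaFun X) := by
      intro a X
      rw [iotaFun_sub, hbr, hbr, iotaSec_vadd, hW]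
      ring
    refine ⟨⟨⟨fun X => br (vadd a₀ X) Y - br a₀ Y, fun X Z => ?_⟩, fun c X => ?_⟩, fun a X => ?_⟩
    · apply iotaFun_injective
      rw [iotaFun_add, h1, h1, h1, iotaFun_add, map_add]
    · apply iotaFun_injective
      rw [RingHom.id_apply, iotaFun_smul, h1, h1, iotaFun_smul, derivation_smul]
    · apply iotaFun_injective
      change _ = iotaFun (br a Y + (br (vadd a₀ X) Y - br a₀ Y))
      rw [iotaFun_add, h1, hbr, hbr, iotaSec_vadd, hW]
  · apply iotaFun_injective
    rw [hbr, hbr, iotaFun_add, iotaFun_vSec, hV, hV, map_add, Derivation.map_one_eq_zero, add_zero]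
  · apply iotaFun_injective
    rw [hbr, hbr, iotaSec_vadd, iotaFun_vSec, hW, Derivation.map_one_eq_zero, add_zero]
  · apply linPart_injective
    intro ψ
    rw [linPart_add, linPart_smul, linPart_smul]
    let φ : A.dual.Base := ⟨x, ψ⟩
    have h1 : iotaFun (br a (smulV g Y)) φ = g x * iotaFun (br a Y) φ +
        dirDeriv g x (Λ.toFun x (a.1 x)) * iotaFun Y φ := by
      rw [hbr, hbr, iotaFun_smulV, hV, Derivation.leibniz, ← hV, ← hV]
      have h2 := hl a g φ
      change A.dual.pull g φ * _ + iotaFun Y φ * D.br (iotaSec a) (A.dual.pull g) φ = _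
      rw [h2, mul_comm (iotaFun Y φ)]
      rfl
    exact h1
  · apply linPart_injective
    intro ψ
    let φ : A.dual.Base := ⟨x, ψ⟩
    rw [sub_eq_add_neg, ← neg_smul, linPart_add, linPart_add, linPart_smul, linPart_smul,
      linPart_smul]
    have h1 : iotaFun (br (vadd a (smulV f X)) Y) φ = (1 - f x) * iotaFun (br a Y) φ +
        f x * iotaFun (br (vadd a X) Y) φ +
        -dirDeriv f x (R.toFun x (Y.1 x)) * iotaFun X φ := by
      rw [hbr, hbr, hbr, iotaSec_vadd, iotaSec_vadd, iotaFun_smulV, hW, hW, Derivation.leibniz]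
      have h2 := hWr Y f φ
      change _ + (f x * W (iotaFun Y) (iotaFun X) φ +
        iotaFun X φ * W (iotaFun Y) (A.dual.pull f) φ) =
        _ * _ + f x * (_ + W (iotaFun Y) (iotaFun X) φ) + _
      rw [h2]
      change _ + (_ + _ * -dirDeriv f x (R.toFun x (Y.1 x))) = _
      ring
    exact h1

/-- Let W be the linear part of {·, g}. By `exists_left` each W(ι_X) is constant along fibres. Apply
this to f X: in f W(ι_X) + ι_X W(f) everything but ι_X is constant along the fibre, and for F
nonzero X can be chosen with ι_X nonconstant there. This forces W(f) = 0. -/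
theorem br_add_pull_pull [Nontrivial F] (D : A.AffineBiderivation) (σ : A.dual.AVSection)
    (f g : C^∞⟮𝓘(ℝ, E), M; ℝ⟯) :
    D.br (σ.add (A.dual.pull f)) (A.dual.pull g) = D.br σ (A.dual.pull g) := by
  obtain ⟨W, hW⟩ := D.derivation_left (A.dual.pull g)
  obtain ⟨a⟩ := A.nonempty_sec
  choose l hl using D.exists_left
  have h1 : ∀ X φ φ', φ.1 = φ'.1 → W (iotaFun X) φ = W (iotaFun X) φ' := by
    have h2 : ∀ X (φ : A.dual.Base), W (iotaFun X) φ =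
        dirDeriv g φ.1 (l (vadd a X) φ.1) - dirDeriv g φ.1 (l a φ.1) := by
      intro X φ
      rw [← (hl (vadd a X) g).2 φ, ← (hl a g).2 φ, iotaSec_vadd, hW, fun_add_apply]
      ring
    rintro X ⟨x, φ⟩ ⟨x', φ'⟩ h
    obtain rfl : x = x' := h
    exact (h2 X ⟨x, φ⟩).trans (h2 X ⟨x, φ'⟩).symm
  rw [hW]
  have h3 : W (A.dual.pull f) = 0 := by
    ext φ
    obtain ⟨u, hu⟩ := exists_ne (0 : F)
    obtain ⟨ξ, hξ⟩ := SeparatingDual.exists_eq_one (R := ℝ) hu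
    let i := A.idx φ.1
    obtain ⟨X, hX⟩ := exists_secV_apply_eq ((A.triv i φ.1).linear.symm (u, 0))
    let p : (F →L[ℝ] ℝ) → A.dual.Base := fun ξ => ⟨φ.1, A.dual.qinv i φ.1 ξ⟩
    have h4 : ∀ ξ, iotaFun X (p ξ) = ξ u := by
      intro ξ
      have : A.linPart (X.1 φ.1) (A.dual.qinv i φ.1 ξ) = ξ u := by
        rw [linPart_qinv, hX, LinearEquiv.apply_symm_apply, add_zero]
      exact this
    have h5 := h1 (smulV f X) (p ξ) (p 0) rfl
    have h6 := h1 X (p ξ) (p 0) rfl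
    rw [iotaFun_smulV, Derivation.leibniz] at h5
    change f φ.1 * W (iotaFun X) (p ξ) + iotaFun X (p ξ) * W (A.dual.pull f) (p ξ) =
      f φ.1 * W (iotaFun X) (p 0) + iotaFun X (p 0) * W (A.dual.pull f) (p 0) at h5
    rw [h4, h4, h6, hξ, zero_apply, zero_mul, one_mul, add_zero, add_eq_left,
      AffineBiderivation.pull_eq_iotaFun] at h5
    rw [AffineBiderivation.pull_eq_iotaFun, h1 _ φ (p ξ) rfl, h5]
    rfl
  rw [h3, add_zero]

end AffineBiderivation

end

/-! ### First order operators on sections of V(A) depend only on differentials. -/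

section

variable {A} [SigmaCompactSpace M] [FiniteDimensional ℝ F]

theorem dfun_one (b : A.Base) : A.dfun 1 b = 0 := by
  have h := A.dfun_mul 1 1 b
  rw [mul_one] at h
  change _ = (1 : ℝ) • _ + (1 : ℝ) • _ at h
  rw [one_smul] at h
  exact left_eq_add.1 h

/-- The usual argument: a bump function shows that Q depends only on the germ at x₁, and near x₁ the
section is a combination of a local frame, completed by v_A, with coefficients vanishing at x₁. -/
theorem eq_zero_of_tensorial {Q : A.SecV →ₗ[ℝ] ℝ} {x₁ : M}
    (hQ : ∀ (f : C^∞⟮𝓘(ℝ, E), M; ℝ⟯) (Y : A.SecV), Q (smulV f Y) = f x₁ * Q Y) {X : A.SecV}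
    (hX : X.1 x₁ = 0) : Q X = 0 := by
  have hloc : ∀ Y : A.SecV, (∀ᶠ x in 𝓝 x₁, Y.1 x = 0) → Q Y = 0 := by
    intro Y hY
    obtain ⟨χ, h1, h2⟩ := exists_bump (E := E) hY
    have h3 : smulV χ Y = 0 := by
      apply Subtype.ext
      funext x
      change χ x • Y.1 x = 0
      by_cases hx : x ∈ tsupport χ
      · rw [show Y.1 x = 0 from h2 hx, smul_zero]
      · rw [image_eq_zero_of_notMem_tsupport hx, zero_smul]
    have h4 := hQ χ Y
    rw [h3, map_zero, h1.self_of_nhds, one_mul] at h4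
    exact h4.symm
  set i := A.idx x₁
  let b := Module.finBasis ℝ F
  choose e he using fun k => A.exists_secV_eventuallyEq i (A.isOpen_U i) (A.mem_U x₁) (A.mem_U x₁)
    (s := fun _ => (b k, 0)) contMDiffOn_const
  have h1 : ContMDiffOn 𝓘(ℝ, E) 𝓘(ℝ, F) ∞ (fun x => ((A.triv i x).linear (X.1 x)).1) (A.U i) :=
    contDiff_fst.contMDiff.comp_contMDiffOn (X.2 i)
  have h2 : ContMDiffOn 𝓘(ℝ, E) 𝓘(ℝ, ℝ) ∞ (fun x => ((A.triv i x).linear (X.1 x)).2) (A.U i) :=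
    contDiff_snd.contMDiff.comp_contMDiffOn (X.2 i)
  choose u hu using fun k => exists_fun_eventuallyEq (A.isOpen_U i) (A.mem_U x₁)
    ((LinearMap.toContinuousLinearMap (b.coord k)).contDiff.contMDiff.comp_contMDiffOn h1)
  obtain ⟨c, hc⟩ := exists_fun_eventuallyEq (A.isOpen_U i) (A.mem_U x₁) h2
  have h3 : Q (X - (∑ k, smulV (u k) (e k) + smulV c A.vSec)) = 0 := by
    apply hloc
    filter_upwards [Filter.eventually_all.2 he, Filter.eventually_all.2 hu, hc] with x he hu hc
    apply (A.triv i x).linear.injective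
    have h4 : (∑ k, smulV (u k) (e k) : A.SecV).1 x = ∑ k, u k x • (e k).1 x := by
      rw [AddSubmonoidClass.coe_finsetSum, Finset.sum_apply]
      rfl
    have h5 : (X - (∑ k, smulV (u k) (e k) + smulV c A.vSec)).1 x =
        X.1 x - (∑ k, u k x • (e k).1 x + c x • A.v x) := by
      rw [← h4]
      rfl
    rw [h5, map_zero, map_sub, map_add, map_sum, map_smul, A.triv_v, sub_eq_zero, hc]
    simp only [map_smul, he, hu]
    refine Prod.ext ?_ ?_
    · rw [Prod.fst_add, Prod.fst_sum]
      simp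
    · rw [Prod.snd_add, Prod.snd_sum]
      simp
  have hu0 : ∀ k, u k x₁ = 0 := by
    intro k
    rw [(hu k).self_of_nhds]
    simp [hX]
  have hc0 : c x₁ = 0 := by
    rw [hc.self_of_nhds]
    simp [hX]
  rw [map_sub, map_add, map_sum, hQ, hc0, zero_mul, add_zero, sub_eq_zero] at h3
  rw [h3]
  exact Finset.sum_eq_zero fun k _ => by rw [hQ, hu0, zero_mul]

theorem exists_mfderiv_fst_eq (b : A.Base) (w : TangentSpace 𝓘(ℝ, E) b.1) :
    ∃ z₁ : TangentSpace 𝓘(ℝ, E × F) b,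
      mfderiv 𝓘(ℝ, E × F) 𝓘(ℝ, E) (fun c : A.Base => c.1) b z₁ = w := by
  have hb := mem_dom_self (A := A) b.1
  obtain ⟨e, he⟩ := A.exists_coord_equiv (i := A.idx b.1) (x₀ := b.1) hb
  let w' : E × F := (mfderiv 𝓘(ℝ, E) 𝓘(ℝ, E) (chartAt E b.1) b.1 w, 0)
  refine ⟨e.symm w', mfderiv_chart_injective hb.2 ?_⟩
  refine (mfderiv_chart_fst (A := A) (i := A.idx b.1) (x₀ := b.1) hb _).trans ?_
  rw [← he, LinearEquiv.apply_symm_apply]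

theorem exists_smul_v_of_dfun_iotaFun_eq_zero {X : A.SecV} {φ : A.dual.Base}
    (h : A.dual.dfun (iotaFun X) φ = 0) : ∃ c : ℝ, X.1 φ.1 = c • A.v φ.1 := by
  have hφ := mem_dom_self (A := A) φ.1
  set i := A.idx φ.1
  have h1 := iotaFun_cdiff X (φ := φ) (SecV.differentiableAt_loc X hφ).hasFDerivAt
  rw [SecV.loc_chart X i (mem_chart_source E φ.1)] at h1
  have h2 : A.dual.cdiff i φ.1 (iotaFun X) φ = A.dual.cdiff i φ.1 (iotaFun (0 : A.SecV)) φ := by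
    refine (A.dual.dfun_eq_iff (i := i) (x₀ := φ.1) hφ _ _).1 ?_
    rw [h, iotaFun_zero, A.dual.dfun_zero]
  have h3 := iotaFun_cdiff 0 (φ := φ) (SecV.differentiableAt_loc 0 hφ).hasFDerivAt
  rw [SecV.loc_chart 0 i (mem_chart_source E φ.1)] at h3
  have h4 := (coprod_inj (h1.symm.trans (h2.trans h3))).2
  have h5 := apply_bijective.1 h4
  have h6 : ((A.triv i φ.1).linear ((0 : A.SecV).1 φ.1)).1 = 0 := by
    change ((A.triv i φ.1).linear 0).1 = 0
    rw [map_zero, Prod.fst_zero]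
  rw [h6] at h5
  refine ⟨((A.triv i φ.1).linear (X.1 φ.1)).2, ?_⟩
  apply (A.triv i φ.1).linear.injective
  rw [map_smul, A.triv_v]
  refine Prod.ext ?_ ?_
  · rw [h5]; simp
  · simp

/-- K is a first order operator with symbol w. Differentiating ι_Y along a lift of w to N has the
same Leibniz defect, so the difference Q is tensorial. If the differential of ι_X vanishes at φ,
then X is there a multiple of v_A; and Q kills v_A because K does and ι of v_A is constant. So Q X =
0, which leaves the value of ι_{K X} at φ. -/
theorem iotaFun_eq_zero_of_dfun_eq_zero (K : A.SecV →ₗ[ℝ] A.SecV)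
    (w : ∀ x : M, TangentSpace 𝓘(ℝ, E) x)
    (hK : ∀ f X x, (K (smulV f X)).1 x = f x • (K X).1 x + dirDeriv f x (w x) • X.1 x)
    (hv : K A.vSec = 0) {X : A.SecV} {φ : A.dual.Base} (h : A.dual.dfun (iotaFun X) φ = 0) :
    iotaFun (K X) φ = 0 := by
  obtain ⟨z₁, hz₁⟩ := exists_mfderiv_fst_eq (A := A.dual) φ (w φ.1)
  let Q : A.SecV →ₗ[ℝ] ℝ :=
    { toFun := fun Y => A.dual.dfun (iotaFun Y) φ z₁ - iotaFun (K Y) φ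
      map_add' := fun Y Z => by
        rw [map_add, iotaFun_add, iotaFun_add, A.dual.dfun_add, add_apply, fun_add_apply]
        ring
      map_smul' := fun c Y => by
        rw [map_smul, iotaFun_smul, iotaFun_smul, dfun_smul, fun_smul_apply, smul_apply,
          RingHom.id_apply, smul_eq_mul, smul_eq_mul]
        ring }
  have hQ : ∀ Y, Q Y = A.dual.dfun (iotaFun Y) φ z₁ - iotaFun (K Y) φ := fun Y => rfl
  have hQs : ∀ (f : C^∞⟮𝓘(ℝ, E), M; ℝ⟯) (Y : A.SecV), Q (smulV f Y) = f φ.1 * Q Y := by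
    intro f Y
    have h1 : iotaFun (K (smulV f Y)) φ = f φ.1 * iotaFun (K Y) φ +
        dirDeriv f φ.1 (w φ.1) * iotaFun Y φ := by
      rw [iotaFun_apply, hK, linPart_add, linPart_smul, linPart_smul]
      rfl
    have h2 : A.dual.dfun (A.dual.pull f) φ z₁ = dirDeriv f φ.1 (w φ.1) :=
      (dfun_pull (A := A.dual) f φ z₁).trans (congrArg _ hz₁)
    rw [hQ, hQ, h1, iotaFun_smulV, dfun_mul, add_apply, smul_apply, smul_apply, h2, smul_eq_mul,
      smul_eq_mul]
    change f φ.1 * _ + _ - _ = _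
    ring
  obtain ⟨c, hc⟩ := exists_smul_v_of_dfun_iotaFun_eq_zero h
  have h1 : Q (X - c • A.vSec) = 0 := by
    apply eq_zero_of_tensorial hQs
    exact sub_eq_zero.2 hc
  have h2 : Q A.vSec = 0 := by
    rw [hQ, hv, iotaFun_zero, iotaFun_vSec, dfun_one]
    exact sub_zero _
  rw [map_sub, map_smul, h2, smul_zero, sub_zero, hQ, h] at h1
  simpa using h1

end

/-! ### From a bracket to a pointwise map from P(A^#) to TN. -/

section

variable {A} [SigmaCompactSpace M] [FiniteDimensional ℝ F]

namespace SpecialAffgebroidBracket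

theorem bracket_vSec (B : A.SpecialAffgebroidBracket) (a : A.Sec) : B.bracket a A.vSec = 0 := by
  have h := B.special_right a 0
  rw [zero_add] at h
  rw [h, (B.linear_right a).map_zero]

/-- Since v_A is killed in the second argument, only the anchor term of the Leibniz rule survives.
This recovers the left anchor from the bracket; `bracket_vadd_smulV_vSec` does the same for the
right anchor. -/
theorem bracket_smulV_vSec (B : A.SpecialAffgebroidBracket) (a : A.Sec)
    (g : C^∞⟮𝓘(ℝ, E), M; ℝ⟯) (x : M) :
    (B.bracket a (smulV g A.vSec)).1 x = dirDeriv g x (B.left.toFun x (a.1 x)) • A.v x := by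
  rw [B.leibniz_right, bracket_vSec]
  change g x • (0 : A.Mod x) + _ = _
  rw [smul_zero, zero_add]
  rfl

theorem bracket_vadd_smulV_vSec (B : A.SpecialAffgebroidBracket) (a : A.Sec)
    (f : C^∞⟮𝓘(ℝ, E), M; ℝ⟯) (Y : A.SecV) (x : M) :
    (B.bracket (vadd a (smulV f A.vSec)) Y).1 x =
      (B.bracket a Y).1 x - dirDeriv f x (B.right.toFun x (Y.1 x)) • A.v x := by
  rw [B.leibniz_left, B.special_left, ← add_smul, sub_add_cancel, one_smul]
  rfl

theorem ext_bracket {B B' : A.SpecialAffgebroidBracket}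
    (h : ∀ a X, B.bracket a X = B'.bracket a X) : B = B' := by
  apply SpecialAffgebroidBracket.ext
  · funext a X
    exact h a X
  · apply AffineAnchor.ext
    funext x
    ext c
    obtain ⟨a, rfl⟩ := exists_sec_apply_eq c
    apply dirDeriv_ext
    intro g
    apply smul_left_injective ℝ (A.v_ne_zero x)
    dsimp only
    rw [← bracket_smulV_vSec, ← bracket_smulV_vSec, h]
  · apply LinearAnchor.ext
    funext x
    ext u
    obtain ⟨Y, rfl⟩ := exists_secV_apply_eq u
    obtain ⟨a⟩ := A.nonempty_sec
    apply dirDeriv_ext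
    intro f
    apply smul_left_injective ℝ (A.v_ne_zero x)
    dsimp only
    have h1 := B.bracket_vadd_smulV_vSec a f Y x
    rw [h, h, B'.bracket_vadd_smulV_vSec] at h1
    exact (sub_right_injective h1).symm

theorem left_vadd_v (B : A.SpecialAffgebroidBracket) (x : M) (t : ℝ) (c : A.Fib x) :
    B.left.toFun x (t • A.v x +ᵥ c) = B.left.toFun x c := by
  have h1 : (B.left.toFun x).linear (A.v x) = 0 := by
    obtain ⟨a⟩ := A.nonempty_sec
    have h2 : B.left.toFun x ((vadd a A.vSec).1 x) = B.left.toFun x (a.1 x) := by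
      apply dirDeriv_ext
      intro g
      apply smul_left_injective ℝ (A.v_ne_zero x)
      dsimp only
      rw [← bracket_smulV_vSec, ← bracket_smulV_vSec, B.special_left]
    have h3 : B.left.toFun x (A.v x +ᵥ a.1 x) = B.left.toFun x (a.1 x) := h2
    rw [AffineMap.map_vadd, vadd_eq_add, add_eq_right] at h3
    exact h3
  rw [AffineMap.map_vadd, map_smul, h1, smul_zero, zero_vadd]

theorem exists_vector_right (B : A.SpecialAffgebroidBracket) (φ : A.dual.Base) (a : A.Sec) :
    ∃ z : TangentSpace 𝓘(ℝ, E × (F →L[ℝ] ℝ)) φ, ∀ X,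
      iotaFun (B.bracket a X) φ = A.dual.dfun (iotaFun X) φ z := by
  have : T2Space (TangentSpace 𝓘(ℝ, E × (F →L[ℝ] ℝ)) φ) :=
    inferInstanceAs (T2Space (E × (F →L[ℝ] ℝ)))
  refine exists_vector_of_ker_le (fun X => A.dual.dfun (iotaFun X) φ) ⟨fun X Y => ?_, fun c X => ?_⟩
    exists_iotaFun_dfun_eq (fun X => iotaFun (B.bracket a X) φ) ⟨fun X Y => ?_, fun c X => ?_⟩
    fun X hX => ?_
  · rw [iotaFun_add, A.dual.dfun_add]
  · rw [iotaFun_smul, dfun_smul]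
  · rw [(B.linear_right a).map_add, iotaFun_add, fun_add_apply]
  · rw [(B.linear_right a).map_smul, iotaFun_smul, fun_smul_apply, smul_eq_mul]
  · exact iotaFun_eq_zero_of_dfun_eq_zero ((B.linear_right a).mk' _)
      (fun x => B.left.toFun x (a.1 x)) (fun f X x => B.leibniz_right a f X x)
      (B.bracket_vSec a) hX

/-- The linear part of [·, Y] is a first order operator whose symbol is minus the right anchor of Y,
and it kills v_A by speciality, so `iotaFun_eq_zero_of_dfun_eq_zero` applies. -/
theorem exists_vector_left (B : A.SpecialAffgebroidBracket) (φ : A.dual.Base) (Y : A.SecV) :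
    ∃ z : TangentSpace 𝓘(ℝ, E × (F →L[ℝ] ℝ)) φ, ∀ a X,
      iotaFun (B.bracket (vadd a X) Y) φ =
        iotaFun (B.bracket a Y) φ + A.dual.dfun (iotaFun X) φ z := by
  have : T2Space (TangentSpace 𝓘(ℝ, E × (F →L[ℝ] ℝ)) φ) :=
    inferInstanceAs (T2Space (E × (F →L[ℝ] ℝ)))
  obtain ⟨L, hL⟩ := B.affine_left Y
  obtain ⟨a⟩ := A.nonempty_sec
  obtain ⟨z, hz⟩ := exists_vector_of_ker_le (fun X => A.dual.dfun (iotaFun X) φ)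
    ⟨fun X Y => by rw [iotaFun_add, A.dual.dfun_add],
      fun c X => by rw [iotaFun_smul, dfun_smul]⟩
    exists_iotaFun_dfun_eq (fun X => iotaFun (L X) φ)
    ⟨fun X Y => by rw [map_add, iotaFun_add, fun_add_apply],
      fun c X => by rw [map_smul, iotaFun_smul, fun_smul_apply, smul_eq_mul]⟩
    fun X hX => by
      refine iotaFun_eq_zero_of_dfun_eq_zero L (fun x => -B.right.toFun x (Y.1 x))
        (fun f X x => ?_) ?_ hX
      · have h1 := B.leibniz_left a f X Y x
        rw [hL, hL] at h1
        have h2 : (B.bracket a Y).1 x + (L (smulV f X)).1 x = (1 - f x) • (B.bracket a Y).1 x +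
          f x • ((B.bracket a Y).1 x + (L X).1 x) -
            dirDeriv f x (B.right.toFun x (Y.1 x)) • X.1 x := h1
        have h3 : dirDeriv f x (-B.right.toFun x (Y.1 x)) =
          -dirDeriv f x (B.right.toFun x (Y.1 x)) := map_neg _ _
        rw [h3, ← add_right_inj ((B.bracket a Y).1 x), h2, sub_smul, one_smul, smul_add, neg_smul]
        abel
      · have h1 := hL a A.vSec
        rw [B.special_left] at h1
        exact left_eq_add.1 h1
  refine ⟨z, fun a X => ?_⟩
  rw [hL, iotaFun_add, fun_add_apply, ← hz]

/-- For each a, `exists_vector_right` represents X ↦ ι_{[a,X]} at φ by a tangent vector. Sections a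
with the same affine differential at φ differ by a Y for which ι_Y has zero differential there, so
by `exists_vector_left` they give the same vector. -/
theorem exists_sharp (B : A.SpecialAffgebroidBracket) :
    ∃ G : ∀ φ, A.dual.PhaseFib φ → TangentSpace 𝓘(ℝ, E × (F →L[ℝ] ℝ)) φ, ∀ φ a X,
      A.dual.dfun (iotaFun X) φ (G φ ((iotaSec a).dd φ)) = iotaFun (B.bracket a X) φ := by
  choose z hz using B.exists_vector_right
  choose s hs using fun φ => fun q : A.dual.PhaseFib φ => exists_iotaSec_dd_eq q
  refine ⟨fun φ q => z φ (s φ q), fun φ a X => ?_⟩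
  rw [← hz]
  have h1 := hs φ ((iotaSec a).dd φ)
  generalize s φ ((iotaSec a).dd φ) = b at h1 ⊢
  obtain ⟨Y, rfl⟩ := exists_vadd b a
  have h2 := (AVSection.dd_add_eq_iff (A := A.dual) (iotaSec b) 0 (iotaFun Y) φ).1
    (by rw [AVSection.add_zero A.dual]; rw [iotaSec_vadd] at h1; exact h1)
  rw [A.dual.dfun_zero] at h2
  obtain ⟨w, hw⟩ := B.exists_vector_left φ X
  rw [hw, ← h2]
  exact (add_zero _).symm

end SpecialAffgebroidBracket

end

/-! ### The local expression of a bracket and its double affine form. -/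

section

variable {A} [SigmaCompactSpace M] [FiniteDimensional ℝ F]

/-- The linear term is not recentred at x₁, so the same section has the same coordinates (y, p) at
all points near x₁. Smooth dependence on the base point can then be tested with one section. -/
theorem exists_sec_affine {i : A.Idx} {x₀ x₁ : M} (hx : x₁ ∈ A.dom i x₀) (y : F) (p : E →L[ℝ] ℝ) :
    ∃ a : A.Sec, ∀ᶠ x in 𝓝 x₁, A.triv i x (a.1 x) = (y, p (chartAt E x₀ x)) := by
  obtain ⟨a, ha⟩ := exists_sec_loc hx (contDiff_affine y p 0)
  exact ⟨a, ha.mono fun x hx => by rw [hx, sub_zero]⟩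

theorem exists_secV_affine {i : A.Idx} {x₀ x₁ : M} (hx : x₁ ∈ A.dom i x₀) (y : F)
    (p : E →L[ℝ] ℝ) :
    ∃ X : A.SecV, ∀ᶠ x in 𝓝 x₁, (A.triv i x).linear (X.1 x) = (y, p (chartAt E x₀ x)) := by
  obtain ⟨a, ha⟩ := exists_secV_loc hx (contDiff_affine y p 0)
  exact ⟨a, ha.mono fun x hx => by rw [hx, sub_zero]⟩

theorem dd_iotaSec_eq {i : A.Idx} {x₀ : M} {φ : A.dual.Base} (hφ : φ.1 ∈ A.dom i x₀)
    {a : A.Sec} {y : F} {p : E →L[ℝ] ℝ}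
    (ha : ∀ᶠ x in 𝓝 φ.1, A.triv i x (a.1 x) = (y, p (chartAt E x₀ x))) {σ : A.dual.AVSection}
    (hσ : σ.phaseCoord i x₀ φ = (p, ContinuousLinearMap.apply ℝ ℝ y)) :
    (iotaSec a).dd φ = σ.dd φ := by
  refine (AVSection.dd_eq_iff (A := A.dual) (i := i) (x₀ := x₀) _ _ hφ).2 ?_
  rw [(AVSection.phaseCoord_eq_iff (A := A.dual) _ _ _ _ _ _).1 hσ]
  exact iotaSec_locDeriv_affine (e₁ := 0) hφ (ha.mono fun x hx => by rw [hx, sub_zero])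

theorem cdiff_iotaFun_eq {i : A.Idx} {x₀ : M} {φ : A.dual.Base} (hφ : φ.1 ∈ A.dom i x₀)
    {X : A.SecV} {y : F} {p : E →L[ℝ] ℝ}
    (hX : ∀ᶠ x in 𝓝 φ.1, (A.triv i x).linear (X.1 x) = (y, p (chartAt E x₀ x))) :
    A.dual.cdiff i x₀ (iotaFun X) φ = p.coprod (ContinuousLinearMap.apply ℝ ℝ y) :=
  iotaFun_cdiff_affine (e₁ := 0) hφ (hX.mono fun x hx => by rw [hx, sub_zero])

/-- A map from the phase bundle of the dual to the tangent bundle that represents a bracket,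
read in local coordinates. -/
theorem exists_local_sharp (B : A.SpecialAffgebroidBracket)
    {G : ∀ φ, A.dual.PhaseFib φ → TangentSpace 𝓘(ℝ, E × (F →L[ℝ] ℝ)) φ}
    (hG : ∀ φ a X, A.dual.dfun (iotaFun X) φ (G φ ((iotaSec a).dd φ)) = iotaFun (B.bracket a X) φ)
    (i : A.Idx) (x₀ : M) :
    ∃ Ψ : E × (F →L[ℝ] ℝ) → F × (E →L[ℝ] ℝ) → E × (F →L[ℝ] ℝ),
      (∀ φ : A.dual.Base, φ.1 ∈ A.dom i x₀ → ∀ (σ : A.dual.AVSection) (p : E →L[ℝ] ℝ) (y : F),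
        σ.phaseCoord i x₀ φ = (p, ContinuousLinearMap.apply ℝ ℝ y) →
          mfderiv 𝓘(ℝ, E × (F →L[ℝ] ℝ)) 𝓘(ℝ, E × (F →L[ℝ] ℝ)) (A.dual.coord i x₀) φ
            (G φ (σ.dd φ)) = Ψ (A.dual.coord i x₀ φ) (y, p)) ∧
      ∀ φ : A.dual.Base, φ.1 ∈ A.dom i x₀ → ∀ (a : A.Sec) (p : E →L[ℝ] ℝ) (y : F),
        (∀ᶠ x in 𝓝 φ.1, A.triv i x (a.1 x) = (y, p (chartAt E x₀ x))) →
        ∀ (X : A.SecV) (l : E →L[ℝ] ℝ) (u : F),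
        (∀ᶠ x in 𝓝 φ.1, (A.triv i x).linear (X.1 x) = (u, l (chartAt E x₀ x))) →
        l.coprod (ContinuousLinearMap.apply ℝ ℝ u) (Ψ (A.dual.coord i x₀ φ) (y, p)) =
          iotaFun (B.bracket a X) φ := by
  obtain ⟨σ₀⟩ := A.dual.nonempty_avSection
  have h1 : ∀ (φ : A.dual.Base) (k : F × (E →L[ℝ] ℝ)), ∃ σ : A.dual.AVSection,
      φ.1 ∈ A.dom i x₀ → σ.phaseCoord i x₀ φ = (k.2, ContinuousLinearMap.apply ℝ ℝ k.1) := by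
    intro φ k
    by_cases hφ : φ.1 ∈ A.dom i x₀
    · obtain ⟨σ, hσ⟩ := AVSection.exists_locDeriv_eq (A := A.dual) (i := i) (x₀ := x₀) σ₀ hφ
        (k.2.coprod (ContinuousLinearMap.apply ℝ ℝ k.1))
      exact ⟨σ, fun _ => (AVSection.phaseCoord_eq_iff (A := A.dual) _ _ _ _ _ _).2 hσ⟩
    · exact ⟨σ₀, fun h => (hφ h).elim⟩
  choose s hs using h1
  let Ψ' : A.dual.Base → F × (E →L[ℝ] ℝ) → E × (F →L[ℝ] ℝ) := fun φ k =>
    mfderiv 𝓘(ℝ, E × (F →L[ℝ] ℝ)) 𝓘(ℝ, E × (F →L[ℝ] ℝ)) (A.dual.coord i x₀) φ (G φ ((s φ k).dd φ))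
  have h2 : ∀ φ : A.dual.Base, φ.1 ∈ A.dom i x₀ →
      A.dual.coordSymm i x₀ (A.dual.coord i x₀ φ) = φ :=
    fun φ hφ => A.dual.coordSymm_coord (i := i) (x₀ := x₀) hφ
  refine ⟨fun q k => Ψ' (A.dual.coordSymm i x₀ q) k, fun φ hφ σ p y hσ => ?_,
    fun φ hφ a p y ha X l u hX => ?_⟩
  · dsimp only
    rw [h2 φ hφ]
    have h3 : (s φ (y, p)).dd φ = σ.dd φ := by
      refine (AVSection.dd_eq_iff (A := A.dual) (i := i) (x₀ := x₀) _ _ hφ).2 ?_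
      rw [(AVSection.phaseCoord_eq_iff (A := A.dual) _ _ _ _ _ _).1 hσ]
      exact (AVSection.phaseCoord_eq_iff (A := A.dual) _ _ _ _ _ _).1 (hs φ (y, p) hφ)
    change _ = mfderiv 𝓘(ℝ, E × (F →L[ℝ] ℝ)) 𝓘(ℝ, E × (F →L[ℝ] ℝ)) (A.dual.coord i x₀) φ
      (G φ ((s φ (y, p)).dd φ))
    rw [h3]
  · dsimp only
    rw [h2 φ hφ]
    have h3 : (iotaSec a).dd φ = (s φ (y, p)).dd φ := dd_iotaSec_eq hφ ha (hs φ (y, p) hφ)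
    have h4 := hG φ a X
    rw [h3, A.dual.dfun_apply (i := i) (x₀ := x₀) hφ, cdiff_iotaFun_eq hφ hX] at h4
    exact h4

variable {B : A.SpecialAffgebroidBracket} {i : A.Idx} {x₀ : M}
  {Ψ : E × (F →L[ℝ] ℝ) → F × (E →L[ℝ] ℝ) → E × (F →L[ℝ] ℝ)}

/-- `Ψ` represents the bracket `B` in local coordinates. -/
def Represents (B : A.SpecialAffgebroidBracket) (i : A.Idx) (x₀ : M)
    (Ψ : E × (F →L[ℝ] ℝ) → F × (E →L[ℝ] ℝ) → E × (F →L[ℝ] ℝ)) : Prop :=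
  ∀ φ : A.dual.Base, φ.1 ∈ A.dom i x₀ → ∀ (a : A.Sec) (p : E →L[ℝ] ℝ) (y : F),
    (∀ᶠ x in 𝓝 φ.1, A.triv i x (a.1 x) = (y, p (chartAt E x₀ x))) →
    ∀ (X : A.SecV) (l : E →L[ℝ] ℝ) (u : F),
    (∀ᶠ x in 𝓝 φ.1, (A.triv i x).linear (X.1 x) = (u, l (chartAt E x₀ x))) →
    l.coprod (ContinuousLinearMap.apply ℝ ℝ u) (Ψ (A.dual.coord i x₀ φ) (y, p)) =
      iotaFun (B.bracket a X) φ

/-- Every linear functional has the form l + evaluation at u. Applied to Ψ it gives ι_{[a,X]} for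
sections a and X that stay fixed near the point, which is smooth. -/
theorem Represents.contDiffOn (h : Represents B i x₀ Ψ) (k : F × (E →L[ℝ] ℝ)) :
    ContDiffOn ℝ ∞ (fun q => Ψ q k) (A.dual.baseChart i x₀).target := by
  intro q hq
  refine ContDiffAt.contDiffWithinAt (contDiffAt_of_forall_dual fun L => ?_)
  obtain ⟨l, u, rfl⟩ := exists_coprod L
  have hφ := A.dual.coordSymm_mem (i := i) (x₀ := x₀) hq
  obtain ⟨a, ha⟩ := exists_sec_affine (A := A) (i := i) (x₀ := x₀) hφ k.1 k.2
  obtain ⟨X, hX⟩ := exists_secV_affine (A := A) (i := i) (x₀ := x₀) hφ u l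
  have h1 := (contDiffOn_fun_comp_coordSymm (A := A.dual) i x₀
    (iotaFun (B.bracket a X))).contDiffAt ((A.dual.isOpen_baseChart_target i x₀).mem_nhds hq)
  refine h1.congr_of_eventuallyEq ?_
  have h2 := A.dual.eventually_coordSymm (i := i) (x₀ := x₀) hφ
    (ha.eventually_nhds.and hX.eventually_nhds)
  rw [A.dual.coord_coordSymm hq] at h2
  filter_upwards [h2] with q' hq'
  have h3 := h _ (A.dual.coordSymm_mem (i := i) (x₀ := x₀) hq'.1) a k.2 k.1 hq'.2.1 X l u hq'.2.2
  rw [A.dual.coord_coordSymm hq'.1] at h3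
  exact h3

/-- The pair k = (y, p) is realized by a + Y_k with a fixed, and `exists_vector_left` provides one
tangent vector that computes all increments, linearly in k. -/
theorem Represents.affine (h : Represents B i x₀ Ψ) {q : E × (F →L[ℝ] ℝ)}
    (hq : q ∈ (A.dual.baseChart i x₀).target) :
    ∃ T : F × (E →L[ℝ] ℝ) →ᵃ[ℝ] E × (F →L[ℝ] ℝ), ∀ k, Ψ q k = T k := by
  refine exists_affineMap_of_forall_dual fun L => ?_
  obtain ⟨l, u, rfl⟩ := exists_coprod L
  have hφ : (A.dual.coordSymm i x₀ q).1 ∈ A.dom i x₀ :=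
    A.dual.coordSymm_mem (i := i) (x₀ := x₀) hq
  have hc := A.dual.coord_coordSymm (i := i) (x₀ := x₀) hq
  generalize A.dual.coordSymm i x₀ q = φ at hφ hc
  subst hc
  obtain ⟨a, ha⟩ := exists_sec_affine (A := A) (i := i) (x₀ := x₀) hφ 0 0
  obtain ⟨X, hX⟩ := exists_secV_affine (A := A) (i := i) (x₀ := x₀) hφ u l
  choose Y hY using fun k : F × (E →L[ℝ] ℝ) =>
    exists_secV_affine (A := A) (i := i) (x₀ := x₀) hφ k.1 k.2
  obtain ⟨z, hz⟩ := B.exists_vector_left φ X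
  let c : E × (F →L[ℝ] ℝ) :=
    mfderiv 𝓘(ℝ, E × (F →L[ℝ] ℝ)) 𝓘(ℝ, E × (F →L[ℝ] ℝ)) (A.dual.coord i x₀) φ z
  let T : F × (E →L[ℝ] ℝ) →ₗ[ℝ] ℝ :=
    { toFun := fun k => k.2 c.1 + c.2 k.1
      map_add' := fun k k' => by
        simp only [Prod.fst_add, Prod.snd_add, add_apply, map_add]
        ring
      map_smul' := fun r k => by
        simp only [Prod.smul_fst, Prod.smul_snd, smul_apply, map_smul, smul_eq_mul,
          RingHom.id_apply]
        ring }
  refine ⟨T.toAffineMap + AffineMap.const ℝ _ (iotaFun (B.bracket a X) φ), fun k => ?_⟩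
  have h1 : ∀ᶠ x in 𝓝 φ.1, A.triv i x ((vadd a (Y k)).1 x) = (k.1, k.2 (chartAt E x₀ x)) := by
    filter_upwards [ha, hY k] with x h1 h2
    change A.triv i x ((Y k).1 x +ᵥ a.1 x) = _
    rw [AffineEquiv.map_vadd, h1, h2]
    simp
  rw [h φ hφ _ _ _ h1 X l u hX, hz, A.dual.dfun_apply (i := i) (x₀ := x₀) hφ,
    cdiff_iotaFun_eq hφ (hY k), add_comm]
  rfl

/-- Test against l with X = g v_A, where g = l ∘ chart near the point: the bracket is then the
derivative of g along the left anchor, times v_A. The parameter p enters a only through a multiple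
of v_A, which the left anchor ignores, and ξ does not enter at all. -/
theorem Represents.fst_eq (h : Represents B i x₀ Ψ) {φ : A.dual.Base} (hφ : φ.1 ∈ A.dom i x₀)
    (y : F) (p : E →L[ℝ] ℝ) :
    (Ψ (A.dual.coord i x₀ φ) (y, p)).1 = mfderiv 𝓘(ℝ, E) 𝓘(ℝ, E) (chartAt E x₀) φ.1
      (B.left.toFun φ.1 ((A.triv i φ.1).symm (y, 0))) := by
  refine (SeparatingDual.eq_iff_forall_dual_eq (R := ℝ) (V := E)).2 fun l => ?_
  obtain ⟨a, ha⟩ := exists_sec_affine (A := A) (i := i) (x₀ := x₀) hφ y p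
  obtain ⟨g, hg⟩ := exists_fun_chart l hφ.2
  have hX : ∀ᶠ x in 𝓝 φ.1, (A.triv i x).linear ((smulV g A.vSec).1 x) =
      (0, l (chartAt E x₀ x)) := by
    filter_upwards [hg] with x hx
    change (A.triv i x).linear (g x • A.v x) = _
    rw [map_smul, A.triv_v, hx]
    simp
  have h1 := h φ hφ a p y ha _ l 0 hX
  have h2 : iotaFun (B.bracket a (smulV g A.vSec)) φ =
      dirDeriv g φ.1 (B.left.toFun φ.1 (a.1 φ.1)) := by
    rw [iotaFun_apply, B.bracket_smulV_vSec, linPart_smul, linPart_v, mul_one]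
  have h3 : a.1 φ.1 = p (chartAt E x₀ φ.1) • A.v φ.1 +ᵥ (A.triv i φ.1).symm (y, 0) := by
    apply (A.triv i φ.1).injective
    rw [A.triv_smul_v_vadd, ha.self_of_nhds]
    simp
  rw [h2, h3, B.left_vadd_v, dirDeriv_of_eventually_chart (l := l) (c := 0) hφ.2
    (hg.mono fun z hz => by rw [hz, add_zero])] at h1
  refine Eq.trans ?_ h1
  simp

/-- Test with X = (u, 0) and with a + g v_A, where g = p ∘ chart realizes p. The bracket is [a, X]
minus the derivative of g along the right anchor of X, times v_A. Its ι is the sum of a term affine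
in ξ and a term linear in p, so no product of ξ and p occurs. -/
theorem Represents.affine_snd (h : Represents B i x₀ Ψ) {e : E} (he : e ∈ chartAt E x₀ '' A.dom i x₀)
    (y : F) : ∃ T : (F →L[ℝ] ℝ) × (E →L[ℝ] ℝ) →ᵃ[ℝ] (F →L[ℝ] ℝ),
      ∀ k, (Ψ (e, k.1) (y, k.2)).2 = T k := by
  refine exists_affineMap_of_forall_dual fun L => ?_
  obtain ⟨u, rfl⟩ := apply_bijective.2 L
  obtain ⟨x, hx, rfl⟩ := he
  obtain ⟨a, ha⟩ := exists_sec_affine (A := A) (i := i) (x₀ := x₀) hx y 0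
  obtain ⟨X, hX⟩ := exists_secV_affine (A := A) (i := i) (x₀ := x₀) hx u 0
  choose g hg using fun p : E →L[ℝ] ℝ => exists_fun_chart p hx.2
  set c : F × ℝ := (A.triv i x).linear ((B.bracket a X).1 x)
  let w : E := mfderiv 𝓘(ℝ, E) 𝓘(ℝ, E) (chartAt E x₀) x (B.right.toFun x (X.1 x))
  let T : (F →L[ℝ] ℝ) × (E →L[ℝ] ℝ) →ₗ[ℝ] ℝ :=
    { toFun := fun k => k.1 c.1 - k.2 w
      map_add' := fun k k' => by
        simp only [Prod.fst_add, Prod.snd_add, add_apply]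
        ring
      map_smul' := fun r k => by
        simp only [Prod.smul_fst, Prod.smul_snd, smul_apply, smul_eq_mul, RingHom.id_apply]
        ring }
  refine ⟨T.toAffineMap + AffineMap.const ℝ _ c.2, fun k => ?_⟩
  have h1 : ∀ᶠ z in 𝓝 x, A.triv i z ((vadd a (smulV (g k.2) A.vSec)).1 z) =
      (y, k.2 (chartAt E x₀ z)) := by
    filter_upwards [ha, hg k.2] with z h1 h2
    change A.triv i z (g k.2 z • A.v z +ᵥ a.1 z) = _
    rw [A.triv_smul_v_vadd, h1, h2]
    simp
  have h2 := h ⟨x, A.dual.qinv i x k.1⟩ hx _ _ _ h1 X 0 u hX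
  have h3 : A.dual.coord i x₀ ⟨x, A.dual.qinv i x k.1⟩ = (chartAt E x₀ x, k.1) :=
    Prod.ext rfl (A.dual.qcoord_qinv i x k.1)
  have h4 : iotaFun (B.bracket (vadd a (smulV (g k.2) A.vSec)) X) ⟨x, A.dual.qinv i x k.1⟩ =
      k.1 c.1 + c.2 - k.2 w := by
    change A.linPart ((B.bracket (vadd a (smulV (g k.2) A.vSec)) X).1 x)
      (A.dual.qinv i x k.1) = _
    rw [B.bracket_vadd_smulV_vSec, sub_eq_add_neg, ← neg_smul, linPart_add, linPart_smul, linPart_v,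
      linPart_qinv, dirDeriv_of_eventually_chart (l := k.2) (c := 0) hx.2
      ((hg k.2).mono fun z hz => by rw [hz, add_zero])]
    change _ + -(k.2 w) * 1 = _
    ring
  rw [h4, h3] at h2
  refine Eq.trans ?_ (h2.trans ?_)
  · simp
  · change _ = k.1 c.1 - k.2 w + c.2
    ring

end

/-! ### Brackets with anchors correspond to affine tensors. -/

section

variable {A} [SigmaCompactSpace M] [FiniteDimensional ℝ F]

/-- The first component of Ψ depends neither on ξ nor on p, so its value at ξ = 0, p = 0 serves as
Φ₂. Smoothness in all variables follows from smoothness in the base and affineness in (y, p). -/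
theorem Represents.isTrivialDoubleAffineMorphism {B : A.SpecialAffgebroidBracket} {i : A.Idx}
    {x₀ : M} {Ψ : E × (F →L[ℝ] ℝ) → F × (E →L[ℝ] ℝ) → E × (F →L[ℝ] ℝ)}
    (h : Represents B i x₀ Ψ) :
    IsTrivialDoubleAffineMorphism (chartAt E x₀ '' A.dom i x₀)
      (fun (_ : E) (ξ : F →L[ℝ] ℝ) => ξ) (fun e y => (Ψ (e, 0) (y, 0)).1)
      (fun e ξ y p => (Ψ (e, ξ) (y, p)).2) ∧
    ∀ e ∈ chartAt E x₀ '' A.dom i x₀, ∀ ξ y p, (Ψ (e, ξ) (y, p)).1 = (Ψ (e, 0) (y, 0)).1 := by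
  have hmem : ∀ e ∈ chartAt E x₀ '' A.dom i x₀, ∀ ξ, (e, ξ) ∈ (A.dual.baseChart i x₀).target := by
    rintro _ ⟨x, hx, rfl⟩ ξ
    refine ⟨(chartAt E x₀).map_source hx.2, ?_⟩
    change (chartAt E x₀).symm (chartAt E x₀ x) ∈ A.U i
    rw [(chartAt E x₀).left_inv hx.2]
    exact hx.1
  have hfst : ∀ e ∈ chartAt E x₀ '' A.dom i x₀, ∀ ξ y p,
      (Ψ (e, ξ) (y, p)).1 = (Ψ (e, 0) (y, 0)).1 := by
    rintro _ ⟨x, hx, rfl⟩ ξ y p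
    have h3 : ∀ ξ, A.dual.coord i x₀ ⟨x, A.dual.qinv i x ξ⟩ = (chartAt E x₀ x, ξ) :=
      fun ξ => Prod.ext rfl (A.dual.qcoord_qinv i x ξ)
    rw [← h3, ← h3]
    exact (h.fst_eq (φ := ⟨x, A.dual.qinv i x ξ⟩) hx y p).trans
      (h.fst_eq (φ := ⟨x, A.dual.qinv i x 0⟩) hx y 0).symm
  have hs : ContDiffOn ℝ ∞
      (fun q : (E × (F →L[ℝ] ℝ)) × (F × (E →L[ℝ] ℝ)) => Ψ q.1 q.2)
      ((A.dual.baseChart i x₀).target ×ˢ univ) :=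
    contDiffOn_of_affine_right (f := Ψ) h.contDiffOn fun q hq => h.affine hq
  refine ⟨⟨contDiff_snd.contDiffOn, ?_, ?_, fun e he ξ => ?_, fun e he y => ?_⟩, hfst⟩
  · exact contDiff_fst.comp_contDiffOn (hs.comp
      (f := fun q : E × F => (((q.1, 0), (q.2, 0)) : (E × (F →L[ℝ] ℝ)) × (F × (E →L[ℝ] ℝ))))
      (by fun_prop) fun q hq => ⟨hmem _ hq.1 _, mem_univ _⟩)
  · exact contDiff_snd.comp_contDiffOn (hs.comp
      (f := fun q : E × (F →L[ℝ] ℝ) × F × (E →L[ℝ] ℝ) => ((q.1, q.2.1), (q.2.2.1, q.2.2.2)))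
      (by fun_prop) fun q hq => ⟨hmem _ hq.1 _, mem_univ _⟩)
  · obtain ⟨T, hT⟩ := h.affine (hmem e he ξ)
    refine ⟨T, fun y p => ?_⟩
    rw [← hT]
    exact Prod.ext (hfst e he ξ y p) rfl
  · obtain ⟨T, hT⟩ := h.affine_snd he y
    exact ⟨(LinearMap.fst ℝ _ _).toAffineMap.prod T, fun ξ p => Prod.ext rfl (hT (ξ, p)).symm⟩

theorem exists_affineTensor_of_bracket (B : A.SpecialAffgebroidBracket) :
    ∃ Γ : A.AffineTensor, ∀ a X,
      Γ.pair (iotaSec a) (iotaFun X) = iotaFun (B.bracket a X) := by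
  obtain ⟨G, hG⟩ := B.exists_sharp
  obtain ⟨Γ, hΓ⟩ := exists_affineTensor (A := A) G (by
    intro i x₀
    obtain ⟨Ψ, h1, h2⟩ := exists_local_sharp B hG i x₀
    obtain ⟨h3, h4⟩ := Represents.isTrivialDoubleAffineMorphism (B := B) h2
    refine ⟨_, _, h3.precomp (bidual (F := F)).symm.toContinuousLinearMap
      (ContinuousLinearMap.id ℝ _), ?_⟩
    intro φ hφ σ x ξ p y hc hp
    have h5 : y = ContinuousLinearMap.apply ℝ ℝ (bidual.symm y) := by
      rw [← bidual_apply]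
      exact (bidual.apply_symm_apply y).symm
    have h6 := h1 φ hφ σ p (bidual.symm y) (hp.trans (Prod.ext rfl h5))
    have h7 : x ∈ chartAt E x₀ '' A.dom i x₀ := ⟨φ.1, hφ, congrArg Prod.fst hc⟩
    rw [hc] at h6
    refine Prod.ext hc (h6.trans ?_)
    exact Prod.ext (h4 x h7 _ _ _) rfl)
  refine ⟨Γ, fun a X => ?_⟩
  ext φ
  rw [Γ.pair_apply, hΓ]
  exact hG φ a X

theorem exists_bracket_of_affineTensor (Γ : A.AffineTensor) :
    ∃ B : A.SpecialAffgebroidBracket, ∀ a X,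
      iotaFun (B.bracket a X) = Γ.pair (iotaSec a) (iotaFun X) :=
  Γ.toBiderivation.exists_bracket Γ.pair_add_pull_pull

end

/-! ### Lie affgebroids and aff-Poisson tensors. -/

section

variable {A} [SigmaCompactSpace M] [FiniteDimensional ℝ F]

theorem eq_zero_of_eq_neg {V : Type*} [AddCommGroup V] [Module ℝ V] {v : V} (h : v = -v) :
    v = 0 := by
  have h1 : (2 : ℝ) • v = 0 := by rw [two_smul]; nth_rw 1 [h]; exact neg_add_cancel v
  exact (smul_eq_zero.1 h1).resolve_left two_ne_zero

theorem iotaFun_neg (X : A.SecV) : iotaFun (-X) = -iotaFun X := by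
  have h := iotaFun_sub 0 X
  rwa [zero_sub, iotaFun_zero, zero_sub] at h

theorem AVSection.dd_add_congr {σ τ : A.AVSection} {h k : C^∞⟮𝓘(ℝ, E × F), A.Base; ℝ⟯} {b : A.Base}
    (H : σ.dd b = τ.dd b) (hk : A.dfun h b = A.dfun k b) : (σ.add h).dd b = (τ.add k).dd b := by
  obtain ⟨m, rfl⟩ := σ.exists_add τ
  have h1 := (σ.dd_add_eq_iff 0 m b).1 (by rw [AVSection.add_zero]; exact H)
  rw [AVSection.add_add, AVSection.dd_add_eq_iff, A.dfun_add, ← h1, A.dfun_zero, zero_add, hk]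

theorem AffineTensor.pair_congr_dd (Γ : A.AffineTensor) {σ τ : A.dual.AVSection}
    {f g : C^∞⟮𝓘(ℝ, E × (F →L[ℝ] ℝ)), A.dual.Base; ℝ⟯} {φ : A.dual.Base}
    (h : σ.dd φ = τ.dd φ) (hf : A.dual.dfun f φ = A.dual.dfun g φ) :
    Γ.pair σ f φ = Γ.pair τ g φ := by
  rw [Γ.pair_apply, Γ.pair_apply, h, hf]

/-- The Lie bracket of two derivations annihilates, at a point, the functions with vanishing
differential there. -/
theorem derivation_comm_apply
    (D D' : Derivation ℝ C^∞⟮𝓘(ℝ, E × F), A.Base; ℝ⟯ C^∞⟮𝓘(ℝ, E × F), A.Base; ℝ⟯)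
    {h : C^∞⟮𝓘(ℝ, E × F), A.Base; ℝ⟯} {b : A.Base} (H : A.dfun h b = 0) :
    D (D' h) b = D' (D h) b := by
  have h1 := A.derivation_eq_zero_of_dfun_eq_zero ⁅D, D'⁆ H
  rw [Derivation.commutator_apply] at h1
  exact sub_eq_zero.1 h1

/-- The bracket `{σ, τ - σ}` of two sections. -/
theorem AffineTensor.exists_bracket_sections (Γ : A.AffineTensor)
    (hskew : ∀ σ h, Γ.pair (σ.add h) h = Γ.pair σ h) :
    ∃ br : A.dual.AVSection → A.dual.AVSection →
        C^∞⟮𝓘(ℝ, E × (F →L[ℝ] ℝ)), A.dual.Base; ℝ⟯,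
      (∀ σ h, br σ (σ.add h) = Γ.pair σ h) ∧
      (∀ σ τ h, br σ (τ.add h) = br σ τ + Γ.pair σ h) ∧ ∀ σ τ, br σ τ = -br τ σ := by
  choose V hV using Γ.exists_derivation_right
  choose d hd using fun σ τ : A.dual.AVSection => AVSection.exists_add (A := A.dual) σ τ
  have h1 : ∀ σ h, d σ (σ.add h) = h := fun σ h =>
    (AVSection.add_injective (A := A.dual) σ (hd σ (σ.add h))).symm
  refine ⟨fun σ τ => Γ.pair σ (d σ τ), fun σ h => ?_, fun σ τ h => ?_, fun σ τ => ?_⟩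
  · dsimp only
    rw [h1]
  · obtain ⟨k, rfl⟩ := AVSection.exists_add (A := A.dual) σ τ
    dsimp only
    rw [AVSection.add_add A.dual, h1, h1, hV, hV, hV, map_add]
  · obtain ⟨k, rfl⟩ := AVSection.exists_add (A := A.dual) σ τ
    dsimp only
    -- Skew-symmetry compares {σ, k} with {σ + k, -k}, which is exactly what `hskew` controls.
    have h2 : d (σ.add k) σ = -k := by
      apply AVSection.add_injective (A := A.dual) (σ.add k)
      rw [← hd, AVSection.add_add A.dual, add_neg_cancel, AVSection.add_zero A.dual]
    rw [h1, h2, hV (σ.add k), map_neg, neg_neg, ← hV, hskew]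

/-- The bracket of two sections is {σ, τ - σ}. Skew-symmetry is a pointwise condition on
differentials, so it follows from the sections ι_a. The Jacobi expression involves second
derivatives, but `hJ` shows that it too depends only on differentials. -/
theorem AffineTensor.isAffPoisson_of_iota (Γ : A.AffineTensor) {B : A.SpecialAffgebroidBracket}
    (hB : ∀ a X, iotaFun (B.bracket a X) = Γ.pair (iotaSec a) (iotaFun X)) (h : B.IsLie) :
    Γ.IsAffPoisson := by
  obtain ⟨L, hL, -⟩ := h
  have h0 : ∀ a, L.br a a = 0 := fun a => eq_zero_of_eq_neg (L.skew a a)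
  have hLr : ∀ a X, L.br a (vadd a X) = B.bracket a X := fun a X => by
    rw [L.affine_right, h0, zero_add, hL]
  have hs : ∀ a X, B.bracket (vadd a X) X = B.bracket a X := by
    intro a X
    have h1 := h0 (vadd a X)
    rw [L.affine_right, L.skew, hLr, hL] at h1
    exact (neg_add_eq_zero.1 h1).symm
  have hskew : ∀ σ h, Γ.pair (σ.add h) h = Γ.pair σ h := by
    intro σ h
    ext φ
    obtain ⟨a, ha⟩ := exists_iotaSec_dd_eq (σ.dd φ)
    obtain ⟨X, hX⟩ := exists_iotaFun_dfun_eq (A.dual.dfun h φ)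
    rw [Γ.pair_congr_dd ha.symm hX.symm,
      Γ.pair_congr_dd (AVSection.dd_add_congr (A := A.dual) ha.symm hX.symm) hX.symm,
      ← iotaSec_vadd, ← hB, ← hB, hs]
  obtain ⟨br, hbr1, hbr, hbs⟩ := Γ.exists_bracket_sections hskew
  choose V hV using Γ.exists_derivation_right
  have hbr' : ∀ σ τ h, br (σ.add h) τ = br σ τ - V τ h := by
    intro σ τ h
    rw [hbs, hbr, hbs σ τ, hV]
    ring
  have hι : ∀ a b, br (iotaSec a) (iotaSec b) = iotaFun (L.br a b) := by
    intro a b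
    obtain ⟨X, rfl⟩ := exists_vadd a b
    rw [iotaSec_vadd, hbr1, hLr, hB]
  have hJι : ∀ a b c, Γ.pair (iotaSec a) (br (iotaSec b) (iotaSec c)) +
      Γ.pair (iotaSec b) (br (iotaSec c) (iotaSec a)) +
      Γ.pair (iotaSec c) (br (iotaSec a) (iotaSec b)) = 0 := by
    intro a b c
    rw [hι, hι, hι, ← hB, ← hB, ← hB, ← hL, ← hL, ← hL, ← iotaFun_add, ← iotaFun_add, L.jacobi,
      iotaFun_zero]
  -- Replacing σ by σ + h adds V_τ V_ρ h - V_ρ V_τ h. This is the value of a commutator of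
  -- derivations, hence zero where the differential of h vanishes.
  have hJ : ∀ σ σ' τ ρ φ, σ.dd φ = σ'.dd φ →
      Γ.pair σ (br τ ρ) φ + Γ.pair τ (br ρ σ) φ + Γ.pair ρ (br σ τ) φ =
      Γ.pair σ' (br τ ρ) φ + Γ.pair τ (br ρ σ') φ + Γ.pair ρ (br σ' τ) φ := by
    intro σ σ' τ ρ φ hd
    obtain ⟨h, rfl⟩ := AVSection.exists_add (A := A.dual) σ σ'
    have h1 := (AVSection.dd_add_eq_iff (A := A.dual) σ 0 h φ).1
      (by rw [AVSection.add_zero A.dual]; exact hd)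
    rw [A.dual.dfun_zero] at h1
    have h2 := derivation_comm_apply (A := A.dual) (V τ) (V ρ) h1.symm
    have h3 : Γ.pair τ (br ρ (σ.add h)) φ = Γ.pair τ (br ρ σ) φ + V τ (V ρ h) φ := by
      rw [hbr, hV τ, hV τ, map_add, hV ρ]
      rfl
    have h4 : Γ.pair ρ (br (σ.add h) τ) φ = Γ.pair ρ (br σ τ) φ - V ρ (V τ h) φ := by
      rw [hbr', hV ρ, hV ρ, map_sub]
      rfl
    rw [h3, h4, ← Γ.pair_congr_dd hd rfl, h2]
    ring
  refine ⟨⟨br, Γ.pair, hbr, fun τ => ⟨-(V τ : _ →ₗ[ℝ] _), fun σ h => ?_⟩, hbs, fun σ τ ρ => ?_,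
    fun σ => ⟨V σ, hV σ⟩⟩, fun σ f => rfl⟩
  · rw [hbr', sub_eq_add_neg]
    rfl
  · ext φ
    obtain ⟨a, ha⟩ := exists_iotaSec_dd_eq (σ.dd φ)
    obtain ⟨b, hb⟩ := exists_iotaSec_dd_eq (τ.dd φ)
    obtain ⟨c, hc⟩ := exists_iotaSec_dd_eq (ρ.dd φ)
    -- The arguments are replaced by ι_a, ι_b and ι_c one at a time, using the cyclic symmetry of
    -- the Jacobi expression.
    have h1 := hJ σ _ τ ρ φ ha.symm
    have h2 := hJ τ _ ρ (iotaSec a) φ hb.symm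
    have h3 := hJ ρ _ (iotaSec a) (iotaSec b) φ hc.symm
    have h4 := congrArg (fun f : C^∞⟮𝓘(ℝ, E × (F →L[ℝ] ℝ)), A.dual.Base; ℝ⟯ => f φ) (hJι a b c)
    change Γ.pair _ _ φ + Γ.pair _ _ φ + Γ.pair _ _ φ = 0 at h4
    change Γ.pair _ _ φ + Γ.pair _ _ φ + Γ.pair _ _ φ = 0
    linarith

/-- The Lie bracket is [a, b - a]. Under the injective map ι it becomes the aff-Poisson bracket of
ι_a and ι_b, so its axioms are inherited. -/
theorem AffineTensor.IsAffPoisson.isLie {Γ : A.AffineTensor} {B : A.SpecialAffgebroidBracket}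
    (hB : ∀ a X, iotaFun (B.bracket a X) = Γ.pair (iotaSec a) (iotaFun X)) (h : Γ.IsAffPoisson) :
    B.IsLie := by
  obtain ⟨P, hP⟩ := h
  choose d hd using fun a b : A.Sec => exists_vadd a b
  have hι : ∀ a b, iotaFun (B.bracket a (d a b)) = P.br (iotaSec a) (iotaSec b) := by
    intro a b
    have h0 : P.br (iotaSec a) (iotaSec a) = 0 := eq_zero_of_eq_neg (P.skew _ _)
    conv_rhs => rw [hd a b]
    rw [iotaSec_vadd, P.affine_right, h0, zero_add, hP, hB]
  have hr : ∀ a b X, B.bracket a (d a (vadd b X)) = B.bracket a (d a b) + B.bracket a X := by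
    intro a b X
    apply iotaFun_injective
    rw [iotaFun_add, hι, hι, iotaSec_vadd, P.affine_right, hP, hB]
  have hs : ∀ a b, B.bracket a (d a b) = -B.bracket b (d b a) := by
    intro a b
    apply iotaFun_injective
    rw [iotaFun_neg, hι, hι, P.skew]
  refine ⟨⟨fun a b => B.bracket a (d a b), fun a => (B.linear_right a).mk' _, B.left, hr,
    fun b => ⟨-(B.linear_right b).mk' _, fun a X => ?_⟩, hs, fun a b c => ?_,
    fun a f X x => B.leibniz_right a f X x, B.bracket_vSec⟩, fun a X => rfl, rfl⟩
  · rw [hs, hr, hs a b]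
    change _ = _ + -B.bracket b X
    abel
  · have h1 : ∀ a b c, iotaFun (B.bracket a (B.bracket b (d b c))) =
        P.lin (iotaSec a) (P.br (iotaSec b) (iotaSec c)) := fun a b c => by
      rw [hB, hι, hP]
    change B.bracket a _ + B.bracket b _ + B.bracket c _ = 0
    apply iotaFun_injective
    rw [iotaFun_add, iotaFun_add, h1, h1, h1, P.jacobi, iotaFun_zero]

end

/-! ### The left anchor and the map covered by the morphism. -/

section

variable {A} [SigmaCompactSpace M] [FiniteDimensional ℝ F]

theorem Sec.loc_chart (a : A.Sec) (i : A.Idx) {x₀ x : M} (hx : x ∈ (chartAt E x₀).source) :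
    a.loc i x₀ (chartAt E x₀ x) = A.triv i x (a.1 x) := by
  have : ∀ z, z = x → A.triv i z (a.1 z) = A.triv i x (a.1 x) := by
    rintro z rfl
    rfl
  exact this _ ((chartAt E x₀).left_inv hx)

theorem AffineTensor.mfderiv_fst_sharpAt {Γ : A.AffineTensor} {B : A.SpecialAffgebroidBracket}
    (hB : ∀ a X, iotaFun (B.bracket a X) = Γ.pair (iotaSec a) (iotaFun X)) (a : A.Sec)
    (φ : A.dual.Base) :
    mfderiv 𝓘(ℝ, E × (F →L[ℝ] ℝ)) 𝓘(ℝ, E) (fun c : A.dual.Base => c.1) φ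
      (A.dual.sharpAt (Γ.toFun φ) ((iotaSec a).dd φ)) = B.left.toFun φ.1 (a.1 φ.1) := by
  apply dirDeriv_ext
  intro g
  refine (dfun_pull (A := A.dual) g φ _).symm.trans ?_
  rw [← Γ.pair_apply, AffineBiderivation.pull_eq_iotaFun, ← hB, iotaFun_apply, B.bracket_smulV_vSec,
    linPart_smul, linPart_v, mul_one]

/-- The canonical isomorphism sends an element of PA over the class of c to the differential of some
ι_a with the same y-coordinate. So a at x and c differ by a multiple of v_A, which the left anchor
ignores, and the velocity of the tensor on ι_a projects to the left anchor of a. -/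
theorem SpecialAffgebroid.left_eq {ℰ : A.SpecialAffgebroid} {Γ : A.AffineTensor}
    (hΓ : ∀ α, ℰ.toFun α = Γ.sharp (A.canonicalIso α)) {B : A.SpecialAffgebroidBracket}
    (hB : ∀ a X, iotaFun (B.bracket a X) = Γ.pair (iotaSec a) (iotaFun X)) (x : M) (c : A.Fib x) :
    ℰ.left ⟨x, A.qmk c⟩ = ⟨x, B.left.toFun x c⟩ := by
  obtain ⟨σ⟩ := A.nonempty_avSection
  let b : A.Base := ⟨x, A.qmk c⟩
  obtain ⟨φ, τ, hτ⟩ := exists_ddP_eq (A := A.dual) (A.canonicalIso (σ.ddP b))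
  obtain ⟨a, ha⟩ := exists_iotaSec_dd_eq (τ.dd φ)
  have h1 : Rel (σ.ddP b) ((iotaSec a).ddP φ) := by
    have h2 : (iotaSec a).ddP φ = τ.ddP φ := congrArg (fun q => (⟨φ, q⟩ : A.dual.Phase)) ha
    rw [h2, ← hτ]
    exact rel_canonicalIso _
  obtain ⟨hφ, h2⟩ := h1.coord
  have h3 : ℰ.left b = ⟨φ.1, B.left.toFun φ.1 (a.1 φ.1)⟩ := by
    rw [← AffineTensor.mfderiv_fst_sharpAt hB, ha]
    have h4 := ℰ.comm_left (σ.ddP b)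
    rw [hΓ, hτ] at h4
    exact h4.symm
  refine h3.trans ?_
  have hx := mem_dom_self (A := A) x
  obtain ⟨e, y, p, ξ, h4, -, -, h5⟩ := h2 (A.idx x) x hx
  have h6 := iotaSec_locDeriv a (i := A.idx x) (x₀ := x) (φ := φ)
    (a.differentiableAt_loc (i := A.idx x) (x₀ := x) (by rw [hφ]; exact hx)).hasFDerivAt
  have h7 := apply_bijective.1 (coprod_inj (h6.symm.trans h5)).2
  rw [Sec.loc_chart a (A.idx x) (by rw [hφ]; exact hx.2)] at h7
  have h8 : (A.triv (A.idx x) x c).1 = y := congrArg Prod.snd h4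
  obtain ⟨x', ψ⟩ := φ
  obtain rfl : x' = x := hφ
  have h9 : a.1 x' = ((A.triv (A.idx x') x' (a.1 x')).2 - (A.triv (A.idx x') x' c).2) • A.v x' +ᵥ
      c := by
    apply (A.triv (A.idx x') x').injective
    rw [A.triv_smul_v_vadd]
    exact Prod.ext (h7.trans h8.symm) (by simp)
  have h10 : B.left.toFun x' (a.1 x') = B.left.toFun x' c := by
    rw [h9, B.left_vadd_v]
  exact congrArg (fun w => (⟨x', w⟩ : TangentBundle 𝓘(ℝ, E) M)) h10

end

end SpecialAffineBundle

end

/-! ### The main theorem. -/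

theorem mainTheorem2
    {E : Type*} [NormedAddCommGroup E] [NormedSpace ℝ E] [FiniteDimensional ℝ E]
    {M : Type*} [TopologicalSpace M] [ChartedSpace E M] [IsManifold 𝓘(ℝ, E) ∞ M]
    [T2Space M] [SigmaCompactSpace M]
    {F : Type*} [NormedAddCommGroup F] [NormedSpace ℝ F] [FiniteDimensional ℝ F]
    (A : SpecialAffineBundle E M F) :
    ∃ R : A.Phase ≃ A.dual.Phase, SpecialAffineBundle.IsCanonicalIso R ∧
    ∃ (tensor : A.SpecialAffgebroid ≃ A.AffineTensor)
      (bracket : A.SpecialAffgebroid ≃ A.SpecialAffgebroidBracket)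
      (bider : A.SpecialAffgebroid → A.AffineBiderivation),
      -- the tensor and the biderivation of a special affgebroid
      (∀ ℰ Γ, tensor ℰ = Γ ↔ ∀ α, ℰ.toFun α = Γ.sharp (R α)) ∧
      (∀ ℰ D, bider ℰ = D ↔ ∀ σ f, D.br σ f = (tensor ℰ).pair σ f) ∧
      -- bracket, tensor and biderivation determine one another on sections of `A` and `V(A)`
      (∀ ℰ B, bracket ℰ = B ↔ ∀ a X, SpecialAffineBundle.iotaFun (B.bracket a X) =
        (tensor ℰ).pair (SpecialAffineBundle.iotaSec a) (SpecialAffineBundle.iotaFun X)) ∧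
      (∀ ℰ Γ, tensor ℰ = Γ ↔ ∀ a X,
        Γ.pair (SpecialAffineBundle.iotaSec a) (SpecialAffineBundle.iotaFun X) =
          SpecialAffineBundle.iotaFun ((bracket ℰ).bracket a X)) ∧
      (∀ ℰ D, bider ℰ = D ↔ ∀ a X,
        D.br (SpecialAffineBundle.iotaSec a) (SpecialAffineBundle.iotaFun X) =
          SpecialAffineBundle.iotaFun ((bracket ℰ).bracket a X)) ∧
      Function.Injective bider ∧ (Nontrivial F → Function.Surjective bider) ∧
      -- the left anchor is the map covered by the morphism
      (∀ (ℰ : A.SpecialAffgebroid) (x : M) (a : A.Fib x), ℰ.left ⟨x, A.qmk a⟩ = ⟨x, (bracket ℰ).left.toFun x a⟩) ∧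
      -- the Lie case
      (∀ ℰ, (bracket ℰ).IsLie ↔ (tensor ℰ).IsAffPoisson) := by
  choose t ht using fun ℰ : A.SpecialAffgebroid =>
    SpecialAffineBundle.exists_affineTensor_of_affgebroid ℰ
  choose β hβ using fun Γ : A.AffineTensor => SpecialAffineBundle.exists_bracket_of_affineTensor Γ
  have htu : ∀ ℰ Γ, t ℰ = Γ ↔ ∀ α, ℰ.toFun α = Γ.sharp (A.canonicalIso α) := by
    refine fun ℰ Γ => ⟨fun h => h ▸ ht ℰ, fun h => ?_⟩
    refine SpecialAffineBundle.AffineTensor.ext_sharp fun b => ?_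
    rw [← A.canonicalIso.apply_symm_apply b, ← ht, h]
  have htb : Function.Bijective t := by
    refine ⟨fun ℰ ℰ' h => ?_, fun Γ => ?_⟩
    · refine SpecialAffineBundle.SpecialAffgebroid.ext_toFun fun α => ?_
      rw [ht, ht, h]
    · obtain ⟨ℰ, hℰ⟩ := SpecialAffineBundle.exists_affgebroid_of_affineTensor Γ
      exact ⟨ℰ, (htu ℰ Γ).2 hℰ⟩
  have hβu : ∀ Γ B, β Γ = B ↔ ∀ a X, SpecialAffineBundle.iotaFun (B.bracket a X) =
      Γ.pair (SpecialAffineBundle.iotaSec a) (SpecialAffineBundle.iotaFun X) := by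
    refine fun Γ B => ⟨fun h => h ▸ hβ Γ, fun h => ?_⟩
    refine SpecialAffineBundle.SpecialAffgebroidBracket.ext_bracket fun a X => ?_
    apply SpecialAffineBundle.iotaFun_injective
    rw [hβ, h]
  have hβb : Function.Bijective β := by
    refine ⟨fun Γ Γ' h => ?_, fun B => ?_⟩
    · refine SpecialAffineBundle.AffineTensor.pair_congr fun a X => ?_
      rw [← hβ, ← hβ, h]
    · obtain ⟨Γ, hΓ⟩ := SpecialAffineBundle.exists_affineTensor_of_bracket B
      exact ⟨Γ, (hβu Γ B).2 fun a X => (hΓ a X).symm⟩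
  refine ⟨A.canonicalIso, SpecialAffineBundle.isCanonicalIso_canonicalIso,
    Equiv.ofBijective t htb, (Equiv.ofBijective t htb).trans (Equiv.ofBijective β hβb),
    fun ℰ => (t ℰ).toBiderivation, htu, fun ℰ D => ⟨?_, fun h => ?_⟩, fun ℰ B => hβu (t ℰ) B,
    fun ℰ Γ => ⟨?_, fun h => ?_⟩, fun ℰ D => ⟨?_, fun h => ?_⟩, fun ℰ ℰ' h => ?_, fun hF D => ?_,
    fun ℰ x c => SpecialAffineBundle.SpecialAffgebroid.left_eq (ht ℰ) (hβ (t ℰ)) x c,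
    fun ℰ => ⟨(t ℰ).isAffPoisson_of_iota (hβ (t ℰ)), fun h => h.isLie (hβ (t ℰ))⟩⟩
  · rintro rfl σ f
    rfl
  · apply SpecialAffineBundle.AffineBiderivation.ext
    funext σ f
    exact (h σ f).symm
  · rintro rfl a X
    exact (hβ (t ℰ) a X).symm
  · refine SpecialAffineBundle.AffineTensor.pair_congr fun a X => ?_
    rw [h]
    exact (hβ (t ℰ) a X).symm
  · rintro rfl a X
    exact (hβ (t ℰ) a X).symm
  · refine SpecialAffineBundle.AffineBiderivation.ext_iota fun a X => ?_
    rw [h]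
    exact (hβ (t ℰ) a X).symm
  -- Equal biderivations agree in particular on the ι_a and ι_X, which already determine the tensor.
  · apply htb.1
    refine SpecialAffineBundle.AffineTensor.pair_congr fun a X => ?_
    exact congrFun (congrFun (congrArg SpecialAffineBundle.AffineBiderivation.br h) _) _
  -- The only place where the rank matters: nontriviality of F supplies the condition on pull-backs,
  -- after which the biderivation yields a bracket, then a tensor, then a special affgebroid with
  -- the same values on ι_a and ι_X.
  · obtain ⟨B, hB⟩ := D.exists_bracket D.br_add_pull_pull
    obtain ⟨Γ, hΓ⟩ := SpecialAffineBundle.exists_affineTensor_of_bracket B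
    obtain ⟨ℰ, rfl⟩ := htb.2 Γ
    refine ⟨ℰ, SpecialAffineBundle.AffineBiderivation.ext_iota fun a X => ?_⟩
    rw [← hB]
    exact hΓ a X
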